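/- **Setting.** Let $\mathcal X,\mathcal Y,\mathcal Z_1,\mathcal Z_2$ be finite sets, $q_{XY}$ a p.m.f. on $\mathcal X\times\mathcal Y$, $q_{Z_1Z_2|XY}$ a conditional p.m.f., and $r\ge 1$. For each blocklength $n$, Alice holds $X^n$ and Bob holds $Y^n$, where the pairs $(X_t,Y_t)$ are i.i.d. with law $q_{XY}$; both know $W$, uniform on a finite set of size $K_n\ge1$ (an arbitrary fixed sequence, e.g. $K_n=2^{nR_0}$) and independent of $(X^n,Y^n)$. An $r$-round protocol $\Pi_n$ in which Alice starts consists of finite message alphabets $\mathcal M_1,\dots,\mathcal M_r$, randomized encoders $p(m_i|x^n,w,m_{[1:i-1]})$ for odd $i$ (Alice) and $p(m_i|y^n,w,m_{[1:i-1]})$ for even $i$ (Bob), and randomized decoders $p(z_1^n|x^n,w,m_{[1:r]})$ (Alice) and $p(z_2^n|y^n,w,m_{[1:r]})$ (Bob). Together with the laws of the inputs and of $W$ these induce a joint law $p$ of $(W,X^n,Y^n,M_{[1:r]},Z_1^n,Z_2^n)$. Call $\Pi_n$ *$\varepsilon$-secure* if $$\Big\|p_{X^nY^nZ_1^nZ_2^n}-\prod_{t=1}^n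 q_{XY}\,q_{Z_1Z_2|XY}\Big\|_1\le\varepsilon,\quad I(M_{[1:r]},W;Y^n,Z_2^n|X^n,Z_1^n)\le n\varepsilon,\quad I(M_{[1:r]},W;X^n,Z_1^n|Y^n,Z_2^n)\le n\varepsilon .$$ The function $(q_{XY},q_{Z_1Z_2|XY})$ is *asymptotically securely computable in $r$ rounds* (Alice starting, privacy against both users) if there is a sequence of such protocols $\Pi_n$ such that for every $\varepsilon>0$ the protocol $\Pi_n$ is $\varepsilon$-secure for all sufficiently large $n$. It is *one-shot perfectly securely computable in $r$ rounds* if there is such a protocol with $n=1$ that is $0$-secure. **Theorem.** (i) The following are equivalent: (a) $(q_{XY},q_{Z_1Z_2|XY})$ is asymptotically securely computable in $r$ rounds; (b) for every $\varepsilon>0$ there are some $n\ge1$ and an $r$-round protocol of blocklength $n$ that is $\varepsilon$-secure; (c) $(q_{XY},q_{Z_1Z_2|XY})$ is one-shot perfectly securely computable in $r$ rounds; (d) there are a conditional p.m.f. $p(u_{[1:r]}|x,y,z_1,z_2)$ and finite alphabets $\mathcal U_1,\dots,\mathcal U_r$ such that, under $q_{XY}\,q_{Z_1Z_2|XY}\,p(u_{[1:r]}|x,y,z_1,z_2)$,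 the following are Markov chains: $$U_i-(U_{[1:i-1]},X)-Y\ (i\text{ odd}),\qquad U_i-(U_{[1:i-1]},Y)-X\ (i\text{ even}),$$ $$Z_1-(U_{[1:r]},X)-(Y,Z_2),\qquad Z_2-(U_{[1:r]},Y)-(X,Z_1),$$ $$U_{[1:r]}-(X,Z_1)-(Y,Z_2),\qquad U_{[1:r]}-(Y,Z_2)-(X,Z_1),$$ and $|\mathcal U_1|\le|\mathcal X||\mathcal Y||\mathcal Z_1||\mathcal Z_2|+1$, $|\mathcal U_i|\le|\mathcal X||\mathcal Y||\mathcal Z_1||\mathcal Z_2|\prod_{j=1}^{i-1}|\mathcal U_j|+1$ for $i>1$. (ii) If $(q_{XY},q_{Z_1Z_2|XY})$ is asymptotically securely computable in $r$ rounds and $\tilde q_{XY}$ is a p.m.f. on $\mathcal X\times\mathcal Y$ with $\operatorname{supp}(\tilde q_{XY})\subseteq\operatorname{supp}(q_{XY})$, then $(\tilde q_{XY},q_{Z_1Z_2|XY})$ is asymptotically securely computable in $r$ rounds. -/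

import Mathlib

namespace SecureComputation

noncomputable section

/-! Finite information theory. A probability mass function on a finite type `Ω` is a function
`P : Ω → ℝ` with `P ∈ stdSimplex ℝ Ω`; random variables are functions on `Ω`. -/

open Classical in
/-- The law of the random variable `A` under `P`, i.e. `a ↦ P(A = a)`. -/
def law {Ω α : Type*} [Fintype Ω] (P : Ω → ℝ) (A : Ω → α) (a : α) : ℝ :=
  ∑ ω, if A ω = a then P ω else 0

/-- Shannon entropy `H(A)` (in nats). -/
def entropy {Ω α : Type*} [Fintype Ω] [Fintype α] (P : Ω → ℝ) (A : Ω → α) : ℝ :=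
  ∑ a, Real.negMulLog (law P A a)

/-- Conditional mutual information `I(A ; B | C) = H(A,C) + H(B,C) - H(A,B,C) - H(C)`. -/
def condMutualInfo {Ω α β γ : Type*} [Fintype Ω] [Fintype α] [Fintype β] [Fintype γ]
    (P : Ω → ℝ) (A : Ω → α) (B : Ω → β) (C : Ω → γ) : ℝ :=
  entropy P (fun ω => (A ω, C ω)) + entropy P (fun ω => (B ω, C ω))
    - entropy P (fun ω => (A ω, B ω, C ω)) - entropy P C

/-- The Markov chain `A - B - C`: `P(a,b,c) P(b) = P(a,b) P(b,c)` for all values, that is, `A` and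
`C` are conditionally independent given `B`. -/
def MarkovChain {Ω α β γ : Type*} [Fintype Ω]
    (P : Ω → ℝ) (A : Ω → α) (B : Ω → β) (C : Ω → γ) : Prop :=
  ∀ a b c, law P (fun ω => (A ω, B ω, C ω)) (a, b, c) * law P B b =
    law P (fun ω => (A ω, B ω)) (a, b) * law P (fun ω => (B ω, C ω)) (b, c)

/-- The part of a message (or auxiliary) vector strictly before round `i`. -/
def past {r : ℕ} {m : Fin r → ℕ} (u : (j : Fin r) → Fin (m j)) (i : Fin r) :
    (j : Set.Iio i) → Fin (m j) :=
  fun j => u j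

/-! Protocols. Rounds are indexed by `Fin r`, so that the `(i+1)`-st round has index `i`; the odd
rounds (Alice's) are the ones with even index. -/

/-- An `r`-round protocol of blocklength `n` in which Alice starts. The common randomness takes
values in `Fin K`, and the message of round `i` in the finite alphabet `Fin (m i)`.
`encA i x w u` is the p.m.f. of the message of round `i` given Alice's input sequence `x`, the
common randomness `w` and the previous messages `u`; only its values in Alice's rounds matter.
Likewise `encB` for Bob. `decA`, `decB` are the randomized decoders. -/
structure Protocol (X Y Z₁ Z₂ : Type*) [Fintype Z₁] [Fintype Z₂] (n r K : ℕ) where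
  m : Fin r → ℕ
  encA : (i : Fin r) → (Fin n → X) → Fin K → ((j : Set.Iio i) → Fin (m j)) → Fin (m i) → ℝ
  encB : (i : Fin r) → (Fin n → Y) → Fin K → ((j : Set.Iio i) → Fin (m j)) → Fin (m i) → ℝ
  decA : (Fin n → X) → Fin K → ((j : Fin r) → Fin (m j)) → (Fin n → Z₁) → ℝ
  decB : (Fin n → Y) → Fin K → ((j : Fin r) → Fin (m j)) → (Fin n → Z₂) → ℝ
  encA_pmf : ∀ i : Fin r, Even (i : ℕ) → ∀ x w u, encA i x w u ∈ stdSimplex ℝ (Fin (m i))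
  encB_pmf : ∀ i : Fin r, ¬ Even (i : ℕ) → ∀ y w u, encB i y w u ∈ stdSimplex ℝ (Fin (m i))
  decA_pmf : ∀ x w u, decA x w u ∈ stdSimplex ℝ (Fin n → Z₁)
  decB_pmf : ∀ y w u, decB y w u ∈ stdSimplex ℝ (Fin n → Z₂)

section

variable {X Y Z₁ Z₂ : Type*} [Fintype X] [Fintype Y] [Fintype Z₁] [Fintype Z₂]

/-- One outcome `(w, xⁿ, yⁿ, m_{[1:r]}, z₁ⁿ, z₂ⁿ)` of an execution of a protocol. -/
@[ext] structure Outcome (X Y Z₁ Z₂ : Type*) (n K : ℕ) {r : ℕ} (m : Fin r → ℕ) where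
  w : Fin K
  x : Fin n → X
  y : Fin n → Y
  msg : (j : Fin r) → Fin (m j)
  z₁ : Fin n → Z₁
  z₂ : Fin n → Z₂

/-- Outcomes are tuples. -/
def Outcome.equiv (X Y Z₁ Z₂ : Type*) (n K : ℕ) {r : ℕ} (m : Fin r → ℕ) :
    Outcome X Y Z₁ Z₂ n K m ≃ Fin K × (Fin n → X) × (Fin n → Y) × ((j : Fin r) → Fin (m j)) ×
      (Fin n → Z₁) × (Fin n → Z₂) where
  toFun ω := (ω.w, ω.x, ω.y, ω.msg, ω.z₁, ω.z₂)
  invFun t := ⟨t.1, t.2.1, t.2.2.1, t.2.2.2.1, t.2.2.2.2.1, t.2.2.2.2.2⟩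
  left_inv _ := rfl
  right_inv _ := rfl

instance (n K : ℕ) {r : ℕ} (m : Fin r → ℕ) : Fintype (Outcome X Y Z₁ Z₂ n K m) :=
  Fintype.ofEquiv _ (Outcome.equiv X Y Z₁ Z₂ n K m).symm

namespace Protocol

variable {n r K : ℕ}

/-- The joint distribution of `(W, Xⁿ, Yⁿ, M_{[1:r]}, Z₁ⁿ, Z₂ⁿ)` induced by the protocol: the inputs
are i.i.d. with law `q`, and `W` is uniform and independent of them. -/
def induced (π : Protocol X Y Z₁ Z₂ n r K) (q : X × Y → ℝ) (ω : Outcome X Y Z₁ Z₂ n K π.m) : ℝ :=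
  (K : ℝ)⁻¹ * (∏ t, q (ω.x t, ω.y t)) *
    (∏ i : Fin r, if Even (i : ℕ) then π.encA i ω.x ω.w (past ω.msg i) (ω.msg i)
      else π.encB i ω.y ω.w (past ω.msg i) (ω.msg i)) *
    π.decA ω.x ω.w ω.msg ω.z₁ * π.decB ω.y ω.w ω.msg ω.z₂

/-- The protocol computes `κ` on inputs of law `q` up to `ε`: the induced law of
`(Xⁿ, Yⁿ, Z₁ⁿ, Z₂ⁿ)` is within `ε` in `ℓ¹` of the ideal i.i.d. law, and the two information leakages
(to Alice and to Bob, respectively) are at most `n ε`. -/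
def SecureWithin (π : Protocol X Y Z₁ Z₂ n r K) (q : X × Y → ℝ) (κ : X × Y → Z₁ × Z₂ → ℝ)
    (ε : ℝ) : Prop :=
  (∑ a : (Fin n → X) × (Fin n → Y) × (Fin n → Z₁) × (Fin n → Z₂),
      |law (π.induced q) (fun ω => (ω.x, ω.y, ω.z₁, ω.z₂)) a -
        ∏ t, q (a.1 t, a.2.1 t) * κ (a.1 t, a.2.1 t) (a.2.2.1 t, a.2.2.2 t)|) ≤ ε ∧
  condMutualInfo (π.induced q) (fun ω => (ω.msg, ω.w)) (fun ω => (ω.y, ω.z₂))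
      (fun ω => (ω.x, ω.z₁)) ≤ n * ε ∧
  condMutualInfo (π.induced q) (fun ω => (ω.msg, ω.w)) (fun ω => (ω.x, ω.z₁))
      (fun ω => (ω.y, ω.z₂)) ≤ n * ε

end Protocol

/-- `(q, κ)` is asymptotically securely computable in `r` rounds, Alice starting, with privacy
against both users, the common randomness at blocklength `n` being uniform on `K n` values: there
is a sequence of protocols that for every `ε > 0` is `ε`-secure at all large blocklengths. -/
def AsymptoticallySecurelyComputable (r : ℕ) (K : ℕ → ℕ) (q : X × Y → ℝ)
    (κ : X × Y → Z₁ × Z₂ → ℝ) : Prop :=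
  ∃ π : (n : ℕ) → Protocol X Y Z₁ Z₂ n r (K n),
    ∀ ε : ℝ, 0 < ε → ∃ N : ℕ, ∀ n, N ≤ n → (π n).SecureWithin q κ ε

/-- The weakest form of asymptotic secure computability: for every `ε > 0`, some protocol of some
blocklength `n ≥ 1` is `ε`-secure. -/
def SecurelyComputableAtSomeBlocklength (r : ℕ) (K : ℕ → ℕ) (q : X × Y → ℝ)
    (κ : X × Y → Z₁ × Z₂ → ℝ) : Prop :=
  ∀ ε : ℝ, 0 < ε → ∃ n : ℕ, 1 ≤ n ∧ ∃ π : Protocol X Y Z₁ Z₂ n r (K n), π.SecureWithin q κ ε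

/-- `(q, κ)` is (one-shot) perfectly securely computable in `r` rounds, Alice starting: there is a
protocol of blocklength one with no error and no leakage. -/
def PerfectlySecurelyComputable (r : ℕ) (K : ℕ → ℕ) (q : X × Y → ℝ)
    (κ : X × Y → Z₁ × Z₂ → ℝ) : Prop :=
  ∃ π : Protocol X Y Z₁ Z₂ 1 r (K 1), π.SecureWithin q κ 0

/-- The joint distribution `q(x,y) κ(z₁,z₂|x,y) p(u|x,y,z₁,z₂)` of `(X, Y, Z₁, Z₂, U_{[1:r]})`. -/
def auxJoint {r : ℕ} {c : Fin r → ℕ} (q : X × Y → ℝ) (κ : X × Y → Z₁ × Z₂ → ℝ)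
    (p : X × Y × Z₁ × Z₂ → ((i : Fin r) → Fin (c i)) → ℝ)
    (ω : X × Y × Z₁ × Z₂ × ((i : Fin r) → Fin (c i))) : ℝ :=
  match ω with
  | (x, y, z₁, z₂, u) => q (x, y) * κ (x, y) (z₁, z₂) * p (x, y, z₁, z₂) u

/-- There is a conditional p.m.f. `p(u_{[1:r]}|x,y,z₁,z₂)`, with `U_i` in an alphabet of size `c i`,
satisfying the interaction, decoding and privacy Markov chains and the cardinality bounds (the
product is `1` in the first round). -/
def HasAuxiliaries (r : ℕ) (q : X × Y → ℝ) (κ : X × Y → Z₁ × Z₂ → ℝ) : Prop :=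
  ∃ (c : Fin r → ℕ) (p : X × Y × Z₁ × Z₂ → ((i : Fin r) → Fin (c i)) → ℝ),
    (∀ a, p a ∈ stdSimplex ℝ ((i : Fin r) → Fin (c i))) ∧
    (∀ i : Fin r, Even (i : ℕ) →
      MarkovChain (auxJoint q κ p) (fun (_, _, _, _, u) => u i)
        (fun (x, _, _, _, u) => (past u i, x)) (fun (_, y, _, _, _) => y)) ∧
    (∀ i : Fin r, ¬ Even (i : ℕ) →
      MarkovChain (auxJoint q κ p) (fun (_, _, _, _, u) => u i)
        (fun (_, y, _, _, u) => (past u i, y)) (fun (x, _, _, _, _) => x)) ∧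
    MarkovChain (auxJoint q κ p) (fun (_, _, z₁, _, _) => z₁)
      (fun (x, _, _, _, u) => (u, x)) (fun (_, y, _, z₂, _) => (y, z₂)) ∧
    MarkovChain (auxJoint q κ p) (fun (_, _, _, z₂, _) => z₂)
      (fun (_, y, _, _, u) => (u, y)) (fun (x, _, z₁, _, _) => (x, z₁)) ∧
    MarkovChain (auxJoint q κ p) (fun (_, _, _, _, u) => u)
      (fun (x, _, z₁, _, _) => (x, z₁)) (fun (_, y, _, z₂, _) => (y, z₂)) ∧
    MarkovChain (auxJoint q κ p) (fun (_, _, _, _, u) => u)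
      (fun (_, y, _, z₂, _) => (y, z₂)) (fun (x, _, z₁, _, _) => (x, z₁)) ∧
    (∀ i : Fin r, c i ≤ Fintype.card X * Fintype.card Y * Fintype.card Z₁ * Fintype.card Z₂ *
      (∏ j ∈ Finset.Iio i, c j) + 1)

end

end

end SecureComputation

/-! The hard direction reduces a long protocol to one letter. Fix a time `t` and call `W`, the
letters of `X` before `t` and the letters of `Y` after `t` the context. Given context and messages,
the two users' sequences are coupled only through the letters at `t`, so the law of these letters
factors as `q(x,y) a(x,z₁) b(y,z₂)` (`letterLaw_eq`). This gives the decoding chains, and the same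
factorization for the first few rounds gives the interaction chains. The context can join the first
message, since Bob has not yet spoken and it tells nothing about `Y_t` beyond `X_t`. The chain rule,
run over suffixes for one leakage and over prefixes for the other, and continuity of entropy bound
the average single-letter leakage by a quantity that vanishes with `ε` (`sum_condEntropy_sub_le`);
some `t` is at least as good as the average.

Context and messages live in alphabets that grow with `n`. The leakage at `t` is the drop of a
homogeneous functional, `leakPotential`, when the letter law is split according to context and
messages. Carathéodory's theorem for pairs (law, potential), applied from the last round to the
first, therefore cuts every alphabet to `|X||Y||Z₁||Z₂| + 1` without changing the law or the total
potential (`reachable_succ_of_sum`). With the alphabets fixed, compactness yields a limit as `ε →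
0`. The Markov conditions are polynomial equations and survive; the limit has no leakage, and
equality in "conditioning reduces entropy" becomes the privacy chains
(`exists_isAuxiliary_of_approx`).

Conversely, the conditional laws of the auxiliaries are encoders and decoders of a one-letter
protocol. On the support of `q` its transition probabilities equal `κ` times a function of the
messages and Alice's pair, and also `κ` times a function of the messages and Bob's pair. These
identities involve `q` only through its support, so independent repetition is perfectly secure at
every blocklength and for every input law supported there (`LetterProtocol.secureWithin_repeated`).
-/

namespace SecureComputation

open Real Finset

/-! Laws of random variables on a finite space. -/

section Law

variable {Ω α β γ ι : Type*} [Fintype Ω]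

theorem law_apply [DecidableEq α] (P : Ω → ℝ) (A : Ω → α) (a : α) :
    law P A a = ∑ ω, if A ω = a then P ω else 0 := by
  unfold law
  exact Finset.sum_congr rfl fun ω _ => by congr

theorem law_nonneg {P : Ω → ℝ} (hP : ∀ ω, 0 ≤ P ω) (A : Ω → α) (a : α) : 0 ≤ law P A a := by
  classical
  rw [law_apply]
  exact Finset.sum_nonneg fun ω _ => by split_ifs <;> simp [hP]

theorem sum_law_mul [Fintype α] (P : Ω → ℝ) (A : Ω → α) (f : α → ℝ) :
    ∑ a, law P A a * f a = ∑ ω, P ω * f (A ω) := by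
  classical
  simp only [law_apply, Finset.sum_mul]
  rw [Finset.sum_comm]
  refine Finset.sum_congr rfl fun ω _ => ?_
  simp [ite_mul]

theorem sum_law [Fintype α] (P : Ω → ℝ) (A : Ω → α) : ∑ a, law P A a = ∑ ω, P ω := by
  simpa using sum_law_mul P A fun _ => 1

theorem law_mem_stdSimplex [Fintype α] {P : Ω → ℝ} (hP : P ∈ stdSimplex ℝ Ω) (A : Ω → α) :
    law P A ∈ stdSimplex ℝ α :=
  ⟨law_nonneg hP.1 A, (sum_law P A).trans hP.2⟩

theorem law_law [Fintype α] (P : Ω → ℝ) (A : Ω → α) (f : α → β) :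
    law (law P A) f = law P fun ω => f (A ω) := by
  classical
  ext b
  have := sum_law_mul P A fun a => if f a = b then 1 else 0
  simpa [law_apply] using this

theorem law_id (P : Ω → ℝ) : law P (fun ω => ω) = P := by
  classical
  ext ω
  simp [law_apply]

theorem law_comp_of_injective (P : Ω → ℝ) (A : Ω → α) {f : α → β} (hf : f.Injective) (a : α) :
    law P (fun ω => f (A ω)) (f a) = law P A a := by
  classical
  simp [law_apply, hf.eq_iff]

theorem law_eq_sum_right [Fintype β] (P : Ω → ℝ) (A : Ω → α) (B : Ω → β) (a : α) :
    law P A a = ∑ b, law P (fun ω => (A ω, B ω)) (a, b) := by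
  classical
  simp only [law_apply]
  rw [Finset.sum_comm]
  refine Finset.sum_congr rfl fun ω _ => ?_
  simp [Prod.ext_iff, ite_and, Finset.sum_ite_irrel]

theorem law_eq_sum_left [Fintype β] (P : Ω → ℝ) (A : Ω → α) (B : Ω → β) (a : α) :
    law P A a = ∑ b, law P (fun ω => (B ω, A ω)) (b, a) := by
  rw [law_eq_sum_right P A B]
  exact Finset.sum_congr rfl fun b _ => (law_comp_of_injective P _ Prod.swap_injective _).symm

theorem law_sum (s : Finset ι) (P : ι → Ω → ℝ) (A : Ω → α) (a : α) :
    law (∑ i ∈ s, P i) A a = ∑ i ∈ s, law (P i) A a := by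
  classical
  simp only [law_apply, Finset.sum_apply]
  rw [Finset.sum_comm]
  refine Finset.sum_congr rfl fun ω _ => ?_
  split_ifs <;> simp

theorem law_smul (t : ℝ) (P : Ω → ℝ) (A : Ω → α) (a : α) : law (t • P) A a = t * law P A a := by
  classical
  simp [law_apply, Finset.mul_sum]

theorem law_zero (A : Ω → α) (a : α) : law (0 : Ω → ℝ) A a = 0 := by
  classical
  simp [law_apply]

theorem continuous_law (A : Ω → α) (a : α) : Continuous fun P : Ω → ℝ => law P A a := by
  classical
  simp only [law_apply]
  refine continuous_finsetSum _ fun ω _ => ?_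
  split_ifs <;> fun_prop

theorem law_pos {P : Ω → ℝ} (hP : ∀ ω, 0 ≤ P ω) (A : Ω → α) {ω : Ω} (h : 0 < P ω) :
    0 < law P A (A ω) := by
  classical
  rw [law_apply]
  refine Finset.sum_pos' (fun ω _ => by split_ifs <;> simp [hP]) ⟨ω, Finset.mem_univ _, ?_⟩
  simpa using h

/-- A random variable matters only through the partition it induces; every reordering and regrouping
of tuples below rests on this. -/
theorem law_congr_ker (P : Ω → ℝ) {A : Ω → α} {B : Ω → β}
    (h : ∀ ω ω', A ω = A ω' ↔ B ω = B ω') (ω : Ω) : law P A (A ω) = law P B (B ω) := by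
  classical
  simp [law_apply, h]

theorem law_le_of_comp {P : Ω → ℝ} (hP : ∀ ω, 0 ≤ P ω) (A : Ω → α) (f : α → β) (a : α) :
    law P A a ≤ law P (fun ω => f (A ω)) (f a) := by
  classical
  simp only [law_apply]
  refine Finset.sum_le_sum fun ω _ => ?_
  split_ifs with h h' h'
  · exact le_rfl
  · exact absurd (by rw [h]) h'
  · exact hP ω
  · exact le_rfl

theorem sum_abs_law_sub_le [Fintype α] (P Q : Ω → ℝ) (A : Ω → α) :
    ∑ a, |law P A a - law Q A a| ≤ ∑ ω, |P ω - Q ω| := by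
  classical
  have h := sum_law (fun ω => |P ω - Q ω|) A
  rw [← h]
  refine Finset.sum_le_sum fun a _ => ?_
  simp only [law_apply, ← Finset.sum_sub_distrib]
  refine (Finset.abs_sum_le_sum_abs _ _).trans (Finset.sum_le_sum fun ω _ => ?_)
  split_ifs <;> simp

end Law

/-! Entropy. -/

section Entropy

set_option linter.unusedSectionVars false

variable {Ω α β γ δ : Type*} [Fintype Ω] [Fintype α] [Fintype β] [Fintype γ] [Fintype δ]

theorem entropy_eq_sum (P : Ω → ℝ) (A : Ω → α) :
    entropy P A = -∑ ω, P ω * log (law P A (A ω)) := by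
  rw [← sum_law_mul P A fun a => log (law P A a), ← Finset.sum_neg_distrib]
  simp [entropy, negMulLog]

theorem entropy_congr_ker (P : Ω → ℝ) {A : Ω → α} {B : Ω → β}
    (h : ∀ ω ω', A ω = A ω' ↔ B ω = B ω') : entropy P A = entropy P B := by
  simp only [entropy_eq_sum, law_congr_ker P h]

theorem entropy_law (P : Ω → ℝ) (A : Ω → α) (f : α → β) :
    entropy (law P A) f = entropy P fun ω => f (A ω) := by
  simp only [entropy, law_law]

theorem entropy_smul {P : Ω → ℝ} (t : ℝ) (A : Ω → α) :
    entropy (t • P) A = t * entropy P A + (∑ ω, P ω) * negMulLog t := by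
  simp only [entropy, law_smul, negMulLog_mul, Finset.sum_add_distrib, ← Finset.mul_sum,
    ← Finset.sum_mul, sum_law]
  ring

theorem continuous_entropy (A : Ω → α) : Continuous fun P : Ω → ℝ => entropy P A :=
  continuous_finsetSum _ fun a _ => continuous_negMulLog.comp (continuous_law A a)

/-- This is `log x ≤ x - 1` at `x = s / a`. Summed over two families of equal mass it is Gibbs'
inequality. The last hypothesis excludes `s = 0 < a`, where the convention `log 0 = 0` would spoil
the bound. -/
theorem sub_le_mul_log_div {a s : ℝ} (ha : 0 ≤ a) (hs : 0 ≤ s) (h : s = 0 → a = 0) :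
    a - s ≤ a * (log a - log s) := by
  rcases ha.eq_or_lt with rfl | ha
  · simpa using hs
  have hs' : 0 < s := hs.lt_of_ne fun h0 => ha.ne' (h h0.symm)
  have := log_le_sub_one_of_pos (div_pos hs' ha)
  rw [log_div hs'.ne' ha.ne'] at this
  have h2 := mul_le_mul_of_nonneg_left this ha.le
  have h3 : a * (s / a - 1) = s - a := by field_simp
  linarith

theorem eq_of_mul_log_div_eq {a s : ℝ} (ha : 0 ≤ a) (h : s = 0 → a = 0) (hs : 0 ≤ s)
    (he : a * (log a - log s) = a - s) : a = s := by
  rcases ha.eq_or_lt with rfl | ha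
  · linarith
  have hs' : 0 < s := hs.lt_of_ne fun h0 => ha.ne' (h h0.symm)
  by_contra hne
  have hne' : s / a ≠ 1 := fun h1 => hne ((div_eq_one_iff_eq ha.ne').1 h1).symm
  have := log_lt_sub_one_of_pos (div_pos hs' ha) hne'
  rw [log_div hs'.ne' ha.ne'] at this
  have h2 := mul_lt_mul_of_pos_left this ha
  have h3 : a * (s / a - 1) = s - a := by field_simp
  linarith

/-- The pointwise form of `H(B|f(D)) - H(B|D)`. -/
theorem entropy_comp_sub_entropy_eq {P : Ω → ℝ} (hP : ∀ ω, 0 ≤ P ω) (B : Ω → β) (D : Ω → δ)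
    (f : δ → γ) :
    entropy P (fun ω => (B ω, f (D ω))) - entropy P (fun ω => f (D ω))
        - (entropy P (fun ω => (B ω, D ω)) - entropy P D) =
      ∑ x : β × δ, law P (fun ω => (B ω, D ω)) x *
        (log (law P (fun ω => (B ω, D ω)) x) -
          log (law P (fun ω => (B ω, f (D ω))) (x.1, f x.2) * law P D x.2 /
            law P (fun ω => f (D ω)) (f x.2))) := by
  rw [sum_law_mul P (fun ω => (B ω, D ω)) fun x => (log (law P (fun ω => (B ω, D ω)) x) -
          log (law P (fun ω => (B ω, f (D ω))) (x.1, f x.2) * law P D x.2 /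
            law P (fun ω => f (D ω)) (f x.2)))]
  simp only [entropy_eq_sum]
  rw [← sub_eq_zero]
  simp only [← Finset.sum_neg_distrib, ← Finset.sum_sub_distrib]
  refine Finset.sum_eq_zero fun ω _ => ?_
  rcases (hP ω).eq_or_lt with h | h
  · simp [← h]
  have h1 := (law_pos hP (fun ω => (B ω, f (D ω))) h).ne'
  have h2 := (law_pos hP D h).ne'
  have h3 := (law_pos hP (fun ω => f (D ω)) h).ne'
  rw [log_div (mul_ne_zero h1 h2) h3, log_mul h1 h2]
  ring

theorem law_prod_eq_zero_of_div_eq_zero {P : Ω → ℝ} (hP : ∀ ω, 0 ≤ P ω) (B : Ω → β) (D : Ω → δ) (f : δ → γ)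
    (x : β × δ)
    (h : law P (fun ω => (B ω, f (D ω))) (x.1, f x.2) * law P D x.2 /
            law P (fun ω => f (D ω)) (f x.2) = 0) :
    law P (fun ω => (B ω, D ω)) x = 0 := by
  refine le_antisymm ?_ (law_nonneg hP _ _)
  rw [div_eq_zero_iff, mul_eq_zero] at h
  rcases h with (h | h) | h
  · rw [← h]
    exact law_le_of_comp hP (fun ω => (B ω, D ω)) (fun y => (y.1, f y.2)) x
  · rw [← h]
    exact law_le_of_comp hP (fun ω => (B ω, D ω)) (fun y => y.2) x
  · rw [← h]
    exact law_le_of_comp hP (fun ω => (B ω, D ω)) (fun y => f y.2) x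

/-- The summand is the law that keeps the pairs `(B, f(D))` and `D` but makes `B` and `D`
independent given `f(D)`, so its mass is unchanged. A zero denominator forces `P(D = d) = 0`. -/
theorem sum_law_mul_div {P : Ω → ℝ} (hP : ∀ ω, 0 ≤ P ω) (B : Ω → β) (D : Ω → δ) (f : δ → γ) :
    ∑ x : β × δ, law P (fun ω => (B ω, f (D ω))) (x.1, f x.2) * law P D x.2 /
            law P (fun ω => f (D ω)) (f x.2) = ∑ x : β × δ, law P (fun ω => (B ω, D ω)) x := by
  rw [sum_law, ← sum_law P D, Fintype.sum_prod_type_right]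
  refine Finset.sum_congr rfl fun d _ => ?_
  simp only [mul_div_assoc, ← Finset.sum_mul]
  rw [← law_eq_sum_left P (fun ω => f (D ω)) B]
  by_cases h : law P (fun ω => f (D ω)) (f d) = 0
  · have : law P D d = 0 := le_antisymm (h ▸ law_le_of_comp hP D f d) (law_nonneg hP _ _)
    simp [this]
  · field_simp

theorem law_mul_law_div_nonneg {P : Ω → ℝ} (hP : ∀ ω, 0 ≤ P ω) (B : Ω → β) (D : Ω → δ) (f : δ → γ)
    (x : β × δ) :
    0 ≤ law P (fun ω => (B ω, f (D ω))) (x.1, f x.2) * law P D x.2 /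
            law P (fun ω => f (D ω)) (f x.2) :=
  div_nonneg (mul_nonneg (law_nonneg hP _ _) (law_nonneg hP _ _)) (law_nonneg hP _ _)

/-- Conditioning reduces entropy: `H(B|D) ≤ H(B|f(D))`. -/
theorem condEntropy_le_comp {P : Ω → ℝ} (hP : ∀ ω, 0 ≤ P ω) (B : Ω → β) (D : Ω → δ) (f : δ → γ) :
    entropy P (fun ω => (B ω, D ω)) - entropy P D ≤
      entropy P (fun ω => (B ω, f (D ω))) - entropy P (fun ω => f (D ω)) := by
  rw [← sub_nonneg, entropy_comp_sub_entropy_eq hP]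
  have h := Finset.sum_le_sum fun (x : β × δ) (_ : x ∈ Finset.univ) =>
    sub_le_mul_log_div (law_nonneg hP (fun ω => (B ω, D ω)) x) (law_mul_law_div_nonneg hP B D f x)
      (law_prod_eq_zero_of_div_eq_zero hP B D f x)
  rw [Finset.sum_sub_distrib, sum_law_mul_div hP, sub_self] at h
  exact h

/-- Termwise inequalities whose sums agree are equalities, and `log x < x - 1` for `x ≠ 1` then
identifies the law with its conditionally independent version. -/
theorem law_mul_law_of_condEntropy_eq {P : Ω → ℝ} (hP : ∀ ω, 0 ≤ P ω) (B : Ω → β) (D : Ω → δ) (f : δ → γ)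
    (he : entropy P (fun ω => (B ω, f (D ω))) - entropy P (fun ω => f (D ω)) ≤
      entropy P (fun ω => (B ω, D ω)) - entropy P D) (b : β) (d : δ) :
    law P (fun ω => (B ω, D ω)) (b, d) * law P (fun ω => f (D ω)) (f d) =
      law P (fun ω => (B ω, f (D ω))) (b, f d) * law P D d := by
  have h := fun (x : β × δ) (_ : x ∈ Finset.univ) =>
    sub_le_mul_log_div (law_nonneg hP (fun ω => (B ω, D ω)) x) (law_mul_law_div_nonneg hP B D f x)
      (law_prod_eq_zero_of_div_eq_zero hP B D f x)
  have h1 := entropy_comp_sub_entropy_eq hP B D f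
  have h2 := Finset.sum_le_sum h
  have h3 := sum_law_mul_div hP B D f
  rw [← sub_eq_zero, ← neg_sub, neg_eq_zero, ← Finset.sum_sub_distrib] at h3
  have h4 := (Finset.sum_eq_sum_iff_of_le h).1 (by linarith) (b, d) (Finset.mem_univ _)
  have h5 := eq_of_mul_log_div_eq (law_nonneg hP _ _) (law_prod_eq_zero_of_div_eq_zero hP B D f (b, d))
    (law_mul_law_div_nonneg hP B D f (b, d)) h4.symm
  simp only at h5
  by_cases h6 : law P (fun ω => f (D ω)) (f d) = 0
  · have : law P D d = 0 := le_antisymm (h6 ▸ law_le_of_comp hP D f d) (law_nonneg hP _ _)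
    simp [this, h6]
  · rw [eq_div_iff h6] at h5
    exact h5

/-- A law that factors as `g(b,c) f(a,c)` makes `A` and `B` conditionally independent given `C`. -/
theorem condMutualInfo_eq_zero {P : Ω → ℝ} (hP : ∀ ω, 0 ≤ P ω) (A : Ω → α) (B : Ω → β) (C : Ω → γ)
    (g : β → γ → ℝ) (f : α → γ → ℝ)
    (h : ∀ a b c, law P (fun ω => (A ω, B ω, C ω)) (a, b, c) = g b c * f a c) :
    condMutualInfo P A B C = 0 := by
  have hc : ∀ c, law P C c = (∑ b, g b c) * ∑ a, f a c := fun c => by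
    rw [law_eq_sum_left P C B]
    simp_rw [law_eq_sum_left P (fun ω => (B ω, C ω)) A, h, ← Finset.mul_sum]
    rw [Finset.sum_mul]
  have hbc : ∀ b c, law P (fun ω => (B ω, C ω)) (b, c) = g b c * ∑ a, f a c := fun b c => by
    simp_rw [law_eq_sum_left P (fun ω => (B ω, C ω)) A, h, ← Finset.mul_sum]
  have hac : ∀ a c, law P (fun ω => (A ω, C ω)) (a, c) = (∑ b, g b c) * f a c := fun a c => by
    rw [law_eq_sum_left P (fun ω => (A ω, C ω)) B, Finset.sum_mul]
    refine Finset.sum_congr rfl fun b _ => ?_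
    rw [← h]
    have : Function.Injective fun x : α × β × γ => (x.2.1, x.1, x.2.2) := by
      rintro ⟨a, b, c⟩ ⟨a', b', c'⟩ h
      simp_all
    exact law_comp_of_injective P (fun ω => (A ω, B ω, C ω)) this (a, b, c)
  unfold condMutualInfo
  simp only [entropy_eq_sum]
  rw [← neg_eq_zero]
  simp only [← Finset.sum_neg_distrib, ← Finset.sum_sub_distrib, ← Finset.sum_add_distrib]
  refine Finset.sum_eq_zero fun ω _ => ?_
  rcases (hP ω).eq_or_lt with h0 | h0
  · simp [← h0]
  have h1 := (law_pos hP (fun ω => (A ω, C ω)) h0).ne'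
  have h2 := (law_pos hP (fun ω => (B ω, C ω)) h0).ne'
  have h3 := (law_pos hP (fun ω => (A ω, B ω, C ω)) h0).ne'
  have h4 := (law_pos hP C h0).ne'
  have h5 : log (law P (fun ω => (A ω, C ω)) (A ω, C ω) * law P (fun ω => (B ω, C ω)) (B ω, C ω)) =
      log (law P (fun ω => (A ω, B ω, C ω)) (A ω, B ω, C ω) * law P C (C ω)) := by
    rw [hac, hbc, h, hc]
    ring_nf
  rw [log_mul h1 h2, log_mul h3 h4] at h5
  linear_combination P ω * h5

end Entropy

end SecureComputation

namespace SecureComputation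

open Real Finset

/-! Continuity of entropy and independent repetitions. -/

section Continuity

variable {α β : Type*} [Fintype α] [Fintype β]

/-- The part of the modulus of continuity of entropy that does not depend on the alphabet. -/
noncomputable def entropyModulus (ε : ℝ) : ℝ := negMulLog ε - log (1 - ε)

theorem entropyModulus_nonneg {ε : ℝ} (h0 : 0 ≤ ε) (h1 : ε ≤ 1) : 0 ≤ entropyModulus ε :=
  sub_nonneg.2 ((log_nonpos (by linarith) (by linarith)).trans (negMulLog_nonneg h0 h1))

theorem sum_negMulLog_le_of_sum_abs_sub_le {P Q : α → ℝ} (hP : P ∈ stdSimplex ℝ α)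
    (hQ : Q ∈ stdSimplex ℝ α) {ε : ℝ} (h0 : 0 < ε) (h1 : ε < 1) (h : ∑ a, |P a - Q a| ≤ ε) :
    ∑ a, negMulLog (P a) ≤
      ∑ a, negMulLog (Q a) + (ε * log (Fintype.card α) + entropyModulus ε) := by
  have hne : Nonempty α := by
    by_contra hne
    rw [not_nonempty_iff] at hne
    simpa using hP.2
  set N : ℝ := (Fintype.card α : ℝ) with hN
  have hNpos : 1 ≤ N := by
    rw [hN]; exact_mod_cast Fintype.card_pos
  have hNpos' : 0 < N := by linarith
  -- Mixing `Q` with the uniform law keeps `-log R` below `log N - log ε`. Cross-entropy against `R`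
  -- bounds the entropy of `P`; replacing `P` by `Q` in it costs at most `ε (log N - log ε)`, and
  -- the mixing itself costs at most `-log (1 - ε)`.
  set R : α → ℝ := fun a => (1 - ε) * Q a + ε / N with hR
  have hRsum : ∑ a, R a = 1 := by
    simp only [hR, Finset.sum_add_distrib, ← Finset.mul_sum, hQ.2, Finset.sum_const,
      Finset.card_univ, nsmul_eq_mul]
    rw [← hN]
    field_simp
    ring
  have hRlow : ∀ a, ε / N ≤ R a := fun a =>
    le_add_of_nonneg_left (mul_nonneg (by linarith) (hQ.1 a))
  have hRpos : ∀ a, 0 < R a := fun a => (div_pos h0 hNpos').trans_le (hRlow a)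
  have hR1 : ∀ a, R a ≤ 1 := fun a =>
    hRsum ▸ Finset.single_le_sum (fun b _ => (hRpos b).le) (Finset.mem_univ a)
  have hgibbs : ∑ a, negMulLog (P a) ≤ ∑ a, P a * -log (R a) := by
    have := Finset.sum_le_sum fun a (_ : a ∈ (Finset.univ : Finset α)) =>
      sub_le_mul_log_div (hP.1 a) (hRpos a).le fun h => absurd h (hRpos a).ne'
    rw [Finset.sum_sub_distrib, hRsum, hP.2, sub_self] at this
    rw [← sub_nonneg, ← Finset.sum_sub_distrib]
    refine this.trans (Finset.sum_le_sum fun a _ => ?_)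
    rw [negMulLog]
    linarith
  have hdiff : ∑ a, (P a - Q a) * -log (R a) ≤ ε * (log N - log ε) := by
    have hlog : 0 ≤ log N - log ε :=
      sub_nonneg.2 ((log_nonpos h0.le h1.le).trans (log_nonneg hNpos))
    refine le_trans ?_ (mul_le_mul_of_nonneg_right h hlog)
    rw [Finset.sum_mul]
    refine Finset.sum_le_sum fun a _ => ?_
    have h2 : 0 ≤ -log (R a) := neg_nonneg.2 (log_nonpos (hRpos a).le (hR1 a))
    refine (mul_le_mul_of_nonneg_right (le_abs_self _) h2).trans
      (mul_le_mul_of_nonneg_left ?_ (abs_nonneg _))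
    have := log_le_log (div_pos h0 hNpos') (hRlow a)
    rw [log_div h0.ne' hNpos'.ne'] at this
    linarith
  have hmix : ∑ a, Q a * -log (R a) ≤ ∑ a, negMulLog (Q a) - log (1 - ε) := by
    have : ∑ a, negMulLog (Q a) - log (1 - ε) = ∑ a, (negMulLog (Q a) - Q a * log (1 - ε)) := by
      rw [Finset.sum_sub_distrib, ← Finset.sum_mul, hQ.2, one_mul]
    rw [this]
    refine Finset.sum_le_sum fun a _ => ?_
    rcases (hQ.1 a).eq_or_lt with hq | hq
    · simp [← hq]
    have h3 : log ((1 - ε) * Q a) ≤ log (R a) :=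
      log_le_log (mul_pos (by linarith) hq) (le_add_of_nonneg_right (div_pos h0 hNpos').le)
    rw [log_mul (by linarith) hq.ne'] at h3
    have h4 := mul_le_mul_of_nonneg_left h3 hq.le
    rw [negMulLog]
    linarith
  have hsplit : ∑ a, P a * -log (R a) =
      ∑ a, (P a - Q a) * -log (R a) + ∑ a, Q a * -log (R a) := by
    rw [← Finset.sum_add_distrib]
    exact Finset.sum_congr rfl fun a _ => by ring
  have hmod : ε * log N + entropyModulus ε = ε * (log N - log ε) - log (1 - ε) := by
    rw [entropyModulus, negMulLog]
    ring
  rw [hmod]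
  linarith

theorem entropy_le_of_sum_abs_sub_le {P Q : α → ℝ} (hP : P ∈ stdSimplex ℝ α)
    (hQ : Q ∈ stdSimplex ℝ α) {ε : ℝ} (h0 : 0 < ε) (h1 : ε < 1) (h : ∑ a, |P a - Q a| ≤ ε)
    (f : α → β) :
    entropy P f ≤ entropy Q f + (ε * log (Fintype.card β) + entropyModulus ε) :=
  sum_negMulLog_le_of_sum_abs_sub_le (law_mem_stdSimplex hP f) (law_mem_stdSimplex hQ f) h0 h1
    ((sum_abs_law_sub_le P Q f).trans h)

end Continuity

section IID

set_option linter.unusedSectionVars false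

variable {ι α β : Type*} [Fintype ι] [Fintype α] [Fintype β]

theorem sum_pi_prod [DecidableEq ι] (F : ι → α → ℝ) :
    ∑ v : ι → α, ∏ t, F t (v t) = ∏ t, ∑ a, F t a := by
  rw [Finset.prod_univ_sum, Fintype.piFinset_univ]

theorem iid_mem_stdSimplex [DecidableEq ι] {Q : α → ℝ} (hQ : Q ∈ stdSimplex ℝ α) :
    (fun v : ι → α => ∏ t, Q (v t)) ∈ stdSimplex ℝ (ι → α) :=
  ⟨fun v => Finset.prod_nonneg fun t _ => hQ.1 _, by
    rw [sum_pi_prod fun _ => Q]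
    simp [hQ.2]⟩

theorem law_iid_comp [DecidableEq ι] (Q : α → ℝ) (g : α → β) :
    law (fun v : ι → α => ∏ t, Q (v t)) (fun v t => g (v t)) = fun b => ∏ t, law Q g (b t) := by
  classical
  ext b
  simp only [law_apply]
  rw [← sum_pi_prod fun t a => if g a = b t then Q a else 0]
  refine Finset.sum_congr rfl fun v _ => ?_
  rw [Finset.prod_ite_zero]
  simp [funext_iff]

theorem law_iid_apply [DecidableEq ι] {Q : α → ℝ} (hQ : ∑ a, Q a = 1) (t : ι) :
    law (fun v : ι → α => ∏ t, Q (v t)) (fun v => v t) = Q := by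
  classical
  ext a
  have := sum_pi_prod fun s b => if s = t then (if b = a then Q b else 0) else Q b
  have h2 : ∀ s, (∑ b, if s = t then (if b = a then Q b else 0) else Q b) =
      if s = t then Q a else 1 := fun s => by
    split_ifs <;> simp [hQ]
  simp only [h2, Finset.prod_ite_eq', Finset.mem_univ, if_true] at this
  rw [law_apply, ← this]
  refine Finset.sum_congr rfl fun v _ => ?_
  rw [← Finset.mul_prod_erase _ _ (Finset.mem_univ t),
    ← Finset.mul_prod_erase _ (fun s => if s = t then _ else _) (Finset.mem_univ t)]
  rw [Finset.prod_congr rfl fun s hs => if_neg (Finset.ne_of_mem_erase hs)]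
  simp [ite_mul]

/-- `negMulLog` satisfies the Leibniz rule; summed over independent coordinates this makes entropy
additive. -/
theorem negMulLog_prod {ι : Type*} [DecidableEq ι] (s : Finset ι) (x : ι → ℝ) :
    negMulLog (∏ t ∈ s, x t) = ∑ t ∈ s, ∏ u ∈ s, if u = t then negMulLog (x u) else x u := by
  induction s using Finset.induction_on with
  | empty => simp
  | insert a s ha ih =>
    rw [Finset.prod_insert ha, negMulLog_mul, ih, Finset.sum_insert ha, Finset.prod_insert ha,
      if_pos rfl, Finset.mul_sum, mul_comm]
    congr 1
    · congr 1
      exact Finset.prod_congr rfl fun u hu => (if_neg (ne_of_mem_of_not_mem hu ha)).symm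
    · refine Finset.sum_congr rfl fun t ht => ?_
      rw [Finset.prod_insert ha, if_neg (ne_of_mem_of_not_mem ht ha).symm]

theorem sum_negMulLog_iid [DecidableEq ι] {Q : α → ℝ} (hQ : ∑ a, Q a = 1) :
    ∑ v : ι → α, negMulLog (∏ t, Q (v t)) = Fintype.card ι * ∑ a, negMulLog (Q a) := by
  simp only [negMulLog_prod]
  rw [Finset.sum_comm]
  have : ∀ t : ι, ∑ v : ι → α, ∏ u, (if u = t then negMulLog (Q (v u)) else Q (v u)) =
      ∑ a, negMulLog (Q a) := fun t => by
    rw [sum_pi_prod fun u a => if u = t then negMulLog (Q a) else Q a]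
    have h2 : ∀ u, (∑ a, if u = t then negMulLog (Q a) else Q a) =
        if u = t then ∑ a, negMulLog (Q a) else 1 := fun u => by
      split_ifs <;> simp [hQ]
    simp [h2]
  simp [this]

theorem entropy_iid_comp [DecidableEq ι] {Q : α → ℝ} (hQ : ∑ a, Q a = 1) (g : α → β) :
    entropy (fun v : ι → α => ∏ t, Q (v t)) (fun v t => g (v t)) =
      Fintype.card ι * entropy Q g := by
  rw [entropy, law_iid_comp, sum_negMulLog_iid ((sum_law Q g).trans hQ), entropy]

end IID

/-! Single-letterization of the leakage. -/

section SingleLetter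

variable {Ω α β μ : Type*} [Fintype Ω] [Fintype α] [Fintype β] [Fintype μ]

/-- The chain rule `∑ₜ H(Bₜ | A, M, B_{>t}) = H(B | A, M)`, in the order given by `e`. -/
theorem sum_condEntropy_suffix {n : ℕ} (P : Ω → ℝ) (C : Ω → μ) (B : Ω → Fin n → β)
    (e : Fin n ≃ Fin n) :
    ∑ t : Fin n, (entropy P (fun ω => (B ω (e t), C ω, fun s : {s : Fin n // t < s} => B ω (e s)))
      - entropy P (fun ω => (C ω, fun s : {s : Fin n // t < s} => B ω (e s)))) =
      entropy P (fun ω => (C ω, B ω)) - entropy P C := by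
  -- `G k` is the joint entropy of `C` and the letters at positions `≥ k` in the order `e`. The
  -- summand at `t` is `G t - G (t + 1)`, so the sum telescopes.
  set G : ℕ → ℝ := fun k =>
    entropy P (fun ω => (C ω, fun s : {s : Fin n // k ≤ (s : ℕ)} => B ω (e s))) with hG
  have h1 : ∀ t : Fin n,
      entropy P (fun ω => (B ω (e t), C ω, fun s : {s : Fin n // t < s} => B ω (e s))) = G t := by
    intro t
    refine entropy_congr_ker P fun ω ω' => ?_
    simp only [Prod.mk.injEq, funext_iff, Subtype.forall]
    constructor
    · rintro ⟨h, h', h''⟩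
      refine ⟨h', fun s hs => ?_⟩
      rcases hs.eq_or_lt with hs | hs
      · rwa [← Fin.ext hs]
      · exact h'' s hs
    · rintro ⟨h, h'⟩
      exact ⟨h' t le_rfl, h, fun s hs => h' s (Fin.le_def.1 hs.le)⟩
  have h2 : ∀ t : Fin n,
      entropy P (fun ω => (C ω, fun s : {s : Fin n // t < s} => B ω (e s))) = G (t + 1) :=
    fun t => rfl
  simp only [h1, h2]
  rw [Fin.sum_univ_eq_sum_range (fun k => G k - G (k + 1)), Finset.sum_range_sub']
  congr 1
  · refine entropy_congr_ker P fun ω ω' => ?_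
    simp only [Prod.mk.injEq, funext_iff, Subtype.forall, Nat.zero_le, forall_const]
    refine and_congr_right fun _ => ⟨fun h s => ?_, fun h s => h _⟩
    simpa using h (e.symm s)
  · refine entropy_congr_ker P fun ω ω' => ?_
    simp only [Prod.mk.injEq, funext_iff, Subtype.forall, and_iff_left_iff_imp]
    exact fun _ s hs => absurd s.2 (not_lt.2 hs)

/-- The single-letter leakages of an approximately i.i.d. source are controlled by the leakage of
the whole sequence. -/
theorem sum_condEntropy_sub_le {n : ℕ} (hn : 1 ≤ n) {P : Ω → ℝ} (hP : P ∈ stdSimplex ℝ Ω)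
    (M : Ω → μ) (A : Ω → Fin n → α) (B : Ω → Fin n → β) (e : Fin n ≃ Fin n)
    {Q : α × β → ℝ} (hQ : Q ∈ stdSimplex ℝ (α × β)) {ε : ℝ} (h0 : 0 < ε) (h1 : ε < 1)
    (hclose : ∑ v, |law P (fun ω t => (A ω t, B ω t)) v - ∏ t, Q (v t)| ≤ ε)
    (hleak : condMutualInfo P M B A ≤ n * ε)
    {υ : Fin n → Type*} [∀ t, Fintype (υ t)] (U : (t : Fin n) → Ω → υ t)
    (f : (t : Fin n) → (Fin n → α) × μ × ({s : Fin n // t < s} → β) → υ (e t))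
    (hU : ∀ t ω, U (e t) ω = f t (A ω, M ω, fun s => B ω (e s))) :
    ∑ t, (entropy P (fun ω => (A ω t, B ω t)) - entropy P (fun ω => A ω t)
        - (entropy P (fun ω => (U t ω, A ω t, B ω t)) - entropy P (fun ω => (U t ω, A ω t)))) ≤
      n * (ε + 2 * ε * (log (Fintype.card α) + log (Fintype.card (α × β)))
        + 4 * entropyModulus ε) := by
  have hmod := entropyModulus_nonneg h0.le h1.le
  have hn' : (1 : ℝ) ≤ n := by exact_mod_cast hn
  set R := law P (fun ω t => (A ω t, B ω t)) with hR
  have hRs : R ∈ stdSimplex ℝ _ := law_mem_stdSimplex hP _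
  have hQs : (fun v : Fin n → α × β => ∏ t, Q (v t)) ∈ stdSimplex ℝ _ := iid_mem_stdSimplex hQ
  have hclose' : ∑ v, |∏ t, Q (v t) - R v| ≤ ε := by
    simpa only [abs_sub_comm] using hclose
  -- conditioning on the suffix
  have hcond : ∀ t : Fin n,
      entropy P (fun ω => (B ω (e t), (A ω, M ω), fun s : {s : Fin n // t < s} => B ω (e s)))
      - entropy P (fun ω => ((A ω, M ω), fun s : {s : Fin n // t < s} => B ω (e s))) ≤
      entropy P (fun ω => (U (e t) ω, A ω (e t), B ω (e t)))
        - entropy P (fun ω => (U (e t) ω, A ω (e t))) := fun t => by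
    have := condEntropy_le_comp hP.1 (fun ω => B ω (e t))
      (fun ω => ((A ω, M ω), fun s : {s : Fin n // t < s} => B ω (e s)))
      (fun d => (f t (d.1.1, d.1.2, d.2), d.1.1 (e t)))
    simp only [← hU] at this
    refine this.trans_eq (congrArg₂ _ (entropy_congr_ker P fun ω ω' => ?_) rfl)
    simp only [Prod.mk.injEq]
    tauto
  have hchain := sum_condEntropy_suffix P (fun ω => (A ω, M ω)) B e
  have hsum := Finset.sum_le_sum fun t (_ : t ∈ Finset.univ) => hcond t
  rw [hchain, Equiv.sum_comp e fun t => entropy P (fun ω => (U t ω, A ω t, B ω t))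
        - entropy P (fun ω => (U t ω, A ω t))] at hsum
  -- Knowing `M` besides `A` lowers the conditional entropy of `B` by exactly the leakage.
  have hL : entropy P (fun ω => ((A ω, M ω), B ω)) - entropy P (fun ω => (A ω, M ω)) =
      entropy P (fun ω t => (A ω t, B ω t)) - entropy P A - condMutualInfo P M B A := by
    unfold condMutualInfo
    have e1 : entropy P (fun ω => ((A ω, M ω), B ω)) = entropy P (fun ω => (M ω, B ω, A ω)) :=
      entropy_congr_ker P fun ω ω' => by simp only [Prod.mk.injEq]; tauto
    have e2 : entropy P (fun ω => (A ω, M ω)) = entropy P (fun ω => (M ω, A ω)) :=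
      entropy_congr_ker P fun ω ω' => by simp only [Prod.mk.injEq]; tauto
    have e3 : entropy P (fun ω t => (A ω t, B ω t)) = entropy P (fun ω => (B ω, A ω)) :=
      entropy_congr_ker P fun ω ω' => by
        simp only [Prod.mk.injEq, funext_iff, forall_and]; tauto
    rw [e1, e2, e3]
    ring
  -- continuity
  have c1 : (n : ℝ) * entropy Q (fun v => v) ≤ entropy P (fun ω t => (A ω t, B ω t)) +
      (ε * (n * log (Fintype.card (α × β))) + entropyModulus ε) := by
    have := entropy_le_of_sum_abs_sub_le hQs hRs h0 h1 hclose' fun v t => v t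
    rw [entropy_iid_comp hQ.2 (fun v => v), entropy_law] at this
    simpa [Fintype.card_pi] using this
  have c2 : entropy P A ≤ n * entropy Q (fun v => v.1) +
      (ε * (n * log (Fintype.card α)) + entropyModulus ε) := by
    have := entropy_le_of_sum_abs_sub_le hRs hQs h0 h1 hclose fun v t => (v t).1
    rw [entropy_iid_comp hQ.2 (fun v => v.1), entropy_law] at this
    simpa [Fintype.card_pi] using this
  have c3 : ∀ t, entropy P (fun ω => (A ω t, B ω t)) ≤ entropy Q (fun v => v) +
      (ε * log (Fintype.card (α × β)) + entropyModulus ε) := fun t => by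
    have := entropy_le_of_sum_abs_sub_le hRs hQs h0 h1 hclose fun v => v t
    rw [entropy_law, ← entropy_law _ (fun v : Fin n → α × β => v t) (fun v => v),
      law_iid_apply hQ.2] at this
    exact this
  have c4 : ∀ t, entropy Q (fun v => v.1) ≤ entropy P (fun ω => A ω t) +
      (ε * log (Fintype.card α) + entropyModulus ε) := fun t => by
    have := entropy_le_of_sum_abs_sub_le hQs hRs h0 h1 hclose' fun v => (v t).1
    rw [entropy_law, ← entropy_law _ (fun v : Fin n → α × β => v t) (fun v => v.1),
      law_iid_apply hQ.2] at this
    exact this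
  have c6 : ∑ t, (entropy P (fun ω => (A ω t, B ω t)) - entropy P (fun ω => A ω t)) ≤
      n * (entropy Q (fun v => v) + (ε * log (Fintype.card (α × β)) + entropyModulus ε)
        - entropy Q (fun v => v.1) + (ε * log (Fintype.card α) + entropyModulus ε)) := by
    refine (Finset.sum_le_sum fun t (_ : t ∈ (Finset.univ : Finset (Fin n))) =>
      (show _ ≤ entropy Q (fun v => v) + (ε * log (Fintype.card (α × β)) + entropyModulus ε)
        - entropy Q (fun v => v.1) + (ε * log (Fintype.card α) + entropyModulus ε) by
        linarith [c3 t, c4 t])).trans_eq ?_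
    rw [Finset.sum_const, Finset.card_univ, Fintype.card_fin, nsmul_eq_mul]
  rw [Finset.sum_sub_distrib]
  -- Two moduli come from the whole sequences and two from each letter; `1 ≤ n` absorbs the former,
  -- whence the constant `4`.
  have hnm : entropyModulus ε ≤ n * entropyModulus ε := le_mul_of_one_le_left hmod hn'
  nlinarith

end SingleLetter

end SecureComputation

namespace SecureComputation

open Real Finset

/-! ### Carathéodory's theorem for cones. -/

theorem sum_subtype_eq_sum {ι W : Type*} [Fintype ι] [AddCommMonoid W] {p : ι → Prop}
    [DecidablePred p] {F : ι → W} (h : ∀ i, ¬ p i → F i = 0) :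
    ∑ i : {i // p i}, F i = ∑ i, F i := by
  rw [← Finset.sum_subtype (univ.filter p) (by simp) F, Finset.sum_filter]
  refine Finset.sum_congr rfl fun i _ => ?_
  by_cases hi : p i <;> simp [hi, h]

theorem sum_extend {ι κ W : Type*} [Fintype ι] [Fintype κ] [AddCommMonoid W]
    (e : ι ↪ κ) (F : ι → W) : ∑ l, Function.extend e F 0 l = ∑ u, F u := by
  classical
  rw [← Finset.sum_subset (Finset.subset_univ (univ.map e)), Finset.sum_map]
  · simp only [e.injective.extend_apply]
  · intro l _ hl
    rw [Function.extend_apply' _ _ _ fun ⟨u, hu⟩ => hl (by simp [← hu])]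
    rfl

/-- Carathéodory's theorem for finitely generated cones. -/
theorem exists_sum_smul_eq_sum_card_le_finrank {ι W : Type*} [Fintype ι] [DecidableEq ι]
    [AddCommGroup W] [Module ℝ W] [Module.Finite ℝ W] (g : ι → W) :
    ∃ w : ι → ℝ, (∀ i, 0 ≤ w i) ∧ ∑ i, w i • g i = ∑ i, g i ∧
      #{i | w i ≠ 0} ≤ Module.finrank ℝ W := by
  suffices H : ∀ (N : ℕ) (w : ι → ℝ), (∀ i, 0 ≤ w i) → #{i | w i ≠ 0} ≤ N →
      ∃ w' : ι → ℝ, (∀ i, 0 ≤ w' i) ∧ ∑ i, w' i • g i = ∑ i, w i • g i ∧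
        #{i | w' i ≠ 0} ≤ Module.finrank ℝ W by
    obtain ⟨w', h1, h2, h3⟩ := H _ (fun _ => 1) (fun _ => zero_le_one) le_rfl
    exact ⟨w', h1, by simpa using h2, h3⟩
  intro N
  induction N with
  | zero => exact fun w hw hN => ⟨w, hw, rfl, hN.trans (Nat.zero_le _)⟩
  | succ N ih =>
    intro w hw hN
    by_cases hd : #{i | w i ≠ 0} ≤ Module.finrank ℝ W
    · exact ⟨w, hw, rfl, hd⟩
    have hdep : ¬ LinearIndependent ℝ fun i : {i // w i ≠ 0} => g i := fun h =>
      hd (by simpa [Fintype.card_subtype] using h.fintype_card_le_finrank)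
    obtain ⟨c, hc, i₀, hi₀⟩ := Fintype.not_linearIndependent_iff.1 hdep
    -- A linear relation among the active vectors, its sign chosen so that some coefficient is
    -- positive. The largest multiple of it that can be subtracted with all weights still
    -- nonnegative is `w j / b j`, for the minimizing `j`, and it kills the weight of `j`.
    obtain ⟨b, hbsupp, hb, i₁, hi₁⟩ : ∃ b : ι → ℝ, (∀ i, w i = 0 → b i = 0) ∧
        ∑ i, b i • g i = 0 ∧ ∃ i, 0 < b i := by
      set a : ι → ℝ := fun i => if h : w i ≠ 0 then c ⟨i, h⟩ else 0 with ha
      have hasum : ∑ i, a i • g i = 0 := by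
        rw [← hc, ← sum_subtype_eq_sum (p := fun i => w i ≠ 0) (fun i hi => by simp [ha, hi])]
        exact Finset.sum_congr rfl fun i _ => by simp [ha, i.2]
      have ha0 : ∀ i, w i = 0 → a i = 0 := fun i h => by simp [ha, h]
      have hai : a i₀ = c i₀ := by simp [ha, i₀.2]
      rcases lt_or_gt_of_ne hi₀ with h | h
      · exact ⟨-a, fun i hi => by simp [ha0 i hi], by simp [hasum], i₀, by simp [hai, h]⟩
      · exact ⟨a, ha0, hasum, i₀, by simpa [hai] using h⟩
    obtain ⟨j, hj, hmin⟩ := Finset.exists_min_image (univ.filter fun i => 0 < b i)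
      (fun i => w i / b i) ⟨i₁, by simpa using hi₁⟩
    have hbj : 0 < b j := by simpa using hj
    have hwj : w j ≠ 0 := fun h => hbj.ne' (hbsupp j h)
    obtain ⟨w', h1, h2, h3⟩ := ih (fun i => w i - w j / b j * b i) (fun i => by
      rcases le_or_gt (b i) 0 with h | h
      · have : w j / b j * b i ≤ 0 :=
          mul_nonpos_of_nonneg_of_nonpos (div_nonneg (hw j) hbj.le) h
        linarith [hw i]
      · have := hmin i (by simpa using h)
        rw [le_div_iff₀ h] at this
        linarith) (by
      refine Nat.le_of_lt_succ (lt_of_lt_of_le (Finset.card_lt_card ?_) hN)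
      refine (Finset.ssubset_iff_of_subset fun i hi => ?_).2 ⟨j, by simpa using hwj, ?_⟩
      · simp only [Finset.mem_filter, Finset.mem_univ, true_and] at hi ⊢
        exact fun h => hi (by rw [h, hbsupp i h]; simp)
      · simp [hbj.ne'])
    refine ⟨w', h1, h2.trans ?_, h3⟩
    simp only [sub_smul, Finset.sum_sub_distrib, mul_smul, ← Finset.smul_sum, hb, smul_zero,
      sub_zero]

/-! The measures that are generated by interaction. -/

section Interaction

variable {X Y Z₁ Z₂ : Type*} [Fintype X] [Fintype Y] [Fintype Z₁] [Fintype Z₂]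

/-- `H(Y,Z₂|X,Z₁) + H(X,Z₁|Y,Z₂)`, as a function of an unnormalized law. -/
noncomputable def leakPotential (P : X × Y × Z₁ × Z₂ → ℝ) : ℝ :=
  2 * entropy P (fun v => v) - entropy P (fun v => (v.1, v.2.2.1))
    - entropy P (fun v => (v.2.1, v.2.2.2))

/-- Rescaling adds the same multiple of `negMulLog t` to each entropy, and the coefficients `2 - 1 -
1` cancel. Homogeneity lets whole branches of an interaction be reweighted. -/
theorem leakPotential_smul (t : ℝ) (P : X × Y × Z₁ × Z₂ → ℝ) :
    leakPotential (t • P) = t * leakPotential P := by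
  simp only [leakPotential, entropy_smul]
  ring

theorem leakPotential_zero : leakPotential (0 : X × Y × Z₁ × Z₂ → ℝ) = 0 := by
  simpa using leakPotential_smul 0 (0 : X × Y × Z₁ × Z₂ → ℝ)

theorem continuous_leakPotential :
    Continuous (leakPotential : (X × Y × Z₁ × Z₂ → ℝ) → ℝ) :=
  ((continuous_const.mul (continuous_entropy _)).sub (continuous_entropy _)).sub
    (continuous_entropy _)

/-- The decoding Markov chains `Z₁ - X - (Y,Z₂)` and `Z₂ - Y - (X,Z₁)`. -/
def Decodable (P : X × Y × Z₁ × Z₂ → ℝ) : Prop :=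
  MarkovChain P (fun v => v.2.2.1) (fun v => v.1) (fun v => (v.2.1, v.2.2.2)) ∧
    MarkovChain P (fun v => v.2.2.2) (fun v => v.2.1) (fun v => (v.1, v.2.2.1))

/-- Under the unnormalized laws `R` and `P`, the variable `B` has the same conditional law given
`A`. -/
def SameConditional {Ω α β : Type*} [Fintype Ω] (A : Ω → α) (B : Ω → β) (R P : Ω → ℝ) : Prop :=
  ∀ a b, law R (fun ω => (A ω, B ω)) (a, b) * law P A a =
    law R A a * law P (fun ω => (A ω, B ω)) (a, b)

/-- The Markov condition of round `i` between a law `P` and its conditioning `R` on the message. -/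
def RoundMarkov (i : ℕ) (R P : X × Y × Z₁ × Z₂ → ℝ) : Prop :=
  (Even i → SameConditional (fun v => v.1) (fun v => v.2.1) R P) ∧
    (¬ Even i → SameConditional (fun v => v.2.1) (fun v => v.1) R P)

theorem MarkovChain.smul {Ω α β γ : Type*} [Fintype Ω] {P : Ω → ℝ} {A : Ω → α} {B : Ω → β}
    {C : Ω → γ} (h : MarkovChain P A B C) (t : ℝ) : MarkovChain (t • P) A B C := fun a b c => by
  simp only [law_smul]
  linear_combination t ^ 2 * h a b c

theorem Decodable.smul {P : X × Y × Z₁ × Z₂ → ℝ} (h : Decodable P) (t : ℝ) : Decodable (t • P) :=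
  ⟨h.1.smul t, h.2.smul t⟩

theorem SameConditional.smul_smul {Ω α β : Type*} [Fintype Ω] {A : Ω → α} {B : Ω → β}
    {R P : Ω → ℝ} (h : SameConditional A B R P) (s t : ℝ) :
    SameConditional A B (s • R) (t • P) := fun a b => by
  simp only [law_smul]
  linear_combination s * t * h a b

theorem RoundMarkov.smul_smul {i : ℕ} {R P : X × Y × Z₁ × Z₂ → ℝ} (h : RoundMarkov i R P)
    (s t : ℝ) : RoundMarkov i (s • R) (t • P) :=
  ⟨fun hi => (h.1 hi).smul_smul s t, fun hi => (h.2 hi).smul_smul s t⟩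

/-- `Reachable L k i P v`: starting from the unnormalized law `P`, an interaction in the rounds
`i, …, i + k - 1` with messages in `Fin L` leads to final laws from which both users can decode, and
the values of `leakPotential` at the final laws add up to `v`. -/
def Reachable (L : ℕ) : ℕ → ℕ → (X × Y × Z₁ × Z₂ → ℝ) → ℝ → Prop
  | 0, _, P, v => (∀ a, 0 ≤ P a) ∧ Decodable P ∧ v = leakPotential P
  | k + 1, i, P, v => ∃ (R : Fin L → X × Y × Z₁ × Z₂ → ℝ) (s : Fin L → ℝ),
      (∀ u, Reachable L k (i + 1) (R u) (s u)) ∧ P = ∑ u, R u ∧ v = ∑ u, s u ∧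
        ∀ u, RoundMarkov i (R u) P

theorem Reachable.smul {L : ℕ} {t : ℝ} (ht : 0 ≤ t) : ∀ {k i : ℕ} {P : X × Y × Z₁ × Z₂ → ℝ} {v : ℝ},
    Reachable L k i P v → Reachable L k i (t • P) (t * v)
  | 0, _, P, v, h => ⟨fun a => mul_nonneg ht (h.1 a), h.2.1.smul t, by
      rw [leakPotential_smul, h.2.2]⟩
  | k + 1, i, P, v, ⟨R, s, h, hP, hv, hR⟩ => ⟨fun u => t • R u, fun u => t * s u,
      fun u => (h u).smul ht, by rw [hP, Finset.smul_sum], by rw [hv, Finset.mul_sum],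
      fun u => (hR u).smul_smul t t⟩

/-- Pads the message values that remain unused after an alphabet has been shrunk. -/
theorem reachable_zero (L : ℕ) :
    ∀ k i : ℕ, Reachable L k i (0 : X × Y × Z₁ × Z₂ → ℝ) 0
  | 0, _ => ⟨fun _ => le_rfl, ⟨fun _ _ _ => by simp [law_zero], fun _ _ _ => by simp [law_zero]⟩,
      leakPotential_zero.symm⟩
  | k + 1, i => ⟨0, 0, fun _ => reachable_zero L k (i + 1), by simp, by simp,
      fun _ => ⟨fun _ _ _ => by simp [law_zero], fun _ _ _ => by simp [law_zero]⟩⟩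

/-- Messages in an arbitrary finite alphabet can be replaced by messages in an alphabet of size
`|X||Y||Z₁||Z₂| + 1`. -/
theorem reachable_succ_of_sum {ι : Type*} [Fintype ι] {k i : ℕ} {L : ℕ}
    (hL : L = Fintype.card (X × Y × Z₁ × Z₂) + 1)
    {R : ι → X × Y × Z₁ × Z₂ → ℝ} {s : ι → ℝ} (h : ∀ u, Reachable L k (i + 1) (R u) (s u))
    (hR : ∀ u, RoundMarkov i (R u) (∑ u, R u)) :
    Reachable L (k + 1) i (∑ u, R u) (∑ u, s u) := by
  classical
  -- A branch is a vector (law, potential) in a space of dimension `|X||Y||Z₁||Z₂| + 1`. Keeping the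
  -- potential as one more coordinate preserves the total leakage along with the law.
  obtain ⟨w, hw, hsum, hcard⟩ := exists_sum_smul_eq_sum_card_le_finrank
    fun u => ((R u, s u) : (X × Y × Z₁ × Z₂ → ℝ) × ℝ)
  rw [Module.finrank_prod, Module.finrank_self, Module.finrank_fintype_fun_eq_card, ← hL] at hcard
  have hcard' : Fintype.card {u // w u ≠ 0} ≤ Fintype.card (Fin L) := by
    simpa [Fintype.card_subtype] using hcard
  obtain ⟨e⟩ := Function.Embedding.nonempty_of_card_le hcard'
  have h1 : ∑ u, w u • R u = ∑ u, R u := by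
    have := congrArg Prod.fst hsum
    simpa [Prod.fst_sum] using this
  have h2 : ∑ u, w u * s u = ∑ u, s u := by
    have := congrArg Prod.snd hsum
    simpa [Prod.snd_sum] using this
  refine ⟨Function.extend e (fun u : {u // w u ≠ 0} => w u • R u) 0,
    Function.extend e (fun u : {u // w u ≠ 0} => w u * s u) 0,
    fun l => ?_, ?_, ?_, fun l => ?_⟩
  · by_cases hl : ∃ u, e u = l
    · obtain ⟨u, rfl⟩ := hl
      simp only [e.injective.extend_apply]
      exact (h u).smul (hw u)
    · rw [Function.extend_apply' _ _ _ hl, Function.extend_apply' _ _ _ hl]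
      exact reachable_zero L k _
  · rw [← h1]
    rw [sum_extend, sum_subtype_eq_sum (F := fun u => w u • R u) fun u hu => by simp_all]
  · rw [← h2]
    rw [sum_extend, sum_subtype_eq_sum (F := fun u => w u * s u) fun u hu => by simp_all]
  · by_cases hl : ∃ u, e u = l
    · obtain ⟨u, rfl⟩ := hl
      simp only [e.injective.extend_apply]
      simpa using (hR u).smul_smul (w u) 1
    · rw [Function.extend_apply' _ _ _ hl]
      exact ⟨fun _ _ _ => by simp [law_zero], fun _ _ _ => by simp [law_zero]⟩

end Interaction

/-! Sums over the message vectors with a given beginning. -/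

section PrefixSum

variable {r : ℕ} {c : Fin r → ℕ} {M : Type*} [AddCommMonoid M]

/-- The sum of `J` over the vectors that agree with `w` strictly before round `i`. -/
def prefixSum (J : ((j : Fin r) → Fin (c j)) → M) (i : ℕ) (w : (j : Fin r) → Fin (c j)) : M :=
  ∑ u with ∀ j : Fin r, (j : ℕ) < i → u j = w j, J u

theorem prefixSum_zero (J : ((j : Fin r) → Fin (c j)) → M) (w) :
    prefixSum J 0 w = ∑ u, J u := by
  simp [prefixSum]

theorem prefixSum_top (J : ((j : Fin r) → Fin (c j)) → M) (w) :
    prefixSum J r w = J w := by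
  have : (univ.filter fun u : (j : Fin r) → Fin (c j) => ∀ j : Fin r, (j : ℕ) < r → u j = w j) =
      {w} := by
    ext u
    simp [funext_iff]
  rw [prefixSum, this, Finset.sum_singleton]

theorem prefixSum_succ (J : ((j : Fin r) → Fin (c j)) → M) (i : Fin r) (w) :
    prefixSum J i w = ∑ a, prefixSum J (i + 1) (Function.update w i a) := by
  simp only [prefixSum, Finset.sum_filter]
  rw [Finset.sum_comm]
  refine Finset.sum_congr rfl fun u _ => ?_
  have : ∀ a, (∀ j : Fin r, (j : ℕ) < i + 1 → u j = Function.update w i a j) ↔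
      (a = u i ∧ ∀ j : Fin r, (j : ℕ) < i → u j = w j) := fun a => by
    constructor
    · refine fun h => ⟨by simpa using (h i (Nat.lt_succ_self _)).symm, fun j hj => ?_⟩
      have := h j (hj.trans (Nat.lt_succ_self _))
      rwa [Function.update_of_ne (Fin.ne_of_lt hj)] at this
    · rintro ⟨rfl, h⟩ j hj
      rcases (Nat.lt_succ_iff.1 hj).eq_or_lt with hj | hj
      · rw [Fin.ext hj, Function.update_self]
      · rw [Function.update_of_ne (Fin.ne_of_lt hj), h j hj]
  simp only [this, ite_and, Finset.sum_ite_eq', Finset.mem_univ, if_true]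

theorem prefixSum_congr (J : ((j : Fin r) → Fin (c j)) → M) {i : ℕ} {w w' : (j : Fin r) → Fin (c j)}
    (h : ∀ j : Fin r, (j : ℕ) < i → w j = w' j) : prefixSum J i w = prefixSum J i w' := by
  have : ∀ u : (j : Fin r) → Fin (c j), (∀ j : Fin r, (j : ℕ) < i → u j = w j) ↔
      ∀ j : Fin r, (j : ℕ) < i → u j = w' j := fun u =>
    forall_congr' fun j => imp_congr_right fun hj => by rw [h j hj]
  simp only [prefixSum, this]

/-- Induction from the last round to round `i`. -/
theorem prefix_induction {p : ℕ → ((j : Fin r) → Fin (c j)) → Prop} (top : ∀ w, p r w)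
    (step : ∀ (i : Fin r) (w), (∀ a, p (i + 1) (Function.update w i a)) → p i w) :
    ∀ i ≤ r, ∀ w, p i w := by
  intro i hi
  induction hi using Nat.decreasingInduction with
  | self => exact top
  | of_succ k hk ih => exact fun w => step ⟨k, hk⟩ w fun a => ih _

theorem prod_lt_succ (F : Fin r → ℝ) (i : Fin r) :
    ∏ j with (j : Fin r).val < i + 1, F j = F i * ∏ j with (j : Fin r).val < i, F j := by
  have hset : (univ.filter fun j : Fin r => (j : ℕ) < i + 1) =
      insert i (univ.filter fun j : Fin r => (j : ℕ) < i) := by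
    ext j
    simp [Fin.ext_iff, le_iff_eq_or_lt]
  rw [hset, Finset.prod_insert (by simp)]

theorem past_update (w : (j : Fin r) → Fin (c j)) {i j : Fin r} (hj : j ≤ i) (a : Fin (c i)) :
    past (Function.update w i a) j = past w j :=
  funext fun l => Function.update_of_ne (ne_of_lt (lt_of_lt_of_le l.2 hj)) _ _

theorem prod_lt_succ_update (F : (i : Fin r) → ((j : Set.Iio i) → Fin (c j)) → Fin (c i) → ℝ)
    (w : (j : Fin r) → Fin (c j)) (i : Fin r) (a : Fin (c i)) :
    (∏ j with (j : Fin r).val < i + 1, F j (past (Function.update w i a) j)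
      (Function.update w i a j)) =
      F i (past w i) a * ∏ j with (j : Fin r).val < i, F j (past w j) (w j) := by
  rw [prod_lt_succ (fun j => F j (past (Function.update w i a) j) (Function.update w i a j)),
    past_update w le_rfl, Function.update_self]
  congr 1
  refine Finset.prod_congr rfl fun j hj => ?_
  have hj' : j < i := by simpa using hj
  rw [past_update w hj'.le, Function.update_of_ne hj'.ne]

/-- Future messages sum out to one. -/
theorem prefixSum_prod {e : (i : Fin r) → ((j : Set.Iio i) → Fin (c j)) → Fin (c i) → ℝ}
    (he : ∀ i b, ∑ a, e i b a = 1) (i : ℕ) (hi : i ≤ r) (w : (j : Fin r) → Fin (c j)) :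
    prefixSum (fun u => ∏ j, e j (past u j) (u j)) i w =
      ∏ j with (j : Fin r).val < i, e j (past w j) (w j) := by
  revert w
  refine prefix_induction (p := fun i w => prefixSum (fun u => ∏ j, e j (past u j) (u j)) i w =
      ∏ j with (j : Fin r).val < i, e j (past w j) (w j)) (fun w => ?_) (fun i w ih => ?_) i hi
  · simp [prefixSum_top]
  · rw [prefixSum_succ]
    simp only [ih, prod_lt_succ_update e w i, ← Finset.sum_mul, he, one_mul]

end PrefixSum

end SecureComputation

namespace SecureComputation

open Real Finset

/-! ### Interaction trees, families of laws indexed by messages, and Markov chains. -/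

section Interaction

set_option linter.unusedSectionVars false

variable {X Y Z₁ Z₂ : Type*} [Fintype X] [Fintype Y] [Fintype Z₁] [Fintype Z₂]

/-- Neither `q` nor `g` depends on `u`, and `f u a` cancels on conditioning on `A = a`. This is the
Markov chain of a round in which only the speaker's factor depends on the message. -/
theorem sameConditional_sum_of_factor {Ω α β ι : Type*} [Fintype Ω] [Fintype β] [Fintype ι]
    {A : Ω → α} {B : Ω → β} {R : ι → Ω → ℝ} {q : α → β → ℝ} {f : ι → α → ℝ} {g : β → ℝ}
    (h : ∀ u a b, law (R u) (fun ω => (A ω, B ω)) (a, b) = q a b * f u a * g b) (u : ι) :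
    SameConditional A B (R u) (∑ u, R u) := fun a b => by
  rw [law_sum, law_sum, law_eq_sum_right (R u) A B]
  simp only [law_eq_sum_right (R _) A B, h]
  have : ∀ i : ι, ∑ b, q a b * f i a * g b = f i a * ∑ b, q a b * g b := fun i => by
    rw [Finset.mul_sum]
    exact Finset.sum_congr rfl fun _ _ => by ring
  have h2 : ∑ i : ι, q a b * f i a * g b = (∑ i, f i a) * (q a b * g b) := by
    rw [Finset.sum_mul]
    exact Finset.sum_congr rfl fun _ _ => by ring
  simp only [this, h2, ← Finset.sum_mul]
  ring

theorem decodable_of_factor {P : X × Y × Z₁ × Z₂ → ℝ} {q : X → Y → ℝ} {f : X → Z₁ → ℝ}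
    {g : Y → Z₂ → ℝ} (h : ∀ x y z₁ z₂, P (x, y, z₁, z₂) = q x y * f x z₁ * g y z₂) :
    Decodable P := by
  classical
  constructor
  · intro z₁ x yz
    obtain ⟨y, z₂⟩ := yz
    simp only [law_apply, Prod.mk.injEq, Fintype.sum_prod_type, ite_and, Finset.sum_ite_eq',
      Finset.sum_ite_irrel, Finset.sum_const_zero, Finset.mem_univ, if_true, h]
    simp only [← Finset.mul_sum, ← Finset.sum_mul]
    simp only [mul_right_comm _ (∑ i, f x i), mul_right_comm _ (f x z₁), ← Finset.sum_mul]
    ring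
  · intro z₂ y xz
    obtain ⟨x, z₁⟩ := xz
    simp only [law_apply, Prod.mk.injEq, Fintype.sum_prod_type, ite_and, Finset.sum_ite_eq',
      Finset.sum_ite_irrel, Finset.sum_const_zero, Finset.mem_univ, if_true, h]
    simp only [← Finset.mul_sum, ← Finset.sum_mul]
    ring

/-- Backward over the rounds: the subtrees after round `i` already use `L` message values, and
`reachable_succ_of_sum` then cuts the alphabet of round `i` itself, whatever the size `c i`. -/
theorem reachable_prefixSum {r : ℕ} {c : Fin r → ℕ} {L : ℕ}
    (hL : L = Fintype.card (X × Y × Z₁ × Z₂) + 1)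
    {J : ((j : Fin r) → Fin (c j)) → X × Y × Z₁ × Z₂ → ℝ} (h0 : ∀ u v, 0 ≤ J u v)
    (hdec : ∀ u, Decodable (J u))
    (hround : ∀ (i : Fin r) w a, RoundMarkov i (prefixSum J (i + 1) (Function.update w i a))
      (prefixSum J i w)) (i : ℕ) (hi : i ≤ r) (w : (j : Fin r) → Fin (c j)) :
    Reachable L (r - i) i (prefixSum J i w) (prefixSum (fun u => leakPotential (J u)) i w) := by
  revert w
  refine prefix_induction (p := fun i w => Reachable L (r - i) i (prefixSum J i w)
    (prefixSum (fun u => leakPotential (J u)) i w)) (fun w => ?_) (fun i w ih => ?_) i hi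
  · rw [Nat.sub_self, prefixSum_top, prefixSum_top]
    exact ⟨h0 w, hdec w, rfl⟩
  · have hr : r - i = r - (i + 1) + 1 := by omega
    rw [hr, prefixSum_succ J, prefixSum_succ fun u => leakPotential (J u)]
    refine reachable_succ_of_sum hL ih fun a => ?_
    rw [← prefixSum_succ J]
    exact hround i w a

theorem prefixSum_cons {M : Type*} [AddCommMonoid M] {k L : ℕ}
    (F : Fin L → (Fin k → Fin L) → M) (j : ℕ) (w : Fin (k + 1) → Fin L) :
    prefixSum (c := fun _ => L) (fun u : Fin (k + 1) → Fin L => F (u 0) (Fin.tail u)) (j + 1) w =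
      prefixSum (c := fun _ => L) (F (w 0)) j (Fin.tail w) := by
  simp only [prefixSum, Finset.sum_filter]
  rw [← (Fin.consEquiv fun _ => Fin L).sum_comp, Fintype.sum_prod_type]
  simp only [Fin.consEquiv_apply, Fin.forall_fin_succ, Fin.cons_zero, Fin.cons_succ, Fin.val_zero,
    Fin.val_succ, Nat.zero_lt_succ, true_imp_iff, add_lt_add_iff_right, ite_and,
    Finset.sum_ite_irrel, Finset.sum_const_zero, Finset.sum_ite_eq', Finset.mem_univ, if_true]
  rfl

theorem sum_cons {M : Type*} [AddCommMonoid M] {k L : ℕ} (F : Fin L → (Fin k → Fin L) → M) :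
    ∑ u : Fin (k + 1) → Fin L, F (u 0) (Fin.tail u) = ∑ a, ∑ u, F a u := by
  rw [← (Fin.consEquiv fun _ => Fin L).sum_comp, Fintype.sum_prod_type]
  rfl

/-- The tree unfolds into its leaf laws, indexed by message paths. The law at a node is the sum over
the paths through it, so conditions at nodes become conditions on successive prefix sums. -/
theorem exists_of_reachable {L : ℕ} : ∀ {k i : ℕ} {P : X × Y × Z₁ × Z₂ → ℝ} {v : ℝ},
    Reachable L k i P v → ∃ J : (Fin k → Fin L) → X × Y × Z₁ × Z₂ → ℝ,
      (∀ u v, 0 ≤ J u v) ∧ (∑ u, J u = P) ∧ (∑ u, leakPotential (J u) = v) ∧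
      (∀ u, Decodable (J u)) ∧
      ∀ (j : Fin k) w, RoundMarkov (i + j) (prefixSum (c := fun _ => L) J (j + 1) w)
        (prefixSum (c := fun _ => L) J j w)
  | 0, i, P, v, ⟨h0, hd, hv⟩ => ⟨fun _ => P, fun _ => h0, by simp, by simp [hv], fun _ => hd,
      fun j => j.elim0⟩
  | k + 1, i, P, v, ⟨R, s, h, hP, hv, hR⟩ => by
    choose F h1 h2 h3 h4 h5 using fun u => exists_of_reachable (h u)
    have hsum : ∑ u : Fin (k + 1) → Fin L, F (u 0) (Fin.tail u) = P := by
      rw [sum_cons F, hP]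
      exact Finset.sum_congr rfl fun a _ => h2 a
    refine ⟨fun u => F (u 0) (Fin.tail u), fun u => h1 _ _, hsum, ?_, fun u => h4 _ _,
      fun j w => ?_⟩
    · rw [sum_cons fun a u => leakPotential (F a u), hv]
      exact Finset.sum_congr rfl fun a _ => h3 a
    · rw [prefixSum_cons]
      induction j using Fin.cases with
      | zero =>
        simp only [Fin.val_zero, add_zero, prefixSum_zero, h2]
        have : ∑ u : Fin (k + 1) → Fin L, F (u 0) (Fin.tail u) = P := hsum
        rw [this]
        exact hR _
      | succ j =>
        have := h5 (w 0) j (Fin.tail w)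
        rw [Fin.val_succ, prefixSum_cons, ← add_assoc, add_right_comm]
        exact this

/-- The joint laws `J u = P(U = u, ·)` of auxiliary variables for the target law `Q`. -/
structure IsAuxiliary {r : ℕ} {c : Fin r → ℕ} (J : ((j : Fin r) → Fin (c j)) → X × Y × Z₁ × Z₂ → ℝ)
    (Q : X × Y × Z₁ × Z₂ → ℝ) : Prop where
  nonneg : ∀ u v, 0 ≤ J u v
  sum_eq : ∑ u, J u = Q
  decodable : ∀ u, Decodable (J u)
  round : ∀ (i : Fin r) w, RoundMarkov i (prefixSum J (i + 1) w) (prefixSum J i w)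
  privateA : ∀ u, SameConditional (fun v => (v.1, v.2.2.1)) (fun v => (v.2.1, v.2.2.2)) (J u) Q
  privateB : ∀ u, SameConditional (fun v => (v.2.1, v.2.2.2)) (fun v => (v.1, v.2.2.1)) (J u) Q

section

variable {r : ℕ} {c : Fin r → ℕ}

theorem sum_outcome_messages {U : Type*} [Fintype U] (F : X × Y × Z₁ × Z₂ × U → ℝ) :
    ∑ ω, F ω = ∑ u, ∑ v : X × Y × Z₁ × Z₂, F (v.1, v.2.1, v.2.2.1, v.2.2.2, u) := by
  rw [← Fintype.sum_prod_type_right']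
  exact Fintype.sum_equiv
    ⟨fun ω => ((ω.1, ω.2.1, ω.2.2.1, ω.2.2.2.1), ω.2.2.2.2),
      fun x => (x.1.1, x.1.2.1, x.1.2.2.1, x.1.2.2.2, x.2), fun _ => rfl, fun _ => rfl⟩ _ _
    fun _ => rfl

theorem law_eq_of_iff {U α τ : Type*} [Fintype U] (P : X × Y × Z₁ × Z₂ × U → ℝ)
    (T : X × Y × Z₁ × Z₂ × U → τ) (t : τ) (G : U → Prop) [DecidablePred G]
    (f : X × Y × Z₁ × Z₂ → α) (a : α)
    (h : ∀ x y z₁ z₂ u, T (x, y, z₁, z₂, u) = t ↔ G u ∧ f (x, y, z₁, z₂) = a) :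
    law P T t = law (∑ u with G u, fun v => P (v.1, v.2.1, v.2.2.1, v.2.2.2, u)) f a := by
  classical
  rw [law_sum, law_apply, sum_outcome_messages, Finset.sum_filter]
  refine Finset.sum_congr rfl fun u _ => ?_
  simp only [law_apply, h, ite_and]
  split_ifs <;> simp

theorem past_eq_past_iff {u w : (j : Fin r) → Fin (c j)} {i : Fin r} :
    past u i = past w i ↔ ∀ j : Fin r, (j : ℕ) < i → u j = w j := by
  simp only [past, funext_iff, Subtype.forall, Set.mem_Iio, Fin.lt_def]

theorem forall_lt_succ_iff {u w : (j : Fin r) → Fin (c j)} {i : Fin r} :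
    (∀ j : Fin r, (j : ℕ) < i + 1 → u j = w j) ↔ u i = w i ∧ past u i = past w i := by
  rw [past_eq_past_iff]
  constructor
  · exact fun h => ⟨h i (Nat.lt_succ_self _), fun j hj => h j (hj.trans (Nat.lt_succ_self _))⟩
  · rintro ⟨h, h'⟩ j hj
    rcases (Nat.lt_succ_iff.1 hj).eq_or_lt with hj | hj
    · rwa [Fin.ext hj]
    · exact h' j hj

variable (P : X × Y × Z₁ × Z₂ × ((j : Fin r) → Fin (c j)) → ℝ)

/-- The law of `(X,Y,Z₁,Z₂)` on the event `U = u`. -/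
def slice (u : (j : Fin r) → Fin (c j)) (v : X × Y × Z₁ × Z₂) : ℝ :=
  P (v.1, v.2.1, v.2.2.1, v.2.2.2, u)

/-- Fixing the past and the current message means fixing the first `i + 1` messages, so all four
laws are laws of letters under prefix sums of the slices. -/
theorem markovChain_round_iff_of_eq {β γ : Type*} (f : X × Y × Z₁ × Z₂ → β)
    (g : X × Y × Z₁ × Z₂ → γ) (i : Fin r) (w : (j : Fin r) → Fin (c j)) (x : β) (y : γ) :
    (law P (fun ω => (ω.2.2.2.2 i, (past ω.2.2.2.2 i, f (ω.1, ω.2.1, ω.2.2.1, ω.2.2.2.1)),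
          g (ω.1, ω.2.1, ω.2.2.1, ω.2.2.2.1))) (w i, (past w i, x), y) *
        law P (fun ω => (past ω.2.2.2.2 i, f (ω.1, ω.2.1, ω.2.2.1, ω.2.2.2.1))) (past w i, x) =
      law P (fun ω => (ω.2.2.2.2 i, (past ω.2.2.2.2 i, f (ω.1, ω.2.1, ω.2.2.1, ω.2.2.2.1))))
          (w i, (past w i, x)) *
        law P (fun ω => ((past ω.2.2.2.2 i, f (ω.1, ω.2.1, ω.2.2.1, ω.2.2.2.1)),
          g (ω.1, ω.2.1, ω.2.2.1, ω.2.2.2.1))) ((past w i, x), y)) ↔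
    (law (prefixSum (slice P) (i + 1) w) (fun v => (f v, g v)) (x, y) *
        law (prefixSum (slice P) i w) f x =
      law (prefixSum (slice P) (i + 1) w) f x *
        law (prefixSum (slice P) i w) (fun v => (f v, g v)) (x, y)) := by
  classical
  rw [law_eq_of_iff P _ (w i, (past w i, x), y)
      (fun u => ∀ j : Fin r, (j : ℕ) < i + 1 → u j = w j) (fun v => (f v, g v)) (x, y),
    law_eq_of_iff P _ (past w i, x) (fun u => ∀ j : Fin r, (j : ℕ) < i → u j = w j) f x,
    law_eq_of_iff P _ (w i, (past w i, x))
      (fun u => ∀ j : Fin r, (j : ℕ) < i + 1 → u j = w j) f x,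
    law_eq_of_iff P _ ((past w i, x), y)
      (fun u => ∀ j : Fin r, (j : ℕ) < i → u j = w j) (fun v => (f v, g v)) (x, y)]
  · rfl
  all_goals
    intro x y z₁ z₂ u
    simp only [Prod.mk.injEq, forall_lt_succ_iff, ← past_eq_past_iff]
    try tauto

theorem exists_vector_extending (w₀ : (j : Fin r) → Fin (c j)) (i : Fin r) (a : Fin (c i))
    (b : (j : Set.Iio i) → Fin (c j)) :
    ∃ w : (j : Fin r) → Fin (c j), w i = a ∧ past w i = b := by
  classical
  refine ⟨Function.update (fun j => if h : j < i then b ⟨j, h⟩ else w₀ j) i a,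
    Function.update_self .., funext fun j => ?_⟩
  have hj : (j : Fin r) < i := j.2
  simp [past, Function.update_of_ne hj.ne, hj]

theorem round_of_markovChain
    (heven : ∀ i : Fin r, Even (i : ℕ) → MarkovChain P (fun ω => ω.2.2.2.2 i)
      (fun ω => (past ω.2.2.2.2 i, ω.1)) (fun ω => ω.2.1))
    (hodd : ∀ i : Fin r, ¬ Even (i : ℕ) → MarkovChain P (fun ω => ω.2.2.2.2 i)
      (fun ω => (past ω.2.2.2.2 i, ω.2.1)) (fun ω => ω.1)) (i : Fin r) (w) :
    RoundMarkov i (prefixSum (slice P) (i + 1) w) (prefixSum (slice P) i w) :=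
  ⟨fun hi x y => (markovChain_round_iff_of_eq P (fun v => v.1) (fun v => v.2.1) i w x y).1
      (heven i hi _ _ _),
    fun hi y x => (markovChain_round_iff_of_eq P (fun v => v.2.1) (fun v => v.1) i w y x).1
      (hodd i hi _ _ _)⟩

theorem markovChain_of_round {β γ : Type*} (f : X × Y × Z₁ × Z₂ → β)
    (g : X × Y × Z₁ × Z₂ → γ) (w₀ : (j : Fin r) → Fin (c j)) (i : Fin r)
    (h : ∀ w, SameConditional f g (prefixSum (slice P) (i + 1) w) (prefixSum (slice P) i w)) :
    MarkovChain P (fun ω => ω.2.2.2.2 i)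
      (fun ω => (past ω.2.2.2.2 i, f (ω.1, ω.2.1, ω.2.2.1, ω.2.2.2.1)))
      (fun ω => g (ω.1, ω.2.1, ω.2.2.1, ω.2.2.2.1)) := by
  rintro a ⟨b, x⟩ y
  obtain ⟨w, rfl, rfl⟩ := exists_vector_extending w₀ i a b
  exact (markovChain_round_iff_of_eq P f g i w x y).2 (h w x y)

theorem sum_filter_eq_slice (u₀ : (j : Fin r) → Fin (c j)) :
    (∑ u with u = u₀, fun v : X × Y × Z₁ × Z₂ => P (v.1, v.2.1, v.2.2.1, v.2.2.2, u)) =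
      slice P u₀ := by
  rw [Finset.sum_filter, Finset.sum_ite_eq' univ u₀, if_pos (Finset.mem_univ _)]
  rfl

theorem markovChain_given_messages_iff {α β γ : Type*} (e : X × Y × Z₁ × Z₂ → α)
    (f : X × Y × Z₁ × Z₂ → β) (g : X × Y × Z₁ × Z₂ → γ) :
    MarkovChain P (fun ω => e (ω.1, ω.2.1, ω.2.2.1, ω.2.2.2.1))
      (fun ω => (ω.2.2.2.2, f (ω.1, ω.2.1, ω.2.2.1, ω.2.2.2.1)))
      (fun ω => g (ω.1, ω.2.1, ω.2.2.1, ω.2.2.2.1)) ↔ ∀ u, MarkovChain (slice P u) e f g := by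
  unfold MarkovChain
  rw [forall_comm, Prod.forall]
  refine forall_congr' fun u => ?_
  rw [forall_comm]
  refine forall_congr' fun a => forall_congr' fun b => forall_congr' fun d => ?_
  rw [law_eq_of_iff P _ (a, (u, b), d) (fun u' => u' = u) (fun v => (e v, f v, g v)) (a, b, d),
    law_eq_of_iff P _ (u, b) (fun u' => u' = u) f b,
    law_eq_of_iff P _ (a, (u, b)) (fun u' => u' = u) (fun v => (e v, f v)) (a, b),
    law_eq_of_iff P _ ((u, b), d) (fun u' => u' = u) (fun v => (f v, g v)) (b, d)]
  · rw [sum_filter_eq_slice]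
  all_goals
    intro x y z₁ z₂ u'
    simp only [Prod.mk.injEq]
    try tauto

theorem markovChain_messages_iff {β γ : Type*} (f : X × Y × Z₁ × Z₂ → β)
    (g : X × Y × Z₁ × Z₂ → γ) :
    MarkovChain P (fun ω => ω.2.2.2.2) (fun ω => f (ω.1, ω.2.1, ω.2.2.1, ω.2.2.2.1))
      (fun ω => g (ω.1, ω.2.1, ω.2.2.1, ω.2.2.2.1)) ↔
      ∀ u, SameConditional f g (slice P u) (∑ u, slice P u) := by
  refine forall_congr' fun u => forall_congr' fun b => forall_congr' fun d => ?_
  have h : (∑ u with True, fun v : X × Y × Z₁ × Z₂ => P (v.1, v.2.1, v.2.2.1, v.2.2.2, u)) =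
      ∑ u, slice P u := by
    rw [Finset.filter_true]
    rfl
  rw [law_eq_of_iff P _ (u, b, d) (fun u' => u' = u) (fun v => (f v, g v)) (b, d),
    law_eq_of_iff P _ b (fun _ => True) f b,
    law_eq_of_iff P _ (u, b) (fun u' => u' = u) f b,
    law_eq_of_iff P _ (b, d) (fun _ => True) (fun v => (f v, g v)) (b, d)]
  · rw [sum_filter_eq_slice, h]
  all_goals
    intro x y z₁ z₂ u'
    simp only [Prod.mk.injEq]
    try tauto

/-- The Markov chains in `HasAuxiliaries` in terms of the laws on the events `U = u`. -/
theorem exists_isAuxiliary_of_hasAuxiliaries {q : X × Y → ℝ} (hq : q ∈ stdSimplex ℝ (X × Y))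
    {κ : X × Y → Z₁ × Z₂ → ℝ} (hκ : ∀ a, κ a ∈ stdSimplex ℝ (Z₁ × Z₂))
    (h : HasAuxiliaries r q κ) :
    ∃ (c : Fin r → ℕ) (J : ((j : Fin r) → Fin (c j)) → X × Y × Z₁ × Z₂ → ℝ),
      IsAuxiliary J fun v => q (v.1, v.2.1) * κ (v.1, v.2.1) (v.2.2.1, v.2.2.2) := by
  obtain ⟨c, p, hp, heven, hodd, hA, hB, hpA, hpB, -⟩ := h
  have hsum : ∑ u, slice (auxJoint q κ p) u =
      fun v => q (v.1, v.2.1) * κ (v.1, v.2.1) (v.2.2.1, v.2.2.2) := by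
    ext v
    simp only [Finset.sum_apply, slice, auxJoint, ← Finset.mul_sum, (hp _).2, mul_one]
  refine ⟨c, slice (auxJoint q κ p), fun u v => mul_nonneg (mul_nonneg (hq.1 _) ((hκ _).1 _))
    ((hp _).1 _), hsum, fun u => ⟨?_, ?_⟩, fun i w => round_of_markovChain _ heven hodd i w, ?_, ?_⟩
  · exact (markovChain_given_messages_iff _ (fun v => v.2.2.1) (fun v => v.1)
      (fun v => (v.2.1, v.2.2.2))).1 hA u
  · exact (markovChain_given_messages_iff _ (fun v => v.2.2.2) (fun v => v.2.1)
      (fun v => (v.1, v.2.2.1))).1 hB u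
  · rw [← hsum]
    exact (markovChain_messages_iff _ (fun v => (v.1, v.2.2.1)) (fun v => (v.2.1, v.2.2.2))).1 hpA
  · rw [← hsum]
    exact (markovChain_messages_iff _ (fun v => (v.2.1, v.2.2.2)) (fun v => (v.1, v.2.2.1))).1 hpB

theorem hasAuxiliaries_of_isAuxiliary {q : X × Y → ℝ} {κ : X × Y → Z₁ × Z₂ → ℝ} {L : ℕ}
    (hL : L = Fintype.card (X × Y × Z₁ × Z₂) + 1)
    {J : (Fin r → Fin L) → X × Y × Z₁ × Z₂ → ℝ}
    (hJ : IsAuxiliary (c := fun _ => L) J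
      fun v : X × Y × Z₁ × Z₂ => q (v.1, v.2.1) * κ (v.1, v.2.1) (v.2.2.1, v.2.2.2)) :
    HasAuxiliaries r q κ := by
  classical
  have hL0 : 0 < L := hL ▸ Nat.succ_pos _
  have hle : ∀ u v, J u v ≤ q (v.1, v.2.1) * κ (v.1, v.2.1) (v.2.2.1, v.2.2.2) := fun u v => by
    have := congrFun hJ.sum_eq v
    rw [← this, Finset.sum_apply]
    exact Finset.single_le_sum (fun u _ => hJ.nonneg u v) (Finset.mem_univ u)
  set w₀ : Fin r → Fin L := fun _ => ⟨0, hL0⟩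
  -- Where the target law vanishes the conditional p.m.f. is multiplied by zero, so any point mass
  -- will do.
  set p : X × Y × Z₁ × Z₂ → (Fin r → Fin L) → ℝ := fun v =>
    if q (v.1, v.2.1) * κ (v.1, v.2.1) (v.2.2.1, v.2.2.2) = 0 then Pi.single w₀ 1
    else fun u => J u v / (q (v.1, v.2.1) * κ (v.1, v.2.1) (v.2.2.1, v.2.2.2)) with hp
  have hslice : slice (c := fun _ => L) (auxJoint q κ p) = J := by
    ext u v
    simp only [slice, auxJoint, hp]
    split_ifs with h
    · rw [h, zero_mul]
      exact le_antisymm (hJ.nonneg u v) ((hle u v).trans_eq h)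
    · rw [mul_div_cancel₀ _ h]
  have hpq : ∀ v : X × Y × Z₁ × Z₂, 0 ≤ q (v.1, v.2.1) * κ (v.1, v.2.1) (v.2.2.1, v.2.2.2) := fun v =>
    (hJ.nonneg w₀ v).trans (hle w₀ v)
  have hround := hJ.round
  have hdec := hJ.decodable
  have hA := hJ.privateA
  have hB := hJ.privateB
  rw [← hJ.sum_eq, ← hslice] at hA hB
  rw [← hslice] at hround hdec
  refine ⟨fun _ => L, p, fun v => ?_,
    fun i hi => markovChain_of_round _ (fun v => v.1) (fun v => v.2.1) w₀ i
      fun w => (hround i w).1 hi,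
    fun i hi => markovChain_of_round _ (fun v => v.2.1) (fun v => v.1) w₀ i
      fun w => (hround i w).2 hi,
    (markovChain_given_messages_iff _ (fun v => v.2.2.1) (fun v => v.1)
      (fun v => (v.2.1, v.2.2.2))).2 fun u => (hdec u).1,
    (markovChain_given_messages_iff _ (fun v => v.2.2.2) (fun v => v.2.1)
      (fun v => (v.1, v.2.2.1))).2 fun u => (hdec u).2,
    (markovChain_messages_iff _ (fun v => (v.1, v.2.2.1)) (fun v => (v.2.1, v.2.2.2))).2 hA,
    (markovChain_messages_iff _ (fun v => (v.2.1, v.2.2.2)) (fun v => (v.1, v.2.2.1))).2 hB,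
    fun i => ?_⟩
  · simp only [hp]
    split_ifs with h
    · exact single_mem_stdSimplex ℝ w₀
    · refine ⟨fun u => div_nonneg (hJ.nonneg u v) (hpq v), ?_⟩
      rw [← Finset.sum_div, div_eq_one_iff_eq h]
      simpa using congrFun hJ.sum_eq v
  · have : 1 ≤ ∏ j ∈ Finset.Iio i, L := Finset.one_le_prod' fun _ _ => hL0
    rw [hL] at this ⊢
    simp only [Fintype.card_prod] at this ⊢
    refine Nat.add_le_add_right ?_ 1
    rw [← mul_assoc, ← mul_assoc] at this ⊢
    exact Nat.le_mul_of_pos_right _ this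

end

end Interaction

end SecureComputation

namespace SecureComputation

open Real Finset Filter Topology

/-! ### Entropies of a family of unnormalized laws. -/

section Slices

set_option linter.unusedSectionVars false

variable {Ω υ τ α : Type*} [Fintype Ω] [Fintype υ] [Fintype τ] [Fintype α]

theorem law_slice (P : Ω → ℝ) (U : Ω → υ) (V : Ω → τ) (f : τ → α) (u : υ) (a : α) :
    law (fun v => law P (fun ω => (U ω, V ω)) (u, v)) f a =
      law P (fun ω => (U ω, f (V ω))) (u, a) := by
  classical
  rw [← law_law P (fun ω => (U ω, V ω)) (fun x => (x.1, f x.2)), law_apply, law_apply,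
    Fintype.sum_prod_type]
  simp only [Prod.mk.injEq, ite_and, Finset.sum_ite_irrel, Finset.sum_const_zero,
    Finset.sum_ite_eq', Finset.mem_univ, if_true]

theorem entropy_pair_eq_sum (P : Ω → ℝ) (U : Ω → υ) (V : Ω → τ) (f : τ → α) :
    entropy P (fun ω => (U ω, f (V ω))) =
      ∑ u, entropy (fun v => law P (fun ω => (U ω, V ω)) (u, v)) f := by
  simp only [entropy, law_slice]
  rw [Fintype.sum_prod_type]

/-- The family `J` is read as one joint law on `U × τ`, so that the index becomes a random variable
and the conditional entropy inequalities apply to it. -/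
theorem law_family_fst_snd {U α : Type*} [Fintype U] (J : U → τ → ℝ) (f : τ → α) (u : U) (a : α) :
    law (fun ω : U × τ => J ω.1 ω.2) (fun ω => (ω.1, f ω.2)) (u, a) = law (J u) f a := by
  classical
  rw [law_apply, law_apply, Fintype.sum_prod_type]
  simp only [Prod.mk.injEq, ite_and, Finset.sum_ite_irrel, Finset.sum_const_zero,
    Finset.sum_ite_eq', Finset.mem_univ, if_true]

theorem law_family_snd {U α : Type*} [Fintype U] (J : U → τ → ℝ) (f : τ → α) :
    law (fun ω : U × τ => J ω.1 ω.2) (fun ω => f ω.2) = law (∑ u, J u) f := by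
  classical
  ext a
  rw [law_eq_sum_left _ (fun ω : U × τ => f ω.2) fun ω => ω.1, law_sum]
  exact Finset.sum_congr rfl fun u _ => law_family_fst_snd J f u a

theorem entropy_family_fst_snd {U : Type*} [Fintype U] (J : U → τ → ℝ) (f : τ → α) :
    entropy (fun ω : U × τ => J ω.1 ω.2) (fun ω => (ω.1, f ω.2)) = ∑ u, entropy (J u) f := by
  simp only [entropy, Fintype.sum_prod_type, law_family_fst_snd]

theorem entropy_family_snd {U : Type*} [Fintype U] (J : U → τ → ℝ) (f : τ → α) :
    entropy (fun ω : U × τ => J ω.1 ω.2) (fun ω => f ω.2) = entropy (∑ u, J u) f := by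
  simp only [entropy, law_family_snd]

theorem entropy_family_left_comm {U β : Type*} [Fintype U] [Fintype β] (J : U → τ → ℝ)
    (f : τ → α) (g : τ → β) :
    entropy (fun ω : U × τ => J ω.1 ω.2) (fun ω => (g ω.2, ω.1, f ω.2)) =
      ∑ u, entropy (J u) fun v => (g v, f v) := by
  rw [← entropy_family_fst_snd]
  exact entropy_congr_ker _ fun ω ω' => by
    simp only [Prod.ext_iff]
    tauto

theorem sum_condEntropy_le {U β : Type*} [Fintype U] [Fintype β] {J : U → τ → ℝ}
    (h0 : ∀ u v, 0 ≤ J u v) (f : τ → α) (g : τ → β) :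
    ∑ u, entropy (J u) (fun v => (g v, f v)) - ∑ u, entropy (J u) f ≤
      entropy (∑ u, J u) (fun v => (g v, f v)) - entropy (∑ u, J u) f := by
  have h := condEntropy_le_comp (P := fun ω : U × τ => J ω.1 ω.2) (fun ω => h0 _ _)
    (fun ω => g ω.2) (fun ω => (ω.1, f ω.2)) Prod.snd
  rwa [entropy_family_left_comm, entropy_family_fst_snd, entropy_family_snd J f,
    entropy_family_snd J fun v => (g v, f v)] at h

theorem sameConditional_of_le_sum_condEntropy {U β : Type*} [Fintype U] [Fintype β]
    {J : U → τ → ℝ} (h0 : ∀ u v, 0 ≤ J u v) (f : τ → α) (g : τ → β)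
    (h : entropy (∑ u, J u) (fun v => (g v, f v)) - entropy (∑ u, J u) f ≤
      ∑ u, entropy (J u) (fun v => (g v, f v)) - ∑ u, entropy (J u) f) (u : U) :
    SameConditional f g (J u) (∑ u, J u) := by
  intro a b
  have h := law_mul_law_of_condEntropy_eq (P := fun ω : U × τ => J ω.1 ω.2) (fun ω => h0 _ _)
    (fun ω => g ω.2) (fun ω => (ω.1, f ω.2)) Prod.snd (by
      rwa [entropy_family_left_comm, entropy_family_fst_snd, entropy_family_snd J f,
        entropy_family_snd J fun v => (g v, f v)]) b (u, a)
  have s1 := law_comp_of_injective (fun ω : U × τ => J ω.1 ω.2) (fun ω => (g ω.2, ω.1, f ω.2))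
    (f := fun x : β × U × α => (x.2.1, x.2.2, x.1))
    (fun x y h => by simp only [Prod.ext_iff] at h ⊢; tauto) (b, u, a)
  have s2 := law_comp_of_injective (∑ u, J u) (fun v => (g v, f v)) Prod.swap_injective (b, a)
  rw [← s1, law_family_fst_snd J f, law_family_snd J f, law_family_snd J fun v => (g v, f v),
    ← s2, law_family_fst_snd J fun v => (f v, g v)] at h
  rw [h, mul_comm]
  rfl

end Slices

/-! ### Passage to the limit of vanishing leakage. -/

section Limit

variable {X Y Z₁ Z₂ : Type*} [Fintype X] [Fintype Y] [Fintype Z₁] [Fintype Z₂]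

/-- A decomposition that does not decrease `leakPotential` has no leakage. -/
theorem sameConditional_of_leakPotential_le {U : Type*} [Fintype U]
    {J : U → X × Y × Z₁ × Z₂ → ℝ} (h0 : ∀ u v, 0 ≤ J u v)
    (h : leakPotential (∑ u, J u) ≤ ∑ u, leakPotential (J u)) (u : U) :
    SameConditional (fun v => (v.1, v.2.2.1)) (fun v => (v.2.1, v.2.2.2)) (J u) (∑ u, J u) ∧
    SameConditional (fun v => (v.2.1, v.2.2.2)) (fun v => (v.1, v.2.2.1)) (J u) (∑ u, J u) := by
  set f : X × Y × Z₁ × Z₂ → X × Z₁ := fun v => (v.1, v.2.2.1)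
  set g : X × Y × Z₁ × Z₂ → Y × Z₂ := fun v => (v.2.1, v.2.2.2)
  have e1 : ∀ P : X × Y × Z₁ × Z₂ → ℝ, entropy P (fun v => (g v, f v)) = entropy P fun v => v :=
    fun P => entropy_congr_ker P fun ω ω' => by
      simp only [f, g, Prod.ext_iff]
      tauto
  have e2 : ∀ P : X × Y × Z₁ × Z₂ → ℝ, entropy P (fun v => (f v, g v)) = entropy P fun v => v :=
    fun P => entropy_congr_ker P fun ω ω' => by
      simp only [f, g, Prod.ext_iff]
      tauto
  -- `leakPotential` is `H(g|f) + H(f|g)`. Neither term can grow under a decomposition, so a sum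
  -- that does not drop forces equality in both.
  have hA := sum_condEntropy_le h0 f g
  have hB := sum_condEntropy_le h0 g f
  have hle : 2 * entropy (∑ u, J u) (fun v => v) - entropy (∑ u, J u) f - entropy (∑ u, J u) g ≤
      2 * ∑ u, entropy (J u) (fun v => v) - ∑ u, entropy (J u) f - ∑ u, entropy (J u) g := by
    refine h.trans_eq ?_
    simp only [leakPotential, Finset.sum_sub_distrib, Finset.mul_sum]
    rfl
  simp only [e1, e2] at hA hB
  constructor
  · refine sameConditional_of_le_sum_condEntropy h0 f g ?_ u
    simp only [e1]
    linarith
  · refine sameConditional_of_le_sum_condEntropy h0 g f ?_ u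
    simp only [e2]
    linarith

/-- Written without division, the chain is a system of polynomial equations in the law; it passes to
limits even where conditioning events lose their mass. -/
theorem isClosed_markovChain {Ω α β γ : Type*} [Fintype Ω] (A : Ω → α) (B : Ω → β) (C : Ω → γ) :
    IsClosed {P : Ω → ℝ | MarkovChain P A B C} := by
  simp only [MarkovChain, Set.ofPred_forall]
  exact isClosed_iInter fun a => isClosed_iInter fun b => isClosed_iInter fun c =>
    isClosed_eq ((continuous_law _ _).mul (continuous_law _ _))
      ((continuous_law _ _).mul (continuous_law _ _))

theorem isClosed_decodable : IsClosed {P : X × Y × Z₁ × Z₂ → ℝ | Decodable P} :=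
  (isClosed_markovChain _ _ _).inter (isClosed_markovChain _ _ _)

theorem isClosed_sameConditional {Ω α β : Type*} [Fintype Ω] (A : Ω → α) (B : Ω → β) :
    IsClosed {P : (Ω → ℝ) × (Ω → ℝ) | SameConditional A B P.1 P.2} := by
  simp only [SameConditional, Set.ofPred_forall]
  exact isClosed_iInter fun a => isClosed_iInter fun b =>
    isClosed_eq (((continuous_law _ _).comp continuous_fst).mul
      ((continuous_law _ _).comp continuous_snd))
      (((continuous_law _ _).comp continuous_fst).mul
      ((continuous_law _ _).comp continuous_snd))

theorem isClosed_roundMarkov (i : ℕ) :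
    IsClosed {P : (X × Y × Z₁ × Z₂ → ℝ) × (X × Y × Z₁ × Z₂ → ℝ) | RoundMarkov i P.1 P.2} := by
  by_cases hi : Even i
  · simpa [RoundMarkov, hi] using isClosed_sameConditional _ _
  · simpa [RoundMarkov, hi] using isClosed_sameConditional _ _

/-- Since `L` does not depend on `η`, the approximate families have a common finite-dimensional
domain and a convergent subsequence. Continuity of `leakPotential` removes the leakage in the limit.
-/
theorem exists_isAuxiliary_of_approx {r L : ℕ} {Q : X × Y × Z₁ × Z₂ → ℝ}
    (h : ∀ η : ℝ, 0 < η → ∃ P v, Reachable L r 0 P v ∧ ∑ a, |P a - Q a| ≤ η ∧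
      leakPotential P - v ≤ η) :
    ∃ J : (Fin r → Fin L) → X × Y × Z₁ × Z₂ → ℝ, IsAuxiliary (c := fun _ => L) J Q := by
  have h' : ∀ n : ℕ, ∃ J : (Fin r → Fin L) → X × Y × Z₁ × Z₂ → ℝ, (∀ u v, 0 ≤ J u v) ∧
      (∀ v, |(∑ u, J u) v - Q v| ≤ 1 / ((n : ℝ) + 1)) ∧
      leakPotential (∑ u, J u) - ∑ u, leakPotential (J u) ≤ 1 / ((n : ℝ) + 1) ∧
      (∀ u, Decodable (J u)) ∧
      ∀ (j : Fin r) w, RoundMarkov j (prefixSum (c := fun _ => L) J (j + 1) w)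
        (prefixSum (c := fun _ => L) J j w) := fun n => by
    obtain ⟨P, v, hr, h1, h2⟩ := h _ (Nat.one_div_pos_of_nat (n := n))
    obtain ⟨J, j1, j2, j3, j4, j5⟩ := exists_of_reachable hr
    refine ⟨J, j1, fun a => ?_, by rw [j2, j3]; exact h2, j4, fun j w => by simpa using j5 j w⟩
    rw [j2]
    exact (Finset.single_le_sum (f := fun a => |P a - Q a|) (fun _ _ => abs_nonneg _)
      (Finset.mem_univ a)).trans h1
  choose J h0 hQ hleak hdec hround using h'
  -- Each nonnegative piece is at most the sum, which is within `1` of `Q`.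
  have hmem : ∀ n, J n ∈ Set.Icc (0 : (Fin r → Fin L) → X × Y × Z₁ × Z₂ → ℝ)
      (fun _ v => Q v + 1) := fun n => ⟨fun u v => h0 n u v, fun u v => by
    have h1 := (abs_le.1 (hQ n v)).2
    have h2 : (1 : ℝ) / ((n : ℝ) + 1) ≤ 1 := by
      rw [div_le_one (by positivity)]
      linarith [(Nat.cast_nonneg n : (0 : ℝ) ≤ n)]
    rw [Finset.sum_apply] at h1
    have h3 := Finset.single_le_sum (f := fun u => J n u v) (fun u _ => h0 n u v)
      (Finset.mem_univ u)
    linarith⟩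
  obtain ⟨a, ha, φ, hφ, hlim⟩ := isCompact_Icc.tendsto_subseq hmem
  have hu : ∀ u, Tendsto (fun n => J (φ n) u) atTop (𝓝 (a u)) := fun u =>
    (tendsto_pi_nhds.1 hlim) u
  have hone : Tendsto (fun n => 1 / (((φ n : ℕ) : ℝ) + 1)) atTop (𝓝 0) :=
    tendsto_one_div_add_atTop_nhds_zero_nat.comp hφ.tendsto_atTop
  have hsum : Tendsto (fun n => ∑ u, J (φ n) u) atTop (𝓝 (∑ u, a u)) :=
    tendsto_finsetSum _ fun u _ => hu u
  have hpre : ∀ (i : ℕ) (w : Fin r → Fin L),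
      Tendsto (fun n => prefixSum (c := fun _ => L) (J (φ n)) i w) atTop
        (𝓝 (prefixSum (c := fun _ => L) a i w)) := fun i w =>
    tendsto_finsetSum _ fun u _ => hu u
  have ha0 : ∀ u v, 0 ≤ a u v := fun u v => ha.1 u v
  have haQ : ∑ u, a u = Q := by
    ext v
    have h1 : Tendsto (fun n => |(∑ u, J (φ n) u) v - Q v|) atTop (𝓝 |(∑ u, a u) v - Q v|) :=
      (((tendsto_pi_nhds.1 hsum) v).sub_const _).abs
    have h2 := le_of_tendsto_of_tendsto' h1 hone fun n => hQ (φ n) v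
    exact sub_eq_zero.1 (abs_nonpos_iff.1 h2)
  have hal : leakPotential (∑ u, a u) ≤ ∑ u, leakPotential (a u) := by
    have h1 : Tendsto (fun n => leakPotential (∑ u, J (φ n) u) - ∑ u, leakPotential (J (φ n) u))
        atTop (𝓝 (leakPotential (∑ u, a u) - ∑ u, leakPotential (a u))) :=
      ((continuous_leakPotential.tendsto _).comp hsum).sub
        (tendsto_finsetSum _ fun u _ => (continuous_leakPotential.tendsto _).comp (hu u))
    exact sub_nonpos.1 (le_of_tendsto_of_tendsto' h1 hone fun n => hleak (φ n))
  have hpriv := sameConditional_of_leakPotential_le ha0 hal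
  rw [haQ] at hpriv
  exact ⟨a, ha0, haQ,
    fun u => isClosed_decodable.mem_of_tendsto (hu u) (Eventually.of_forall fun n => hdec _ u),
    fun i w => (isClosed_roundMarkov (i : ℕ)).mem_of_tendsto
      ((hpre (i + 1) w).prodMk_nhds (hpre i w)) (Eventually.of_forall fun n => hround _ i w),
    fun u => (hpriv u).1, fun u => (hpriv u).2⟩

end Limit

end SecureComputation

namespace SecureComputation

open Finset

/-! ### The letters of a protocol at one time, given context and messages. -/

theorem prod_eq_prod_lt_mul_prod_gt {n : ℕ} (t : Fin n) (F : Fin n → ℝ) :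
    ∏ s, F s = (∏ s : {s // s < t}, F s) * F t * ∏ s : {s // t < s}, F s := by
  rw [← Finset.prod_subtype (univ.filter fun s => s < t) (by simp) F,
    ← Finset.prod_subtype (univ.filter fun s => t < s) (by simp) F, Finset.prod_filter,
    Finset.prod_filter]
  have h : F t = ∏ s, if s = t then F s else 1 := by simp
  rw [h, ← Finset.prod_mul_distrib, ← Finset.prod_mul_distrib]
  refine Finset.prod_congr rfl fun s _ => ?_
  rcases lt_trichotomy s t with hs | rfl | hs
  · simp [hs, hs.ne, hs.not_gt]
  · simp
  · simp [hs, hs.ne', hs.not_gt]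

section Protocol

set_option linter.unusedSectionVars false

variable {X Y Z₁ Z₂ : Type*} [Fintype X] [Fintype Y] [Fintype Z₁] [Fintype Z₂]

/-- The common context of the two users at time `t`: the shared randomness, the past of `X` and the
future of `Y`. -/
abbrev Context (X Y : Type*) {n : ℕ} (K : ℕ) (t : Fin n) : Type _ :=
  Fin K × ({s : Fin n // s < t} → X) × ({s : Fin n // t < s} → Y)

open Classical in
/-- The weight of Alice's input sequences compatible with a context and the letter `x` at `t`. -/
noncomputable def weightA {n : ℕ} (q : X × Y → ℝ) (t : Fin n) (a : {s : Fin n // s < t} → X)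
    (b : {s : Fin n // t < s} → Y) (f : (Fin n → X) → ℝ) (x : X) : ℝ :=
  ∑ xs : Fin n → X, if (fun s : {s : Fin n // s < t} => xs s) = a ∧ xs t = x then
    f xs * ∏ s : {s // t < s}, q (xs s, b s) else 0

open Classical in
/-- The weight of Bob's input sequences compatible with a context and the letter `y` at `t`. -/
noncomputable def weightB {n : ℕ} (q : X × Y → ℝ) (t : Fin n) (a : {s : Fin n // s < t} → X)
    (b : {s : Fin n // t < s} → Y) (g : (Fin n → Y) → ℝ) (y : Y) : ℝ :=
  ∑ ys : Fin n → Y, if (fun s : {s : Fin n // t < s} => ys s) = b ∧ ys t = y then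
    g ys * ∏ s : {s // s < t}, q (a s, ys s) else 0

open Classical in
/-- Given the context, the two input sequences are coupled only through the current letters. -/
theorem sum_sequences_eq_mul {n : ℕ} (q : X × Y → ℝ) (t : Fin n) (a : {s : Fin n // s < t} → X)
    (b : {s : Fin n // t < s} → Y) (f : (Fin n → X) → ℝ) (g : (Fin n → Y) → ℝ) (x : X) (y : Y) :
    (∑ xs : Fin n → X, ∑ ys : Fin n → Y,
      if ((fun s : {s : Fin n // s < t} => xs s) = a ∧ xs t = x) ∧
        ((fun s : {s : Fin n // t < s} => ys s) = b ∧ ys t = y) then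
      (∏ s, q (xs s, ys s)) * f xs * g ys else 0) =
      q (x, y) * weightA q t a b f x * weightB q t a b g y := by
  rw [weightA, weightB, mul_assoc, Finset.sum_mul_sum, Finset.mul_sum]
  refine Finset.sum_congr rfl fun xs _ => ?_
  rw [Finset.mul_sum]
  refine Finset.sum_congr rfl fun ys _ => ?_
  by_cases h1 : (fun s : {s : Fin n // s < t} => xs s) = a ∧ xs t = x
  · by_cases h2 : (fun s : {s : Fin n // t < s} => ys s) = b ∧ ys t = y
    · rw [if_pos ⟨h1, h2⟩, if_pos h1, if_pos h2, prod_eq_prod_lt_mul_prod_gt t]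
      obtain ⟨rfl, rfl⟩ := h1
      obtain ⟨rfl, rfl⟩ := h2
      ring
    · rw [if_neg fun h => h2 h.2, if_neg h2, mul_zero, mul_zero]
  · rw [if_neg fun h => h1 h.1, if_neg h1, zero_mul, mul_zero]

/-- If Bob has not spoken, then the weight of his sequences does not depend on the current letter. -/
theorem weightB_one_const {n : ℕ} (q : X × Y → ℝ) (t : Fin n) (a : {s : Fin n // s < t} → X)
    (b : {s : Fin n // t < s} → Y) (y y' : Y) :
    weightB q t a b (fun _ => 1) y = weightB q t a b (fun _ => 1) y' := by
  classical
  -- Exchanging `y` and `y'` at coordinate `t` permutes the sequences, and neither the future `b`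
  -- nor the product over `s < t` sees that coordinate.
  refine Fintype.sum_equiv
    (Equiv.piCongrRight fun s => if s = t then Equiv.swap y y' else Equiv.refl Y) _ _ fun ys => ?_
  have h1 : ∀ s : {s : Fin n // t < s}, (s : Fin n) ≠ t := fun s => s.2.ne'
  have h2 : ∀ s : {s : Fin n // s < t}, (s : Fin n) ≠ t := fun s => s.2.ne
  have h3 : Equiv.swap y y' (ys t) = y' ↔ ys t = y := by
    rw [Equiv.swap_apply_eq_iff, Equiv.swap_apply_right]
  simp [Equiv.piCongrRight, h1, h2, h3]

theorem sum_outcome {n K r : ℕ} {m : Fin r → ℕ} (F : Outcome X Y Z₁ Z₂ n K m → ℝ) :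
    ∑ ω, F ω = ∑ w, ∑ x, ∑ y, ∑ u, ∑ z₁, ∑ z₂, F ⟨w, x, y, u, z₁, z₂⟩ := by
  rw [← (Outcome.equiv X Y Z₁ Z₂ n K m).symm.sum_comp]
  simp only [Fintype.sum_prod_type]
  rfl

namespace Protocol

variable {n r K : ℕ} (π : Protocol X Y Z₁ Z₂ n r K)

/-- The transition probabilities of the messages. -/
def enc (x : Fin n → X) (y : Fin n → Y) (w : Fin K) (i : Fin r) (b : (j : Set.Iio i) → Fin (π.m j))
    (a : Fin (π.m i)) : ℝ :=
  if Even (i : ℕ) then π.encA i x w b a else π.encB i y w b a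

theorem sum_enc (x : Fin n → X) (y : Fin n → Y) (w : Fin K) (i : Fin r)
    (b : (j : Set.Iio i) → Fin (π.m j)) : ∑ a, π.enc x y w i b a = 1 := by
  unfold enc
  split_ifs with h
  · exact (π.encA_pmf i h x w b).2
  · exact (π.encB_pmf i h y w b).2

theorem enc_nonneg (x : Fin n → X) (y : Fin n → Y) (w : Fin K) (i : Fin r)
    (b : (j : Set.Iio i) → Fin (π.m j)) (a) : 0 ≤ π.enc x y w i b a := by
  unfold enc
  split_ifs with h
  · exact (π.encA_pmf i h x w b).1 a
  · exact (π.encB_pmf i h y w b).1 a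

/-- Alice's factor of the probability of the messages before round `i`. -/
def factorA (i : ℕ) (w : Fin K) (u : (j : Fin r) → Fin (π.m j)) (x : Fin n → X) : ℝ :=
  ∏ j with (j : Fin r).val < i, if Even (j : ℕ) then π.encA j x w (past u j) (u j) else 1

/-- Bob's factor of the probability of the messages before round `i`. -/
def factorB (i : ℕ) (w : Fin K) (u : (j : Fin r) → Fin (π.m j)) (y : Fin n → Y) : ℝ :=
  ∏ j with (j : Fin r).val < i, if Even (j : ℕ) then 1 else π.encB j y w (past u j) (u j)

theorem prod_enc (i : ℕ) (w : Fin K) (u : (j : Fin r) → Fin (π.m j)) (x : Fin n → X)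
    (y : Fin n → Y) :
    ∏ j with (j : Fin r).val < i, π.enc x y w j (past u j) (u j) =
      π.factorA i w u x * π.factorB i w u y := by
  rw [factorA, factorB, ← Finset.prod_mul_distrib]
  refine Finset.prod_congr rfl fun j _ => ?_
  unfold enc
  split_ifs <;> simp

theorem factorB_succ_update {i : Fin r} (hi : Even (i : ℕ)) (w : Fin K)
    (u : (j : Fin r) → Fin (π.m j)) (a) :
    π.factorB (i + 1) w (Function.update u i a) = π.factorB i w u := by
  ext y
  rw [factorB, prod_lt_succ_update (fun j b a => if Even (j : ℕ) then 1 else π.encB j y w b a),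
    if_pos hi, one_mul, factorB]

theorem factorA_succ_update {i : Fin r} (hi : ¬ Even (i : ℕ)) (w : Fin K)
    (u : (j : Fin r) → Fin (π.m j)) (a) :
    π.factorA (i + 1) w (Function.update u i a) = π.factorA i w u := by
  ext x
  rw [factorA, prod_lt_succ_update (fun j b a => if Even (j : ℕ) then π.encA j x w b a else 1),
    if_neg hi, one_mul, factorA]

theorem induced_eq (q : X × Y → ℝ) (ω : Outcome X Y Z₁ Z₂ n K π.m) :
    π.induced q ω = (K : ℝ)⁻¹ * (∏ t, q (ω.x t, ω.y t)) *
      (∏ i, π.enc ω.x ω.y ω.w i (past ω.msg i) (ω.msg i)) *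
      π.decA ω.x ω.w ω.msg ω.z₁ * π.decB ω.y ω.w ω.msg ω.z₂ := rfl

theorem induced_nonneg {q : X × Y → ℝ} (hq : ∀ a, 0 ≤ q a) (ω) : 0 ≤ π.induced q ω := by
  rw [induced_eq]
  have h1 := (π.decA_pmf ω.x ω.w ω.msg).1 ω.z₁
  have h2 := (π.decB_pmf ω.y ω.w ω.msg).1 ω.z₂
  have h3 : 0 ≤ ∏ i, π.enc ω.x ω.y ω.w i (past ω.msg i) (ω.msg i) :=
    Finset.prod_nonneg fun i _ => π.enc_nonneg _ _ _ _ _ _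
  have h4 : 0 ≤ ∏ t, q (ω.x t, ω.y t) := Finset.prod_nonneg fun i _ => hq _
  positivity

/-- An empty alphabet carries no p.m.f.; the induction supplies the past messages at which an
encoder can be evaluated. -/
theorem m_pos (x : Fin n → X) (y : Fin n → Y) (w : Fin K) (i : Fin r) : 0 < π.m i := by
  obtain ⟨i, hi⟩ := i
  induction i using Nat.strong_induction_on with
  | _ i ih =>
    rw [pos_iff_ne_zero]
    intro h
    have := π.sum_enc x y w ⟨i, hi⟩ fun j => ⟨0, ih j.1.1 j.2 j.1.2⟩
    have he : IsEmpty (Fin (π.m ⟨i, hi⟩)) := by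
      rw [h]
      infer_instance
    simp at this

theorem sum_prod_enc (x : Fin n → X) (y : Fin n → Y) (w : Fin K) :
    ∑ u : (j : Fin r) → Fin (π.m j), ∏ i, π.enc x y w i (past u i) (u i) = 1 := by
  have := prefixSum_prod (π.sum_enc x y w) 0 (Nat.zero_le r)
    (fun j => ⟨0, π.m_pos x y w j⟩)
  simpa [prefixSum_zero] using this

theorem sum_decoders (q : X × Y → ℝ) (w : Fin K) (x : Fin n → X) (y : Fin n → Y)
    (u : (j : Fin r) → Fin (π.m j)) :
    ∑ z₁, ∑ z₂, π.induced q ⟨w, x, y, u, z₁, z₂⟩ =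
      (K : ℝ)⁻¹ * (∏ t, q (x t, y t)) * (∏ i, π.enc x y w i (past u i) (u i)) := by
  simp only [induced_eq, ← Finset.mul_sum, (π.decB_pmf y w u).2, mul_one, (π.decA_pmf x w u).2]

theorem induced_mem_stdSimplex {q : X × Y → ℝ} (hq : q ∈ stdSimplex ℝ (X × Y)) (hK : 1 ≤ K) :
    π.induced q ∈ stdSimplex ℝ (Outcome X Y Z₁ Z₂ n K π.m) := by
  refine ⟨π.induced_nonneg hq.1, ?_⟩
  rw [sum_outcome]
  simp only [sum_decoders, ← Finset.mul_sum, sum_prod_enc, mul_one]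
  have h : ∑ x : Fin n → X, ∑ y : Fin n → Y, ∏ t, q (x t, y t) = 1 := by
    rw [← Fintype.sum_prod_type', ← (Equiv.arrowProdEquivProdArrow (Fin n) _ _).sum_comp]
    exact (iid_mem_stdSimplex hq).2
  have hK' : (K : ℝ) ≠ 0 := by positivity
  simp [h, hK']

variable (t : Fin n)

/-- The current letters of all variables. -/
def letters (ω : Outcome X Y Z₁ Z₂ n K π.m) : X × Y × Z₁ × Z₂ := (ω.x t, ω.y t, ω.z₁ t, ω.z₂ t)

/-- The context at time `t`. -/
def context (ω : Outcome X Y Z₁ Z₂ n K π.m) : Context X Y K t :=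
  (ω.w, fun s => ω.x s, fun s => ω.y s)

/-- The law of the letters at time `t` on the event that context and messages are given. -/
noncomputable def letterLaw (q : X × Y → ℝ) (d : Context X Y K t)
    (u : (j : Fin r) → Fin (π.m j)) (v : X × Y × Z₁ × Z₂) : ℝ :=
  law (π.induced q) (fun ω => ((π.context t ω, ω.msg), π.letters t ω)) ((d, u), v)

-- For fixed `w` and messages the transcript probability is a factor in Alice's sequence times one
-- in Bob's, and so are the decoders. The context then decouples the two sequences away from `t`, by
-- `sum_sequences_eq_mul`.
open Classical in
theorem letterLaw_eq (q : X × Y → ℝ) (d : Context X Y K t)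
    (u : (j : Fin r) → Fin (π.m j)) (x : X) (y : Y) (z₁ : Z₁) (z₂ : Z₂) :
    π.letterLaw t q d u (x, y, z₁, z₂) = q (x, y) *
      weightA q t d.2.1 d.2.2 (fun xs => (K : ℝ)⁻¹ * π.factorA r d.1 u xs *
        ∑ z, if z t = z₁ then π.decA xs d.1 u z else 0) x *
      weightB q t d.2.1 d.2.2 (fun ys => π.factorB r d.1 u ys *
        ∑ z, if z t = z₂ then π.decB ys d.1 u z else 0) y := by
  obtain ⟨w, a, b⟩ := d
  rw [← sum_sequences_eq_mul, letterLaw, law_apply, sum_outcome]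
  simp only [context, letters, Prod.mk.injEq, ite_and, Finset.sum_ite_irrel, Finset.sum_const_zero,
    Finset.sum_ite_eq', Finset.mem_univ, if_true]
  refine Finset.sum_congr rfl fun xs _ => if_congr Iff.rfl ?_ rfl
  by_cases hx : xs t = x
  · rw [if_pos hx]
    refine Finset.sum_congr rfl fun ys _ => if_congr Iff.rfl ?_ rfl
    rw [if_pos hx]
    refine if_congr Iff.rfl ?_ rfl
    have h : ∏ i, π.enc xs ys w i (past u i) (u i) = π.factorA r w u xs * π.factorB r w u ys := by
      rw [← prod_enc]
      simp
    have h2 : ∀ c d e f g : ℝ, c * (d * e) * (f * g) = c * d * f * (e * g) :=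
      fun c d e f g => by ring
    rw [h2, Finset.sum_mul_sum, Finset.mul_sum]
    refine Finset.sum_congr rfl fun z₁' _ => ?_
    split_ifs
    · rw [Finset.mul_sum]
      refine Finset.sum_congr rfl fun z₂' _ => ?_
      rw [induced_eq, h]
      split_ifs <;> ring
    · simp
  · simp [hx]

-- The outputs and the messages from round `i` on sum out to one, which leaves only the users'
-- factors for the rounds before `i`.
open Classical in
theorem law_prefixSum_letterLaw (q : X × Y → ℝ) (d : Context X Y K t) (i : ℕ) (hi : i ≤ r)
    (u : (j : Fin r) → Fin (π.m j)) (x : X) (y : Y) :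
    law (prefixSum (π.letterLaw t q d) i u) (fun v => (v.1, v.2.1)) (x, y) = q (x, y) *
      weightA q t d.2.1 d.2.2 (fun xs => (K : ℝ)⁻¹ * π.factorA i d.1 u xs) x *
      weightB q t d.2.1 d.2.2 (π.factorB i d.1 u) y := by
  obtain ⟨w, a, b⟩ := d
  rw [← sum_sequences_eq_mul, prefixSum, law_sum]
  have h : ∀ u', law (π.letterLaw t q (w, a, b) u') (fun v => (v.1, v.2.1)) (x, y) =
      ∑ xs : Fin n → X, ∑ ys : Fin n → Y,
        if ((fun s : {s : Fin n // s < t} => xs s) = a ∧ xs t = x) ∧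
        ((fun s : {s : Fin n // t < s} => ys s) = b ∧ ys t = y) then
        (K : ℝ)⁻¹ * (∏ t, q (xs t, ys t)) * (∏ i, π.enc xs ys w i (past u' i) (u' i)) else 0 := by
    intro u'
    unfold letterLaw
    rw [law_slice (π.induced q) (fun ω => (π.context t ω, ω.msg)) (π.letters t), law_apply,
      sum_outcome]
    simp only [context, letters, Prod.mk.injEq, ite_and, Finset.sum_ite_irrel,
      Finset.sum_const_zero, Finset.sum_ite_eq', Finset.mem_univ, if_true, sum_decoders]
    refine Finset.sum_congr rfl fun xs _ => if_congr Iff.rfl ?_ rfl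
    by_cases hx : xs t = x <;> simp [hx]
  simp only [h]
  rw [Finset.sum_comm]
  refine Finset.sum_congr rfl fun xs _ => ?_
  rw [Finset.sum_comm]
  refine Finset.sum_congr rfl fun ys _ => ?_
  split_ifs
  · rw [← Finset.mul_sum]
    have h := prefixSum_prod (π.sum_enc xs ys w) i hi u
    rw [prod_enc, prefixSum] at h
    rw [h]
    ring
  · exact Finset.sum_const_zero

theorem letterLaw_nonneg {q : X × Y → ℝ} (hq : ∀ a, 0 ≤ q a) (d : Context X Y K t)
    (u : (j : Fin r) → Fin (π.m j)) (v) : 0 ≤ π.letterLaw t q d u v :=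
  law_nonneg (π.induced_nonneg hq) _ _

theorem decodable_letterLaw (q : X × Y → ℝ) (d : Context X Y K t)
    (u : (j : Fin r) → Fin (π.m j)) : Decodable (π.letterLaw t q d u) := by
  classical
  exact decodable_of_factor (q := fun x y => q (x, y)) fun x y z₁ z₂ =>
    π.letterLaw_eq t q d u x y z₁ z₂

/-- In Alice's rounds Bob's weight is the same for every value of the new message, and vice versa in
Bob's rounds. -/
theorem roundMarkov_letterLaw (q : X × Y → ℝ) (d : Context X Y K t) (i : Fin r)
    (u : (j : Fin r) → Fin (π.m j)) (a : Fin (π.m i)) :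
    RoundMarkov i (prefixSum (π.letterLaw t q d) (i + 1) (Function.update u i a))
      (prefixSum (π.letterLaw t q d) i u) := by
  rw [prefixSum_succ]
  constructor
  · intro hi
    refine sameConditional_sum_of_factor
      (R := fun a => prefixSum (π.letterLaw t q d) (i + 1) (Function.update u i a))
      (q := fun x y => q (x, y)) (f := fun a => weightA q t d.2.1 d.2.2
        (fun xs => (K : ℝ)⁻¹ * π.factorA (i + 1) d.1 (Function.update u i a) xs))
      (g := weightB q t d.2.1 d.2.2 (π.factorB i d.1 u)) (fun a x y => ?_) a
    rw [law_prefixSum_letterLaw _ _ _ _ _ i.2, factorB_succ_update _ hi]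
  · intro hi
    refine sameConditional_sum_of_factor
      (R := fun a => prefixSum (π.letterLaw t q d) (i + 1) (Function.update u i a))
      (q := fun y x => q (x, y)) (f := fun a => weightB q t d.2.1 d.2.2 (π.factorB (i + 1) d.1 (Function.update u i a)))
      (g := weightA q t d.2.1 d.2.2 (fun xs => (K : ℝ)⁻¹ * π.factorA i d.1 u xs))
      (fun a y x => ?_) a
    have h := law_comp_of_injective
      (prefixSum (π.letterLaw t q d) (i + 1) (Function.update u i a)) (fun v => (v.1, v.2.1))
      Prod.swap_injective (x, y)
    simp only [Prod.swap_prod_mk] at h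
    rw [h, law_prefixSum_letterLaw _ _ _ _ _ i.2, factorA_succ_update _ hi]
    ring

theorem sum_letterLaw (q : X × Y → ℝ) :
    ∑ d, ∑ u, π.letterLaw t q d u = law (π.induced q) (π.letters t) := by
  ext v
  rw [law_eq_sum_left _ (π.letters t) fun ω => (π.context t ω, ω.msg),
    Fintype.sum_prod_type (α₁ := Context X Y K t)]
  simp only [Finset.sum_apply]
  rfl

/-- The law of the letters at time `t` is generated by an `r`-round interaction, whose first
message includes the context. -/
theorem reachable_letters {L : ℕ} (hL : L = Fintype.card (X × Y × Z₁ × Z₂) + 1) (hr : 1 ≤ r)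
    {q : X × Y → ℝ} (hq : ∀ a, 0 ≤ q a) (u₀ : (j : Fin r) → Fin (π.m j)) (y₀ : Y) :
    Reachable L r 0 (law (π.induced q) (π.letters t))
      (∑ d, ∑ u, leakPotential (π.letterLaw t q d u)) := by
  obtain ⟨k, rfl⟩ : ∃ k, r = k + 1 := ⟨r - 1, by omega⟩
  have h1 : ∑ d, ∑ u, leakPotential (π.letterLaw t q d u) =
      ∑ x : Context X Y K t × Fin (π.m 0),
        prefixSum (fun u => leakPotential (π.letterLaw t q x.1 u)) 1
          (Function.update u₀ 0 x.2) := by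
    rw [Fintype.sum_prod_type (α₁ := Context X Y K t) (α₂ := Fin (π.m 0))]
    refine Finset.sum_congr rfl fun d _ => ?_
    rw [← prefixSum_zero (fun u => leakPotential (π.letterLaw t q d u)) u₀]
    exact prefixSum_succ _ 0 u₀
  have h2 : law (π.induced q) (π.letters t) =
      ∑ x : Context X Y K t × Fin (π.m 0),
        prefixSum (π.letterLaw t q x.1) 1 (Function.update u₀ 0 x.2) := by
    rw [← sum_letterLaw, Fintype.sum_prod_type (α₁ := Context X Y K t) (α₂ := Fin (π.m 0))]
    refine Finset.sum_congr rfl fun d _ => ?_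
    rw [← prefixSum_zero (π.letterLaw t q d) u₀]
    exact prefixSum_succ _ 0 u₀
  rw [h1, h2]
  -- The pair (context, first message) acts as the first message. Its alphabet grows with the
  -- blocklength, but only finiteness is needed here.
  refine reachable_succ_of_sum hL (fun x => ?_) fun x => ⟨fun _ => ?_, fun h => absurd Even.zero h⟩
  · exact reachable_prefixSum hL (π.letterLaw_nonneg t hq x.1) (π.decodable_letterLaw t q x.1)
      (π.roundMarkov_letterLaw t q x.1) 1 (Nat.le_add_left 1 k) _
  · refine sameConditional_sum_of_factor
      (R := fun z : Context X Y K t × Fin (π.m 0) =>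
        prefixSum (π.letterLaw t q z.1) 1 (Function.update u₀ 0 z.2))
      (q := fun x y => q (x, y)) (f := fun (z : Context X Y K t × Fin (π.m 0)) x => weightA q t z.1.2.1 z.1.2.2
        (fun xs => (K : ℝ)⁻¹ * π.factorA 1 z.1.1 (Function.update u₀ 0 z.2) xs) x *
        weightB q t z.1.2.1 z.1.2.2 (fun _ => 1) y₀)
      (g := fun _ => 1) (fun z x y => ?_) x
    -- Bob is silent in the first round, so his weight does not depend on `y`. Evaluated at `y₀` it
    -- goes into the factor in `x`: the context with the first message depends on `Y_t` only through
    -- `X_t`.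
    have hB : π.factorB 1 z.1.1 (Function.update u₀ 0 z.2) = fun _ => 1 := by
      have := π.factorB_succ_update (i := 0) (by simp) z.1.1 u₀ z.2
      simp only [Fin.val_zero, zero_add] at this
      rw [this]
      ext y
      simp [factorB]
    rw [law_prefixSum_letterLaw _ _ _ _ _ (Nat.le_add_left 1 k), hB,
      weightB_one_const q t _ _ y y₀]
    ring

end Protocol

end Protocol

end SecureComputation

namespace SecureComputation

open Finset Filter Topology

/-! ### From secure protocols to auxiliary variables in bounded alphabets. -/

section

variable {X Y Z₁ Z₂ : Type*} [Fintype X] [Fintype Y] [Fintype Z₁] [Fintype Z₂]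

theorem condMutualInfo_congr_ker {Ω α β γ β' γ' : Type*} [Fintype Ω] [Fintype α] [Fintype β]
    [Fintype γ] [Fintype β'] [Fintype γ'] (P : Ω → ℝ) (A : Ω → α) {B : Ω → β} {C : Ω → γ}
    {B' : Ω → β'} {C' : Ω → γ'} (hB : ∀ ω ω', B ω = B ω' ↔ B' ω = B' ω')
    (hC : ∀ ω ω', C ω = C ω' ↔ C' ω = C' ω') :
    condMutualInfo P A B C = condMutualInfo P A B' C' := by
  unfold condMutualInfo
  rw [entropy_congr_ker P hC]
  congr 1
  congr 1
  · congr 1 <;> exact entropy_congr_ker P fun ω ω' => by simp only [Prod.mk.injEq, hB, hC]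
  · exact entropy_congr_ker P fun ω ω' => by simp only [Prod.mk.injEq, hB, hC]

theorem mem_stdSimplex_joint {q : X × Y → ℝ} (hq : q ∈ stdSimplex ℝ (X × Y))
    {κ : X × Y → Z₁ × Z₂ → ℝ} (hκ : ∀ a, κ a ∈ stdSimplex ℝ (Z₁ × Z₂)) :
    (fun v : X × Y × Z₁ × Z₂ => q (v.1, v.2.1) * κ (v.1, v.2.1) (v.2.2.1, v.2.2.2)) ∈
      stdSimplex ℝ (X × Y × Z₁ × Z₂) := by
  refine ⟨fun v => mul_nonneg (hq.1 _) ((hκ _).1 _), ?_⟩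
  have h : ∀ a, ∑ z₁, ∑ z₂, κ a (z₁, z₂) = 1 := fun a => by
    rw [← Fintype.sum_prod_type]
    exact (hκ a).2
  simp only [Fintype.sum_prod_type, ← Finset.mul_sum, h, mul_one]
  rw [← Fintype.sum_prod_type]
  exact hq.2

theorem comp_equiv_mem_stdSimplex {α β : Type*} [Fintype α] [Fintype β] (e : α ≃ β) {Q : α → ℝ}
    (hQ : Q ∈ stdSimplex ℝ α) : (fun b => Q (e.symm b)) ∈ stdSimplex ℝ β :=
  ⟨fun _ => hQ.1 _, by rw [e.symm.sum_comp]; exact hQ.2⟩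

/-- The bound on the single-letter leakages of an `ε`-secure protocol. -/
noncomputable def leakBound (X Y Z₁ Z₂ : Type*) [Fintype X] [Fintype Y] [Fintype Z₁] [Fintype Z₂]
    (ε : ℝ) : ℝ :=
  (ε + 2 * ε * (Real.log (Fintype.card (X × Z₁)) +
      Real.log (Fintype.card ((X × Z₁) × Y × Z₂))) + 4 * entropyModulus ε) +
    (ε + 2 * ε * (Real.log (Fintype.card (Y × Z₂)) +
      Real.log (Fintype.card ((Y × Z₂) × X × Z₁))) + 4 * entropyModulus ε)

theorem tendsto_leakBound :
    Tendsto (leakBound X Y Z₁ Z₂) (𝓝 0) (𝓝 0) := by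
  have h : ContinuousAt (leakBound X Y Z₁ Z₂) 0 := by
    unfold leakBound entropyModulus
    have h1 : ContinuousAt (fun ε : ℝ => Real.log (1 - ε)) 0 :=
      ContinuousAt.log (by fun_prop) (by norm_num)
    have h2 : ContinuousAt Real.negMulLog 0 := Real.continuous_negMulLog.continuousAt
    fun_prop
  have h0 : leakBound X Y Z₁ Z₂ 0 = 0 := by simp [leakBound, entropyModulus]
  simpa [h0] using h.tendsto

namespace Protocol

variable {n r K : ℕ} (π : Protocol X Y Z₁ Z₂ n r K)

/-- The four sequences are interleaved into one sequence of tuples, regrouped by `e`; relabelling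
does not change the `ℓ¹` distance. -/
theorem sum_abs_law_sequences_le {q : X × Y → ℝ} {κ : X × Y → Z₁ × Z₂ → ℝ} {ε : ℝ}
    (h : π.SecureWithin q κ ε) {τ : Type*} [Fintype τ] (e : X × Y × Z₁ × Z₂ ≃ τ) :
    ∑ v : Fin n → τ, |law (π.induced q) (fun ω t => e (π.letters t ω)) v -
      ∏ t, (fun b => (fun v : X × Y × Z₁ × Z₂ =>
        q (v.1, v.2.1) * κ (v.1, v.2.1) (v.2.2.1, v.2.2.2)) (e.symm b)) (v t)| ≤ ε := by
  set E : (Fin n → X) × (Fin n → Y) × (Fin n → Z₁) × (Fin n → Z₂) ≃ (Fin n → τ) :=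
    ⟨fun a t => e (a.1 t, a.2.1 t, a.2.2.1 t, a.2.2.2 t),
      fun v => (fun t => (e.symm (v t)).1, fun t => (e.symm (v t)).2.1,
        fun t => (e.symm (v t)).2.2.1, fun t => (e.symm (v t)).2.2.2),
      fun a => by simp, fun v => by simp⟩ with hE
  rw [← E.sum_comp]
  refine (Finset.sum_congr rfl fun a _ => ?_).trans_le h.1
  congr 2
  · exact law_comp_of_injective (π.induced q) (fun ω => (ω.x, ω.y, ω.z₁, ω.z₂)) E.injective a
  · simp [hE]

theorem exists_letter_leak_le {q : X × Y → ℝ} (hq : q ∈ stdSimplex ℝ (X × Y))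
    {κ : X × Y → Z₁ × Z₂ → ℝ} (hκ : ∀ a, κ a ∈ stdSimplex ℝ (Z₁ × Z₂)) (hn : 1 ≤ n) (hK : 1 ≤ K)
    {ε : ℝ} (h0 : 0 < ε) (h1 : ε < 1) (h : π.SecureWithin q κ ε) :
    ∃ t : Fin n, ∑ v, |law (π.induced q) (π.letters t) v -
        q (v.1, v.2.1) * κ (v.1, v.2.1) (v.2.2.1, v.2.2.2)| ≤ ε ∧
      leakPotential (law (π.induced q) (π.letters t)) -
        ∑ d, ∑ u, leakPotential (π.letterLaw t q d u) ≤ leakBound X Y Z₁ Z₂ ε := by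
  classical
  have hP := π.induced_mem_stdSimplex hq hK
  have hQ := mem_stdSimplex_joint hq hκ
  set P := π.induced q with hPdef
  set e₁ : X × Y × Z₁ × Z₂ ≃ (X × Z₁) × Y × Z₂ :=
    ⟨fun v => ((v.1, v.2.2.1), v.2.1, v.2.2.2), fun v => (v.1.1, v.2.1, v.1.2, v.2.2),
      fun _ => rfl, fun _ => rfl⟩
  set e₂ : X × Y × Z₁ × Z₂ ≃ (Y × Z₂) × X × Z₁ :=
    ⟨fun v => ((v.2.1, v.2.2.2), v.1, v.2.2.1), fun v => (v.2.1, v.1.1, v.2.2, v.1.2),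
      fun _ => rfl, fun _ => rfl⟩
  set A : Outcome X Y Z₁ Z₂ n K π.m → Fin n → X × Z₁ := fun ω t => (ω.x t, ω.z₁ t) with hA
  set B : Outcome X Y Z₁ Z₂ n K π.m → Fin n → Y × Z₂ := fun ω t => (ω.y t, ω.z₂ t) with hB
  have kA : ∀ ω ω' : Outcome X Y Z₁ Z₂ n K π.m,
      (ω.x, ω.z₁) = (ω'.x, ω'.z₁) ↔ A ω = A ω' := fun ω ω' => by
    simp only [hA, funext_iff, Prod.mk.injEq, forall_and]
  have kB : ∀ ω ω' : Outcome X Y Z₁ Z₂ n K π.m,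
      (ω.y, ω.z₂) = (ω'.y, ω'.z₂) ↔ B ω = B ω' := fun ω ω' => by
    simp only [hB, funext_iff, Prod.mk.injEq, forall_and]
  have l1 := h.2.1
  have l2 := h.2.2
  rw [condMutualInfo_congr_ker P _ kB kA] at l1
  rw [condMutualInfo_congr_ker P _ kA kB] at l2
  -- In the natural order, Alice's sequence contains the past of `X` and the suffix of Bob's letters
  -- contains the future of `Y`, so together with `W` they determine the context.
  have b1 := sum_condEntropy_sub_le hn hP (fun ω => (ω.msg, ω.w)) A B (Equiv.refl _)
    (comp_equiv_mem_stdSimplex e₁ hQ) h0 h1 (π.sum_abs_law_sequences_le h e₁) l1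
    (fun t ω => (π.context t ω, ω.msg))
    (fun t d => ((d.2.1.2, fun s => (d.1 s).1, fun s => (d.2.2 s).1), d.2.1.1)) (fun t ω => rfl)
  -- For the other leakage the past of `X` must be the chain-rule suffix, so time is reversed: `X_s`
  -- with `s < rev t` has reversed index `rev s > t`.
  have b2 := sum_condEntropy_sub_le hn hP (fun ω => (ω.msg, ω.w)) B A Fin.revPerm
    (comp_equiv_mem_stdSimplex e₂ hQ) h0 h1 (π.sum_abs_law_sequences_le h e₂) l2
    (fun t ω => (π.context t ω, ω.msg))
    (fun t d => ((d.2.1.2, fun s => (d.2.2 ⟨Fin.rev s.1, by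
      have := s.2
      simp only [Fin.revPerm_apply, Fin.lt_def, Fin.val_rev] at this ⊢
      omega⟩).1,
      fun s => (d.1 s).1), d.2.1.1)) (fun t ω => by
        simp [context, hA, hB])
  have hsum := add_le_add b1 b2
  rw [← Finset.sum_add_distrib, ← mul_add] at hsum
  -- The drop of the potential at `t` is the sum of the two single-letter leakages bounded by `b1`
  -- and `b2`.
  have key : ∀ t : Fin n, leakPotential (law P (π.letters t)) -
        ∑ d, ∑ u, leakPotential (π.letterLaw t q d u) =
      entropy P (fun ω => (A ω t, B ω t)) - entropy P (fun ω => A ω t)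
        - (entropy P (fun ω => ((π.context t ω, ω.msg), A ω t, B ω t))
          - entropy P (fun ω => ((π.context t ω, ω.msg), A ω t)))
      + (entropy P (fun ω => (B ω t, A ω t)) - entropy P (fun ω => B ω t)
        - (entropy P (fun ω => ((π.context t ω, ω.msg), B ω t, A ω t))
          - entropy P (fun ω => ((π.context t ω, ω.msg), B ω t)))) := fun t => by
    have p1 : leakPotential (law P (π.letters t)) = 2 * entropy P (π.letters t) -
        entropy P (fun ω => A ω t) - entropy P (fun ω => B ω t) := by
      rw [leakPotential, entropy_law, entropy_law, entropy_law]
      rfl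
    have p2 : ∑ d, ∑ u, leakPotential (π.letterLaw t q d u) =
        2 * entropy P (fun ω => ((π.context t ω, ω.msg), π.letters t ω)) -
        entropy P (fun ω => ((π.context t ω, ω.msg), A ω t)) -
        entropy P (fun ω => ((π.context t ω, ω.msg), B ω t)) := by
      have q1 := entropy_pair_eq_sum P (fun ω => (π.context t ω, ω.msg)) (π.letters t) fun v => v
      have q2 := entropy_pair_eq_sum P (fun ω => (π.context t ω, ω.msg)) (π.letters t)
        fun v => (v.1, v.2.2.1)
      have q3 := entropy_pair_eq_sum P (fun ω => (π.context t ω, ω.msg)) (π.letters t)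
        fun v => (v.2.1, v.2.2.2)
      rw [Fintype.sum_prod_type (α₁ := Context X Y K t)] at q1 q2 q3
      have q2' : entropy P (fun ω => ((π.context t ω, ω.msg), A ω t)) = _ := q2
      have q3' : entropy P (fun ω => ((π.context t ω, ω.msg), B ω t)) = _ := q3
      rw [q1, q2', q3']
      simp only [leakPotential, Finset.sum_sub_distrib, Finset.mul_sum]
      rfl
    have r1 : entropy P (fun ω => (A ω t, B ω t)) = entropy P (π.letters t) :=
      entropy_congr_ker P fun ω ω' => by
        simp only [hA, hB, letters, Prod.mk.injEq]
        tauto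
    have r2 : entropy P (fun ω => (B ω t, A ω t)) = entropy P (π.letters t) :=
      entropy_congr_ker P fun ω ω' => by
        simp only [hA, hB, letters, Prod.mk.injEq]
        tauto
    have r3 : entropy P (fun ω => ((π.context t ω, ω.msg), A ω t, B ω t)) =
        entropy P (fun ω => ((π.context t ω, ω.msg), π.letters t ω)) :=
      entropy_congr_ker P fun ω ω' => by
        simp only [hA, hB, letters, Prod.mk.injEq]
        tauto
    have r4 : entropy P (fun ω => ((π.context t ω, ω.msg), B ω t, A ω t)) =
        entropy P (fun ω => ((π.context t ω, ω.msg), π.letters t ω)) :=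
      entropy_congr_ker P fun ω ω' => by
        simp only [hA, hB, letters, Prod.mk.injEq]
        tauto
    rw [p1, p2, r1, r2, r3, r4]
    ring
  -- Averaging over `t`: some time is no worse than the mean.
  have hex : ∃ t ∈ (Finset.univ : Finset (Fin n)), leakPotential (law P (π.letters t)) -
        ∑ d, ∑ u, leakPotential (π.letterLaw t q d u) ≤ leakBound X Y Z₁ Z₂ ε := by
    refine Finset.exists_le_of_sum_le ⟨⟨0, hn⟩, Finset.mem_univ _⟩ ?_
    simp only [key]
    refine hsum.trans_eq ?_
    simp only [Finset.sum_const, Finset.card_univ, Fintype.card_fin, nsmul_eq_mul]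
    rfl
  obtain ⟨t, -, ht⟩ := hex
  refine ⟨t, ?_, ht⟩
  have hs := sum_abs_law_sub_le (law P (fun ω t => π.letters t ω))
    (fun v : Fin n → X × Y × Z₁ × Z₂ => ∏ t, (fun v : X × Y × Z₁ × Z₂ =>
        q (v.1, v.2.1) * κ (v.1, v.2.1) (v.2.2.1, v.2.2.2)) (v t)) fun v => v t
  rw [law_law, law_iid_apply hQ.2] at hs
  exact hs.trans (π.sum_abs_law_sequences_le h (Equiv.refl _))

end Protocol

/-- From `ε`-secure protocols for every `ε` to auxiliary variables in small alphabets. -/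
theorem exists_isAuxiliary_of_securelyComputable {q : X × Y → ℝ} (hq : q ∈ stdSimplex ℝ (X × Y))
    {κ : X × Y → Z₁ × Z₂ → ℝ} (hκ : ∀ a, κ a ∈ stdSimplex ℝ (Z₁ × Z₂))
    {r : ℕ} (hr : 1 ≤ r) {K : ℕ → ℕ} (hK : ∀ n, 1 ≤ K n)
    (h : SecurelyComputableAtSomeBlocklength r K q κ) {L : ℕ}
    (hL : L = Fintype.card (X × Y × Z₁ × Z₂) + 1) :
    ∃ J : (Fin r → Fin L) → X × Y × Z₁ × Z₂ → ℝ, IsAuxiliary (c := fun _ => L) J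
      fun v => q (v.1, v.2.1) * κ (v.1, v.2.1) (v.2.2.1, v.2.2.2) := by
  refine exists_isAuxiliary_of_approx fun η hη => ?_
  obtain ⟨ε, hε, h0, h1, hεη⟩ : ∃ ε : ℝ, leakBound X Y Z₁ Z₂ ε < η ∧ 0 < ε ∧ ε < 1 ∧ ε < η := by
    have e1 : ∀ᶠ ε in 𝓝[>] (0 : ℝ), leakBound X Y Z₁ Z₂ ε < η :=
      (tendsto_leakBound.mono_left nhdsWithin_le_nhds).eventually (gt_mem_nhds hη)
    have e2 : ∀ᶠ ε in 𝓝[>] (0 : ℝ), 0 < ε := self_mem_nhdsWithin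
    have e3 : ∀ᶠ ε in 𝓝[>] (0 : ℝ), ε < 1 :=
      nhdsWithin_le_nhds (gt_mem_nhds one_pos)
    have e4 : ∀ᶠ ε in 𝓝[>] (0 : ℝ), ε < η := nhdsWithin_le_nhds (gt_mem_nhds hη)
    obtain ⟨ε, h1, h2, h3, h4⟩ := (e1.and (e2.and (e3.and e4))).exists
    exact ⟨ε, h1, h2, h3, h4⟩
  obtain ⟨n, hn, π, hπ⟩ := h ε h0
  obtain ⟨t, ht1, ht2⟩ := π.exists_letter_leak_le hq hκ hn (hK n) h0 h1 hπ
  obtain ⟨⟨x₀, y₀⟩⟩ : Nonempty (X × Y) := by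
    by_contra hne
    rw [not_nonempty_iff] at hne
    simpa using hq.2
  exact ⟨_, _, π.reachable_letters t hL hr hq.1
    (fun j => ⟨0, π.m_pos (fun _ => x₀) (fun _ => y₀) ⟨0, hK n⟩ j⟩) y₀, ht1.trans hεη.le,
    ht2.trans hε.le⟩

end

end SecureComputation

namespace SecureComputation

open Finset

/-! ### One-letter protocols that depend on `q` only through its support. -/

section

set_option linter.unusedSectionVars false

variable {X Y Z₁ Z₂ : Type*} [Fintype X] [Fintype Y] [Fintype Z₁] [Fintype Z₂]

/-- Encoders and decoders for single letters, with message alphabets of sizes `c`, that compute `κ`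
on the support of `q` without leakage: given the letters, the conditional law of the messages is
`privA`, which depends on Alice's input and output only, and `privB`, which depends on Bob's. -/
structure LetterProtocol (r : ℕ) (q : X × Y → ℝ) (κ : X × Y → Z₁ × Z₂ → ℝ) where
  c : Fin r → ℕ
  encA : (i : Fin r) → X → ((j : Set.Iio i) → Fin (c j)) → Fin (c i) → ℝ
  encB : (i : Fin r) → Y → ((j : Set.Iio i) → Fin (c j)) → Fin (c i) → ℝ
  decA : X → ((j : Fin r) → Fin (c j)) → Z₁ → ℝ
  decB : Y → ((j : Fin r) → Fin (c j)) → Z₂ → ℝ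
  privA : ((j : Fin r) → Fin (c j)) → X × Z₁ → ℝ
  privB : ((j : Fin r) → Fin (c j)) → Y × Z₂ → ℝ
  encA_pmf : ∀ i x b, encA i x b ∈ stdSimplex ℝ (Fin (c i))
  encB_pmf : ∀ i y b, encB i y b ∈ stdSimplex ℝ (Fin (c i))
  decA_pmf : ∀ x u, decA x u ∈ stdSimplex ℝ Z₁
  decB_pmf : ∀ y u, decB y u ∈ stdSimplex ℝ Z₂
  eq_privA : ∀ x y, q (x, y) ≠ 0 → ∀ u z₁ z₂,
    (∏ i : Fin r, if Even (i : ℕ) then encA i x (past u i) (u i) else encB i y (past u i) (u i)) *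
      decA x u z₁ * decB y u z₂ = κ (x, y) (z₁, z₂) * privA u (x, z₁)
  eq_privB : ∀ x y, q (x, y) ≠ 0 → ∀ u z₁ z₂,
    (∏ i : Fin r, if Even (i : ℕ) then encA i x (past u i) (u i) else encB i y (past u i) (u i)) *
      decA x u z₁ * decB y u z₂ = κ (x, y) (z₁, z₂) * privB u (y, z₂)
  sum_eq : ∀ x y, q (x, y) ≠ 0 → ∀ z₁ z₂,
    ∑ u, (∏ i : Fin r, if Even (i : ℕ) then encA i x (past u i) (u i)
      else encB i y (past u i) (u i)) * decA x u z₁ * decB y u z₂ = κ (x, y) (z₁, z₂)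

/-! Letter protocols from auxiliary variables. -/

open Classical in
/-- The p.m.f. proportional to `N`, or a point mass if `N` vanishes. -/
noncomputable def normalize {α : Type*} [Fintype α] (a₀ : α) (N : α → ℝ) : α → ℝ :=
  if ∑ a, N a = 0 then Pi.single a₀ 1 else fun a => N a / ∑ a, N a

theorem normalize_mem_stdSimplex {α : Type*} [Fintype α] (a₀ : α) {N : α → ℝ}
    (hN : ∀ a, 0 ≤ N a) : normalize a₀ N ∈ stdSimplex ℝ α := by
  classical
  unfold normalize
  split_ifs with h
  · convert single_mem_stdSimplex ℝ a₀
  · exact ⟨fun a => div_nonneg (hN a) (Finset.sum_nonneg fun a _ => hN a), by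
      rw [← Finset.sum_div, div_self h]⟩

/-- It holds even when the total vanishes, since nonnegativity then forces `N = 0`. -/
theorem normalize_mul_sum {α : Type*} [Fintype α] (a₀ : α) {N : α → ℝ} (hN : ∀ a, 0 ≤ N a)
    (a : α) : normalize a₀ N a * ∑ a, N a = N a := by
  unfold normalize
  split_ifs with h
  · rw [h, mul_zero]
    exact ((Finset.sum_eq_zero_iff_of_nonneg fun a _ => hN a).1 h a (Finset.mem_univ a)).symm
  · rw [div_mul_cancel₀ _ h]

theorem law_mono {Ω α : Type*} [Fintype Ω] {R P : Ω → ℝ} (h : ∀ ω, R ω ≤ P ω) (A : Ω → α) (a : α) :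
    law R A a ≤ law P A a := by
  classical
  simp only [law_apply]
  exact Finset.sum_le_sum fun ω _ => by split_ifs <;> simp [h]

/-- Turns the division-free condition into multiplication by a kernel value `e`. When `P(A = a) = 0`
the value of `e` is arbitrary, but `R ≤ P` makes both sides zero. -/
theorem SameConditional.law_eq_mul {Ω α β : Type*} [Fintype Ω] {A : Ω → α} {B : Ω → β}
    {R P : Ω → ℝ} (h : SameConditional A B R P) (h0 : ∀ ω, 0 ≤ R ω) (hle : ∀ ω, R ω ≤ P ω) {a : α}
    {e : ℝ} (he : e * law P A a = law R A a) (b : β) :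
    law R (fun ω => (A ω, B ω)) (a, b) = e * law P (fun ω => (A ω, B ω)) (a, b) := by
  have hP : ∀ ω, 0 ≤ P ω := fun ω => (h0 ω).trans (hle ω)
  by_cases hz : law P A a = 0
  · have h1 : law P (fun ω => (A ω, B ω)) (a, b) = 0 :=
      le_antisymm (hz ▸ law_le_of_comp hP (fun ω => (A ω, B ω)) Prod.fst (a, b))
        (law_nonneg hP _ _)
    rw [h1, mul_zero]
    exact le_antisymm (h1 ▸ law_mono hle _ _) (law_nonneg h0 _ _)
  · refine mul_right_cancel₀ hz ?_
    rw [h a b, ← he]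
    ring

theorem MarkovChain.law_eq_mul {Ω α β γ : Type*} [Fintype Ω] {A : Ω → α} {B : Ω → β} {C : Ω → γ}
    {P : Ω → ℝ} (h : MarkovChain P A B C) (h0 : ∀ ω, 0 ≤ P ω) {a : α} {b : β} {e : ℝ}
    (he : e * law P B b = law P (fun ω => (A ω, B ω)) (a, b)) (d : γ) :
    law P (fun ω => (A ω, B ω, C ω)) (a, b, d) = e * law P (fun ω => (B ω, C ω)) (b, d) := by
  by_cases hz : law P B b = 0
  · have h1 : law P (fun ω => (B ω, C ω)) (b, d) = 0 :=
      le_antisymm (hz ▸ law_le_of_comp h0 (fun ω => (B ω, C ω)) Prod.fst (b, d))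
        (law_nonneg h0 _ _)
    have h2 : law P (fun ω => (A ω, B ω, C ω)) (a, b, d) = 0 :=
      le_antisymm (hz ▸ law_le_of_comp h0 (fun ω => (A ω, B ω, C ω)) (fun x => x.2.1) (a, b, d))
        (law_nonneg h0 _ _)
    rw [h1, h2, mul_zero]
  · refine mul_right_cancel₀ hz ?_
    rw [h a b d, ← he]
    ring

theorem prefixSum_le_prefixSum {r : ℕ} {c : Fin r → ℕ} {τ : Type*}
    {J : ((j : Fin r) → Fin (c j)) → τ → ℝ} (h0 : ∀ u v, 0 ≤ J u v) (i : ℕ) (w) (v : τ) :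
    prefixSum J (i + 1) w v ≤ prefixSum J i w v := by
  simp only [prefixSum, Finset.sum_apply]
  refine Finset.sum_le_sum_of_subset_of_nonneg (fun u hu => ?_) fun u _ _ => h0 u v
  simp only [Finset.mem_filter, Finset.mem_univ, true_and] at hu ⊢
  exact fun j hj => hu j (hj.trans (Nat.lt_succ_self i))

theorem prefixSum_nonneg {r : ℕ} {c : Fin r → ℕ} {τ : Type*}
    {J : ((j : Fin r) → Fin (c j)) → τ → ℝ} (h0 : ∀ u v, 0 ≤ J u v) (i : ℕ) (w) (v : τ) :
    0 ≤ prefixSum J i w v := by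
  simp only [prefixSum, Finset.sum_apply]
  exact Finset.sum_nonneg fun u _ => h0 u v

open Classical in
/-- The transition probabilities of the message of round `i` given its past and `A`. -/
noncomputable def messageKernel {r : ℕ} {c : Fin r → ℕ} {Ω α : Type*} [Fintype Ω]
    (J : ((j : Fin r) → Fin (c j)) → Ω → ℝ) (A : Ω → α) (w₀ : (j : Fin r) → Fin (c j)) (i : Fin r)
    (x : α) (b : (j : Set.Iio i) → Fin (c j)) : Fin (c i) → ℝ :=
  normalize (w₀ i) fun a =>
    law (prefixSum J (i + 1) (exists_vector_extending w₀ i a b).choose) A x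

theorem messageKernel_mem_stdSimplex {r : ℕ} {c : Fin r → ℕ} {Ω α : Type*} [Fintype Ω]
    {J : ((j : Fin r) → Fin (c j)) → Ω → ℝ} (h0 : ∀ u v, 0 ≤ J u v) (A : Ω → α)
    (w₀ : (j : Fin r) → Fin (c j)) (i : Fin r) (x : α) (b : (j : Set.Iio i) → Fin (c j)) :
    messageKernel J A w₀ i x b ∈ stdSimplex ℝ (Fin (c i)) :=
  normalize_mem_stdSimplex _ fun _ => law_nonneg (prefixSum_nonneg h0 _ _) _ _

/-- The vector chosen in `messageKernel` is arbitrary after coordinate `i`, and the prefix sum over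
the first `i + 1` messages ignores those coordinates. -/
theorem messageKernel_mul {r : ℕ} {c : Fin r → ℕ} {Ω α : Type*} [Fintype Ω]
    {J : ((j : Fin r) → Fin (c j)) → Ω → ℝ} (h0 : ∀ u v, 0 ≤ J u v) (A : Ω → α)
    (w₀ : (j : Fin r) → Fin (c j)) (i : Fin r) (x : α) (w : (j : Fin r) → Fin (c j)) :
    messageKernel J A w₀ i x (past w i) (w i) * law (prefixSum J i w) A x =
      law (prefixSum J (i + 1) w) A x := by
  have h1 : ∀ a, prefixSum J (i + 1) (exists_vector_extending w₀ i a (past w i)).choose =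
      prefixSum J (i + 1) (Function.update w i a) := fun a => by
    have h := (exists_vector_extending w₀ i a (past w i)).choose_spec
    refine prefixSum_congr J (forall_lt_succ_iff.2 ⟨?_, ?_⟩)
    · rw [h.1, Function.update_self]
    · rw [h.2, past_update w le_rfl]
  have h2 := normalize_mul_sum (w₀ i) (N := fun a =>
    law (prefixSum J (i + 1) (exists_vector_extending w₀ i a (past w i)).choose) A x)
    (fun _ => law_nonneg (prefixSum_nonneg h0 _ _) _ _) (w i)
  simp only [h1] at h2
  rw [← law_sum, ← prefixSum_succ, Function.update_eq_self] at h2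
  rw [← h2, messageKernel]
  simp only [h1]

/-- Encoders and decoders are the conditional laws under `J`, and `privA`, `privB` are those of the
messages given one user's input and output. The Markov chains make `J` equal to `q` times the
transition probabilities, and also to `Q` times either conditional law. -/
theorem IsAuxiliary.exists_letterProtocol {r : ℕ} {c : Fin r → ℕ} {q : X × Y → ℝ}
    (hq : q ∈ stdSimplex ℝ (X × Y)) {κ : X × Y → Z₁ × Z₂ → ℝ}
    (hκ : ∀ a, κ a ∈ stdSimplex ℝ (Z₁ × Z₂))
    {J : ((j : Fin r) → Fin (c j)) → X × Y × Z₁ × Z₂ → ℝ}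
    (hJ : IsAuxiliary J fun v => q (v.1, v.2.1) * κ (v.1, v.2.1) (v.2.2.1, v.2.2.2)) :
    Nonempty (LetterProtocol r q κ) := by
  classical
  have hQ := mem_stdSimplex_joint hq hκ
  set Q : X × Y × Z₁ × Z₂ → ℝ := fun v => q (v.1, v.2.1) * κ (v.1, v.2.1) (v.2.2.1, v.2.2.2)
    with hQdef
  obtain ⟨⟨_, _, z₁₀, z₂₀⟩⟩ : Nonempty (X × Y × Z₁ × Z₂) := by
    by_contra hne
    rw [not_nonempty_iff] at hne
    simpa using hQ.2
  obtain ⟨w₀⟩ : Nonempty ((j : Fin r) → Fin (c j)) := by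
    by_contra hne
    rw [not_nonempty_iff] at hne
    have h1 := hJ.sum_eq
    have h2 := hQ.2
    rw [← h1] at h2
    simp at h2
  have hle : ∀ u v, J u v ≤ Q v := fun u v => by
    rw [← congrFun hJ.sum_eq v, Finset.sum_apply]
    exact Finset.single_le_sum (fun u _ => hJ.nonneg u v) (Finset.mem_univ u)
  set eA := messageKernel J (fun v => v.1) w₀ with heA
  set eB := messageKernel J (fun v => v.2.1) w₀ with heB
  set dA : X → ((j : Fin r) → Fin (c j)) → Z₁ → ℝ := fun x u =>
    normalize z₁₀ fun z => law (J u) (fun v => (v.2.2.1, v.1)) (z, x) with hdA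
  set dB : Y → ((j : Fin r) → Fin (c j)) → Z₂ → ℝ := fun y u =>
    normalize z₂₀ fun z => law (J u) (fun v => (v.2.2.2, v.2.1)) (z, y) with hdB
  set pA : ((j : Fin r) → Fin (c j)) → X × Z₁ → ℝ := fun u a =>
    normalize w₀ (fun u => law (J u) (fun v => (v.1, v.2.2.1)) a) u with hpA
  set pB : ((j : Fin r) → Fin (c j)) → Y × Z₂ → ℝ := fun u a =>
    normalize w₀ (fun u => law (J u) (fun v => (v.2.1, v.2.2.2)) a) u with hpB
  have hlq : ∀ x y, law Q (fun v => (v.1, v.2.1)) (x, y) = q (x, y) := fun x y => by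
    have h : ∑ z₁, ∑ z₂, κ (x, y) (z₁, z₂) = 1 := by
      rw [← Fintype.sum_prod_type]
      exact (hκ (x, y)).2
    simp only [law_apply, hQdef, Fintype.sum_prod_type, Prod.mk.injEq, ite_and,
      Finset.sum_ite_irrel, Finset.sum_const_zero, Finset.sum_ite_eq', Finset.mem_univ, if_true,
      ← Finset.mul_sum, h, mul_one]
  -- By induction on the rounds: the chain of each round lets a kernel that sees only the speaker's
  -- input extend the joint law with both inputs.
  have hmsg : ∀ x y w, ∀ i ≤ r, law (prefixSum J i w) (fun v => (v.1, v.2.1)) (x, y) =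
      q (x, y) * ∏ j with (j : Fin r).val < i, if Even (j : ℕ) then eA j x (past w j) (w j)
        else eB j y (past w j) (w j) := by
    intro x y w i hi
    induction i with
    | zero => simp [prefixSum_zero, hJ.sum_eq, hlq]
    | succ i ih =>
      have hr := hJ.round ⟨i, hi⟩ w
      rw [prod_lt_succ (fun j => if Even (j : ℕ) then eA j x (past w j) (w j)
        else eB j y (past w j) (w j)) ⟨i, hi⟩, mul_left_comm, ← ih (Nat.le_of_succ_le hi)]
      split_ifs with he
      · exact (hr.1 he).law_eq_mul (prefixSum_nonneg hJ.nonneg _ _)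
          (prefixSum_le_prefixSum hJ.nonneg _ _)
          (messageKernel_mul hJ.nonneg (fun v => v.1) w₀ ⟨i, hi⟩ x w) y
      · have h1 := (hr.2 he).law_eq_mul (prefixSum_nonneg hJ.nonneg _ _)
          (prefixSum_le_prefixSum hJ.nonneg _ _)
          (messageKernel_mul hJ.nonneg (fun v => v.2.1) w₀ ⟨i, hi⟩ y w) x
        have h2 := fun P : X × Y × Z₁ × Z₂ → ℝ => law_comp_of_injective P (fun v => (v.1, v.2.1))
          Prod.swap_injective (x, y)
        simp only [Prod.swap_prod_mk] at h2
        rwa [h2, h2] at h1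
  -- The chain for `Z₁` on the event `U = u` splits off Alice's decoder; `hdecB` does the same for
  -- Bob's once `Z₁` has been summed out.
  have hdecA : ∀ x y u z₁ z₂, J u (x, y, z₁, z₂) =
      dA x u z₁ * law (J u) (fun v => (v.1, v.2.1, v.2.2.2)) (x, y, z₂) := fun x y u z₁ z₂ => by
    have h1 := (hJ.decodable u).1.law_eq_mul (hJ.nonneg u) (a := z₁) (b := x) (e := dA x u z₁)
      (by
        rw [law_eq_sum_left (J u) (fun v => v.1) fun v => v.2.2.1]
        exact normalize_mul_sum z₁₀ (N := fun z => law (J u) (fun v => (v.2.2.1, v.1)) (z, x))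
          (fun z => law_nonneg (hJ.nonneg u) _ _) z₁) (y, z₂)
    rw [← h1, ← congrFun (law_id (J u)) (x, y, z₁, z₂)]
    exact (law_comp_of_injective (J u) (fun v => v)
      (f := fun v : X × Y × Z₁ × Z₂ => (v.2.2.1, v.1, v.2.1, v.2.2.2))
      (fun v v' h => by simp only [Prod.ext_iff] at h ⊢; tauto) (x, y, z₁, z₂)).symm
  have hdecB : ∀ x y u z₂, law (J u) (fun v => (v.1, v.2.1, v.2.2.2)) (x, y, z₂) =
      dB y u z₂ * law (J u) (fun v => (v.1, v.2.1)) (x, y) := fun x y u z₂ => by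
    have h1 := fun z₁ => (hJ.decodable u).2.law_eq_mul (hJ.nonneg u) (a := z₂) (b := y)
      (e := dB y u z₂) (by
        rw [law_eq_sum_left (J u) (fun v => v.2.1) fun v => v.2.2.2]
        exact normalize_mul_sum z₂₀ (N := fun z => law (J u) (fun v => (v.2.2.2, v.2.1)) (z, y))
          (fun z => law_nonneg (hJ.nonneg u) _ _) z₂) (x, z₁)
    rw [law_eq_sum_right (J u) (fun v => (v.1, v.2.1, v.2.2.2)) fun v => v.2.2.1,
      law_eq_sum_right (J u) (fun v => (v.1, v.2.1)) fun v => v.2.2.1, Finset.mul_sum]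
    refine Finset.sum_congr rfl fun z₁ _ => ?_
    have s1 := law_comp_of_injective (J u) (fun v => (v.2.2.2, v.2.1, v.1, v.2.2.1))
      (f := fun a : Z₂ × Y × X × Z₁ => ((a.2.2.1, a.2.1, a.1), a.2.2.2))
      (fun v v' h => by simp only [Prod.ext_iff] at h ⊢; tauto) (z₂, y, x, z₁)
    have s2 := law_comp_of_injective (J u) (fun v => (v.2.1, v.1, v.2.2.1))
      (f := fun a : Y × X × Z₁ => ((a.2.1, a.1), a.2.2))
      (fun v v' h => by simp only [Prod.ext_iff] at h ⊢; tauto) (y, x, z₁)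
    exact (s1.trans (h1 z₁)).trans (congrArg _ s2.symm)
  have hfac : ∀ x y u z₁ z₂, q (x, y) * ((∏ i : Fin r, if Even (i : ℕ) then eA i x (past u i) (u i)
      else eB i y (past u i) (u i)) * dA x u z₁ * dB y u z₂) = J u (x, y, z₁, z₂) :=
    fun x y u z₁ z₂ => by
      have h := hmsg x y u r le_rfl
      rw [prefixSum_top] at h
      rw [hdecA, hdecB, h]
      simp only [Fin.is_lt, Finset.filter_true]
      ring
  have hprivA : ∀ u v, J u v = pA u (v.1, v.2.2.1) * Q v := fun u v => by
    have h1 := (hJ.privateA u).law_eq_mul (hJ.nonneg u) (hle u) (a := (v.1, v.2.2.1))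
      (e := pA u (v.1, v.2.2.1)) (by
        rw [← hJ.sum_eq, law_sum]
        exact normalize_mul_sum w₀ (N := fun u => law (J u) (fun v => (v.1, v.2.2.1)) _)
          (fun u => law_nonneg (hJ.nonneg u) _ _) u) (v.2.1, v.2.2.2)
    have s := fun P : X × Y × Z₁ × Z₂ → ℝ => law_comp_of_injective P (fun v => v)
      (f := fun v : X × Y × Z₁ × Z₂ => ((v.1, v.2.2.1), v.2.1, v.2.2.2))
      (fun v v' h => by simp only [Prod.ext_iff] at h ⊢; tauto) v
    rw [s, s, law_id, law_id] at h1
    exact h1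
  have hprivB : ∀ u v, J u v = pB u (v.2.1, v.2.2.2) * Q v := fun u v => by
    have h1 := (hJ.privateB u).law_eq_mul (hJ.nonneg u) (hle u) (a := (v.2.1, v.2.2.2))
      (e := pB u (v.2.1, v.2.2.2)) (by
        rw [← hJ.sum_eq, law_sum]
        exact normalize_mul_sum w₀ (N := fun u => law (J u) (fun v => (v.2.1, v.2.2.2)) _)
          (fun u => law_nonneg (hJ.nonneg u) _ _) u) (v.1, v.2.2.1)
    have s := fun P : X × Y × Z₁ × Z₂ → ℝ => law_comp_of_injective P (fun v => v)
      (f := fun v : X × Y × Z₁ × Z₂ => ((v.2.1, v.2.2.2), v.1, v.2.2.1))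
      (fun v v' h => by simp only [Prod.ext_iff] at h ⊢; tauto) v
    rw [s, s, law_id, law_id] at h1
    exact h1
  refine ⟨⟨c, eA, eB, dA, dB, pA, pB, messageKernel_mem_stdSimplex hJ.nonneg _ w₀,
    messageKernel_mem_stdSimplex hJ.nonneg _ w₀,
    fun x u => normalize_mem_stdSimplex _ fun z => law_nonneg (hJ.nonneg u) _ _,
    fun x u => normalize_mem_stdSimplex _ fun z => law_nonneg (hJ.nonneg u) _ _,
    fun x y hxy u z₁ z₂ => ?_, fun x y hxy u z₁ z₂ => ?_, fun x y hxy z₁ z₂ => ?_⟩⟩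
  -- Both sides agree after multiplication by `q (x, y) ≠ 0`; the cancelled identity no longer
  -- contains the value of `q`.
  · refine mul_left_cancel₀ hxy ?_
    rw [hfac, hprivA, hQdef]
    ring
  · refine mul_left_cancel₀ hxy ?_
    rw [hfac, hprivB, hQdef]
    ring
  · refine mul_left_cancel₀ hxy ?_
    rw [Finset.mul_sum]
    simp only [hfac]
    simpa [hQdef] using congrFun hJ.sum_eq (x, y, z₁, z₂)

/-! Independent repetition of a letter protocol. -/

namespace LetterProtocol

variable {r : ℕ} {q : X × Y → ℝ} {κ : X × Y → Z₁ × Z₂ → ℝ} (ρ : LetterProtocol r q κ)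

/-- A protocol that runs `n` copies of a letter protocol in parallel. -/
noncomputable def repeated (n K : ℕ) : Protocol X Y Z₁ Z₂ n r K where
  -- `finFunctionFinEquiv` codes an `n`-tuple of letter messages as one message; the common
  -- randomness is ignored.
  m i := ρ.c i ^ n
  encA i x _ b a := ∏ t, ρ.encA i (x t) (fun j => finFunctionFinEquiv.symm (b j) t)
    (finFunctionFinEquiv.symm a t)
  encB i y _ b a := ∏ t, ρ.encB i (y t) (fun j => finFunctionFinEquiv.symm (b j) t)
    (finFunctionFinEquiv.symm a t)
  decA x _ u z := ∏ t, ρ.decA (x t) (fun j => finFunctionFinEquiv.symm (u j) t) (z t)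
  decB y _ u z := ∏ t, ρ.decB (y t) (fun j => finFunctionFinEquiv.symm (u j) t) (z t)
  encA_pmf i _ x _ b := by
    refine ⟨fun a => Finset.prod_nonneg fun t _ => (ρ.encA_pmf i _ _).1 _, ?_⟩
    rw [finFunctionFinEquiv.symm.sum_comp fun v => ∏ t, ρ.encA i (x t)
      (fun j => finFunctionFinEquiv.symm (b j) t) (v t), sum_pi_prod fun t a => ρ.encA i (x t)
      (fun j => finFunctionFinEquiv.symm (b j) t) a]
    exact Finset.prod_eq_one fun t _ => (ρ.encA_pmf i _ _).2
  encB_pmf i _ y _ b := by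
    refine ⟨fun a => Finset.prod_nonneg fun t _ => (ρ.encB_pmf i _ _).1 _, ?_⟩
    rw [finFunctionFinEquiv.symm.sum_comp fun v => ∏ t, ρ.encB i (y t)
      (fun j => finFunctionFinEquiv.symm (b j) t) (v t), sum_pi_prod fun t a => ρ.encB i (y t)
      (fun j => finFunctionFinEquiv.symm (b j) t) a]
    exact Finset.prod_eq_one fun t _ => (ρ.encB_pmf i _ _).2
  decA_pmf x _ u := by
    refine ⟨fun a => Finset.prod_nonneg fun t _ => (ρ.decA_pmf _ _).1 _, ?_⟩
    rw [sum_pi_prod fun t z => ρ.decA (x t) (fun j => finFunctionFinEquiv.symm (u j) t) z]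
    exact Finset.prod_eq_one fun t _ => (ρ.decA_pmf _ _).2
  decB_pmf y _ u := by
    refine ⟨fun a => Finset.prod_nonneg fun t _ => (ρ.decB_pmf _ _).1 _, ?_⟩
    rw [sum_pi_prod fun t z => ρ.decB (y t) (fun j => finFunctionFinEquiv.symm (u j) t) z]
    exact Finset.prod_eq_one fun t _ => (ρ.decB_pmf _ _).2

/-- The messages of the single copies. -/
def messagesEquiv (c : Fin r → ℕ) (n : ℕ) :
    ((j : Fin r) → Fin (c j ^ n)) ≃ (Fin n → (j : Fin r) → Fin (c j)) :=
  (Equiv.piCongrRight fun _ => finFunctionFinEquiv.symm).trans (Equiv.piComm _)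

/-- The transition probabilities of a letter protocol. -/
noncomputable def trans (x : X) (y : Y) (u : (j : Fin r) → Fin (ρ.c j)) (z₁ : Z₁) (z₂ : Z₂) : ℝ :=
  (∏ i : Fin r, if Even (i : ℕ) then ρ.encA i x (past u i) (u i)
    else ρ.encB i y (past u i) (u i)) * ρ.decA x u z₁ * ρ.decB y u z₂

theorem induced_repeated (q' : X × Y → ℝ) {n K : ℕ}
    (ω : Outcome X Y Z₁ Z₂ n K (ρ.repeated n K).m) :
    (ρ.repeated n K).induced q' ω = (K : ℝ)⁻¹ * ∏ t, q' (ω.x t, ω.y t) *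
      ρ.trans (ω.x t) (ω.y t) (messagesEquiv ρ.c n ω.msg t) (ω.z₁ t) (ω.z₂ t) := by
  have h : (∏ i : Fin r, if Even (i : ℕ) then
        (ρ.repeated n K).encA i ω.x ω.w (past ω.msg i) (ω.msg i)
      else (ρ.repeated n K).encB i ω.y ω.w (past ω.msg i) (ω.msg i)) =
      ∏ t, ∏ i : Fin r, if Even (i : ℕ) then
        ρ.encA i (ω.x t) (past (messagesEquiv ρ.c n ω.msg t) i) (messagesEquiv ρ.c n ω.msg t i)
      else ρ.encB i (ω.y t) (past (messagesEquiv ρ.c n ω.msg t) i)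
        (messagesEquiv ρ.c n ω.msg t i) := by
    rw [Finset.prod_comm]
    refine Finset.prod_congr rfl fun i _ => ?_
    split_ifs <;> rfl
  rw [Protocol.induced, h]
  simp only [trans, Finset.prod_mul_distrib]
  simp only [mul_assoc]
  rfl

/-- The identities of `ρ` hold where `q' ≠ 0`, and elsewhere both sides carry the factor zero. Each
user's view then factors as required by `condMutualInfo_eq_zero`, with `privA` or `privB` as the
factor of the messages. -/
theorem secureWithin_repeated {q' : X × Y → ℝ} (hq' : ∀ a, 0 ≤ q' a)
    (hsupp : Function.support q' ⊆ Function.support q) {n K : ℕ} (hK : 1 ≤ K) :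
    (ρ.repeated n K).SecureWithin q' κ 0 := by
  classical
  have hK' : (K : ℝ) ≠ 0 := by positivity
  have hne : ∀ x y, q' (x, y) = 0 ∨ q (x, y) ≠ 0 := fun x y =>
    or_iff_not_imp_left.2 fun h => hsupp h
  have hA : ∀ x y u z₁ z₂, q' (x, y) * ρ.trans x y u z₁ z₂ =
      q' (x, y) * κ (x, y) (z₁, z₂) * ρ.privA u (x, z₁) := fun x y u z₁ z₂ => by
    rcases hne x y with h | h
    · simp [h]
    · rw [trans, ρ.eq_privA x y h]
      ring
  have hB : ∀ x y u z₁ z₂, q' (x, y) * ρ.trans x y u z₁ z₂ =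
      q' (x, y) * κ (x, y) (z₁, z₂) * ρ.privB u (y, z₂) := fun x y u z₁ z₂ => by
    rcases hne x y with h | h
    · simp [h]
    · rw [trans, ρ.eq_privB x y h]
      ring
  have hS : ∀ x y z₁ z₂, ∑ u, q' (x, y) * ρ.trans x y u z₁ z₂ =
      q' (x, y) * κ (x, y) (z₁, z₂) := fun x y z₁ z₂ => by
    rcases hne x y with h | h
    · simp [h]
    · rw [← Finset.mul_sum]
      exact congrArg _ (ρ.sum_eq x y h z₁ z₂)
  have hlaw : ∀ a : (Fin n → X) × (Fin n → Y) × (Fin n → Z₁) × (Fin n → Z₂),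
      law ((ρ.repeated n K).induced q') (fun ω => (ω.x, ω.y, ω.z₁, ω.z₂)) a =
        ∏ t, q' (a.1 t, a.2.1 t) * κ (a.1 t, a.2.1 t) (a.2.2.1 t, a.2.2.2 t) := by
    rintro ⟨x, y, z₁, z₂⟩
    rw [law_apply, sum_outcome]
    simp only [Prod.mk.injEq, ite_and, Finset.sum_ite_irrel, Finset.sum_const_zero,
      Finset.sum_ite_eq', Finset.mem_univ, if_true, induced_repeated, Finset.sum_const,
      Finset.card_univ, Fintype.card_fin, nsmul_eq_mul, ← Finset.mul_sum]
    rw [mul_inv_cancel_left₀ hK']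
    have h := (messagesEquiv ρ.c n).sum_comp fun v =>
      ∏ t, q' (x t, y t) * ρ.trans (x t) (y t) (v t) (z₁ t) (z₂ t)
    refine h.trans ?_
    rw [sum_pi_prod fun t u => q' (x t, y t) * ρ.trans (x t) (y t) u (z₁ t) (z₂ t)]
    simp only [hS]
  have hnn := (ρ.repeated n K).induced_nonneg hq'
  refine ⟨?_, ?_, ?_⟩
  · simp [hlaw]
  · rw [condMutualInfo_eq_zero hnn _ _ _
      (fun b c => ∏ t, q' (c.1 t, b.1 t) * κ (c.1 t, b.1 t) (c.2 t, b.2 t))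
      (fun a c => (K : ℝ)⁻¹ * ∏ t, ρ.privA (messagesEquiv ρ.c n a.1 t) (c.1 t, c.2 t)), mul_zero]
    rintro ⟨u, w⟩ ⟨y, z₂⟩ ⟨x, z₁⟩
    have h := law_comp_of_injective ((ρ.repeated n K).induced q') (fun ω => ω)
      (f := fun ω => ((ω.msg, ω.w), (ω.y, ω.z₂), (ω.x, ω.z₁)))
      (fun ω ω' h => by simp only [Prod.mk.injEq] at h; ext1 <;> tauto) ⟨w, x, y, u, z₁, z₂⟩
    rw [law_id] at h
    refine h.trans ?_
    rw [induced_repeated, mul_left_comm, ← Finset.prod_mul_distrib]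
    simp only [hA]
  · rw [condMutualInfo_eq_zero hnn _ _ _
      (fun b c => ∏ t, q' (b.1 t, c.1 t) * κ (b.1 t, c.1 t) (b.2 t, c.2 t))
      (fun a c => (K : ℝ)⁻¹ * ∏ t, ρ.privB (messagesEquiv ρ.c n a.1 t) (c.1 t, c.2 t)), mul_zero]
    rintro ⟨u, w⟩ ⟨x, z₁⟩ ⟨y, z₂⟩
    have h := law_comp_of_injective ((ρ.repeated n K).induced q') (fun ω => ω)
      (f := fun ω => ((ω.msg, ω.w), (ω.x, ω.z₁), (ω.y, ω.z₂)))
      (fun ω ω' h => by simp only [Prod.mk.injEq] at h; ext1 <;> tauto) ⟨w, x, y, u, z₁, z₂⟩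
    rw [law_id] at h
    refine h.trans ?_
    rw [induced_repeated, mul_left_comm, ← Finset.prod_mul_distrib]
    simp only [hB]

end LetterProtocol

end

end SecureComputation

/-! ### The cycle of implications. -/

open SecureComputation in
theorem theorem1 {X Y Z₁ Z₂ : Type*} [Fintype X] [Fintype Y] [Fintype Z₁] [Fintype Z₂]
    (q : X × Y → ℝ) (hq : q ∈ stdSimplex ℝ (X × Y))
    (κ : X × Y → Z₁ × Z₂ → ℝ) (hκ : ∀ a, κ a ∈ stdSimplex ℝ (Z₁ × Z₂))
    (r : ℕ) (hr : 1 ≤ r) (K : ℕ → ℕ) (hK : ∀ n, 1 ≤ K n) :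
    ((SecureComputation.AsymptoticallySecurelyComputable r K q κ ↔
        SecureComputation.HasAuxiliaries r q κ) ∧
      (SecureComputation.AsymptoticallySecurelyComputable r K q κ ↔
        SecureComputation.PerfectlySecurelyComputable r K q κ) ∧
      (SecureComputation.AsymptoticallySecurelyComputable r K q κ ↔
        SecureComputation.SecurelyComputableAtSomeBlocklength r K q κ)) ∧
    (SecureComputation.AsymptoticallySecurelyComputable r K q κ →
      ∀ q' : X × Y → ℝ, q' ∈ stdSimplex ℝ (X × Y) →
        Function.support q' ⊆ Function.support q →
        SecureComputation.AsymptoticallySecurelyComputable r K q' κ) := by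
  have hab : AsymptoticallySecurelyComputable r K q κ →
      SecurelyComputableAtSomeBlocklength r K q κ := by
    rintro ⟨π, hπ⟩ ε hε
    obtain ⟨N, hN⟩ := hπ ε hε
    exact ⟨max N 1, le_max_right _ _, π _, hN _ (le_max_left _ _)⟩
  have hcb : PerfectlySecurelyComputable r K q κ →
      SecurelyComputableAtSomeBlocklength r K q κ := by
    rintro ⟨π, h1, h2, h3⟩ ε hε
    have hle : ((1 : ℕ) : ℝ) * 0 ≤ ((1 : ℕ) : ℝ) * ε :=
      mul_le_mul_of_nonneg_left hε.le (Nat.cast_nonneg _)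
    exact ⟨1, le_rfl, π, h1.trans hε.le, h2.trans hle, h3.trans hle⟩
  have hbd : SecurelyComputableAtSomeBlocklength r K q κ → HasAuxiliaries r q κ := fun h => by
    obtain ⟨J, hJ⟩ := exists_isAuxiliary_of_securelyComputable hq hκ hr hK h rfl
    exact hasAuxiliaries_of_isAuxiliary rfl hJ
  have hde : HasAuxiliaries r q κ → Nonempty (LetterProtocol r q κ) := fun h => by
    obtain ⟨c, J, hJ⟩ := exists_isAuxiliary_of_hasAuxiliaries hq hκ h
    exact hJ.exists_letterProtocol hq hκ
  -- Used with `q' = q` for the equivalence and with a general `q'` for the transfer to smaller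
  -- supports.
  have hea : ∀ q' : X × Y → ℝ, q' ∈ stdSimplex ℝ (X × Y) →
      Function.support q' ⊆ Function.support q → LetterProtocol r q κ →
      AsymptoticallySecurelyComputable r K q' κ := fun q' hq' hsupp ρ =>
    ⟨fun n => ρ.repeated n (K n), fun ε hε => ⟨0, fun n _ => by
      obtain ⟨h1, h2, h3⟩ := ρ.secureWithin_repeated hq'.1 hsupp (n := n) (hK n)
      have hle : (n : ℝ) * 0 ≤ n * ε := mul_le_mul_of_nonneg_left hε.le (Nat.cast_nonneg _)
      exact ⟨h1.trans hε.le, h2.trans hle, h3.trans hle⟩⟩⟩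
  have had := fun h => hbd (hab h)
  have hda : HasAuxiliaries r q κ → AsymptoticallySecurelyComputable r K q κ := fun h =>
    (hde h).elim (hea q hq le_rfl)
  have hdc : HasAuxiliaries r q κ → PerfectlySecurelyComputable r K q κ := fun h =>
    (hde h).elim fun ρ => ⟨ρ.repeated 1 (K 1), ρ.secureWithin_repeated hq.1 le_rfl (hK 1)⟩
  exact ⟨⟨⟨had, hda⟩, ⟨fun h => hdc (had h), fun h => hda (hbd (hcb h))⟩,
    ⟨hab, fun h => hda (hbd h)⟩⟩,
    fun h q' hq' hsupp => (hde (had h)).elim (hea q' hq' hsupp)⟩
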